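/- Let $k$ be a field and let $Q$ be a finite quiver with vertex set $Q_0$ and arrow set $Q_1$; write $s(\alpha), t(\alpha)$ for the source and target of an arrow $\alpha$. Let $kQ$ be the path algebra (paths are composed like maps, and representations of $Q$ are left $kQ$-modules), let $J$ be the ideal generated by the arrows, and let $\Lambda = kQ/J^2$. Let $Q^{\mathrm{op}}$ be the opposite quiver, with reversed arrows $\alpha^*\colon t(\alpha)\to s(\alpha)$ for $\alpha \in Q_1$, and let $kQ_0$ also denote the semisimple $kQ^{\mathrm{op}}$-module $kQ^{\mathrm{op}}/J^{\mathrm{op}}$, where $J^{\mathrm{op}}$ is the ideal generated by the arrows. A differential projective $\Lambda$-module is a (not necessarily finitely generated) projective $\Lambda$-module $M$ with an endomorphism $d$ such that $d^2=0$. Its morphisms are the $\Lambda$-linear maps commuting with the differentials; such a map $f\colon (M,d)\to(N,\delta)$ is null homotopic if $f = rd+\delta r$ for some $\Lambda$-linear map $r\colon M\to N$. The homotopy category has the differential projective $\Lambda$-modules as objects and the morphisms modulo null-homotopic ones as morphisms. An object $M$ of it is compact if for every set $\{T_\lambda\}$ of objects the natural map $\coprod_\lambda \mathrm{Hom}(M,T_\lambda)\to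 \mathrm{Hom}(M,\coprod_\lambda T_\lambda)$ is bijective. $(M,d)$ is contractible if its identity map is null homotopic, reduced if it has no nonzero contractible direct summand, and exact if $\mathrm{Ker}\, d=\mathrm{Im}\, d$. If $(M,d)$ is a reduced differential projective $\Lambda$-module, then $d(M)\subseteq \mathrm{rad}\,M$, and $F(M)$ denotes the following $kQ^{\mathrm{op}}$-module: its underlying vector space is $M/\mathrm{rad}\, M$, with $F(M)_i=(M/\mathrm{rad}\,M)_i$ for each vertex $i$, and the arrows $\alpha^*$ act by the unique $k$-linear maps $F(M)_{\alpha^*}\colon (M/\mathrm{rad}\,M)_{t(\alpha)}\to (M/\mathrm{rad}\,M)_{s(\alpha)}$ such that $$d(x)=\sum_{\alpha\in Q_1,\ t(\alpha)=i}\alpha\, y_\alpha$$ for all $i\in Q_0$ and $x\in M_i$, where $y_\alpha\in M$ is any lift of $F(M)_{\alpha^*}(x+\mathrm{rad}\,M)$. Let $M$ be a reduced differential projective $\Lambda$-module. Then: 1. $M$ is finite dimensional over $k$ if and only if $F(M)$ is finite dimensional over $k$. 2. $M$ is compact in the homotopy category of differential projective $\Lambda$-modules if and only if the $kQ^{\mathrm{op}}$-module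 $F(M)$ is finitely presented. 3. $M$ is exact if and only if $\mathrm{Ext}^n_{kQ^{\mathrm{op}}}(kQ_0,F(M))=0$ for $n=0,1$. -/

import Mathlib

open CategoryTheory

universe u

/-- All paths of a quiver, trivial paths included, with their source and target. -/
abbrev QuiverPath (V : Type u) [Quiver.{u} V] : Type u :=
  Σ i j : V, Quiver.Path i j

/-- The path algebra `kQ` of a quiver with vertex set `V`: the vector space with basis the
set of all paths.  The product `q * p` of two paths is the path `p` followed by the path `q`. -/
def PathAlgebra (k V : Type u) [Field k] [Quiver.{u} V] : Type u :=
  QuiverPath V →₀ k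

namespace PathAlgebra

section Basic

variable {k V : Type u} [Field k] [Quiver.{u} V]

noncomputable instance : AddCommGroup (PathAlgebra k V) :=
  inferInstanceAs (AddCommGroup (QuiverPath V →₀ k))

noncomputable instance : Module k (PathAlgebra k V) :=
  inferInstanceAs (Module k (QuiverPath V →₀ k))

variable (k V) in
/-- The basis of the path algebra that consists of the paths. -/
noncomputable def basis : Module.Basis (QuiverPath V) k (PathAlgebra k V) :=
  Module.Basis.ofRepr (LinearEquiv.refl k (QuiverPath V →₀ k))

/-- The basis element of the path algebra given by a path. -/
noncomputable def ofPath {i j : V} (p : Quiver.Path i j) : PathAlgebra k V :=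
  basis k V ⟨i, j, p⟩

/-- The element of the path algebra given by an arrow. -/
noncomputable def arrow {i j : V} (a : i ⟶ j) : PathAlgebra k V := ofPath a.toPath

/-- The trivial path at a vertex. -/
noncomputable def vertex (i : V) : PathAlgebra k V := ofPath (Quiver.Path.nil : Quiver.Path i i)

open Classical in
/-- The product `q * p` of two paths: `p` followed by `q` if `p` ends where `q` starts,
and zero otherwise. -/
noncomputable def pathMul (q p : QuiverPath V) : PathAlgebra k V :=
  if h : q.1 = p.2.1 then ofPath (p.2.2.comp (q.2.2.cast h rfl)) else 0

/-- The multiplication of the path algebra, as the bilinear extension of the product of paths. -/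
noncomputable def mulHom : PathAlgebra k V →ₗ[k] PathAlgebra k V →ₗ[k] PathAlgebra k V :=
  (basis k V).constr k fun q => (basis k V).constr k fun p => pathMul q p

noncomputable instance : Mul (PathAlgebra k V) := ⟨fun x y => mulHom x y⟩

lemma mul_def (x y : PathAlgebra k V) : x * y = mulHom x y := rfl

lemma ofPath_mul_ofPath {i j l : V} (q : Quiver.Path j l) (p : Quiver.Path i j) :
    ofPath (k := k) q * ofPath p = ofPath (p.comp q) := by
  have h : mulHom (ofPath (k := k) q) (ofPath p) = pathMul ⟨j, l, q⟩ ⟨i, j, p⟩ := by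
    simp only [mulHom, ofPath, Module.Basis.constr_basis]
  rw [mul_def, h, pathMul, dif_pos rfl]
  rfl

lemma ofPath_mul_ofPath_of_ne {i j i' j' : V} (q : Quiver.Path i j) (p : Quiver.Path i' j')
    (h : i ≠ j') : ofPath (k := k) q * ofPath p = 0 := by
  simp only [mul_def, mulHom, ofPath, Module.Basis.constr_basis, pathMul]
  rw [dif_neg h]

@[elab_as_elim]
protected lemma path_induction {P : PathAlgebra k V → Prop} (x : PathAlgebra k V)
    (path : ∀ {i j : V} (p : Quiver.Path i j), P (ofPath p)) (zero : P 0)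
    (add : ∀ x y, P x → P y → P (x + y)) (smul : ∀ (c : k) x, P x → P (c • x)) : P x := by
  have hx : x ∈ Submodule.span k (Set.range (basis k V)) := by
    rw [(basis k V).span_eq]; trivial
  refine Submodule.span_induction ?_ zero (fun x y _ _ => add x y) (fun c x _ => smul c x) hx
  rintro _ ⟨p, rfl⟩
  exact path p.2.2

protected lemma mul_add' (x y z : PathAlgebra k V) : x * (y + z) = x * y + x * z := by
  simp [mul_def]

protected lemma add_mul' (x y z : PathAlgebra k V) : (x + y) * z = x * z + y * z := by
  simp [mul_def]

protected lemma zero_mul' (x : PathAlgebra k V) : 0 * x = 0 := by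
  simp [mul_def]

protected lemma mul_zero' (x : PathAlgebra k V) : x * 0 = 0 := by
  simp [mul_def]

protected lemma smul_mul' (c : k) (x y : PathAlgebra k V) : c • x * y = c • (x * y) := by
  simp [mul_def]

protected lemma mul_smul' (c : k) (x y : PathAlgebra k V) : x * c • y = c • (x * y) := by
  simp [mul_def]

protected lemma mul_assoc' (x y z : PathAlgebra k V) : x * y * z = x * (y * z) := by
  induction x using PathAlgebra.path_induction with
  | zero => simp only [PathAlgebra.zero_mul']
  | add a b ha hb => simp only [PathAlgebra.add_mul', ha, hb]
  | smul c a ha => simp only [PathAlgebra.smul_mul', ha]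
  | @path i j p =>
  induction y using PathAlgebra.path_induction with
  | zero => simp only [PathAlgebra.zero_mul', PathAlgebra.mul_zero']
  | add a b ha hb => simp only [PathAlgebra.add_mul', PathAlgebra.mul_add', ha, hb]
  | smul c a ha => simp only [PathAlgebra.smul_mul', PathAlgebra.mul_smul', ha]
  | @path i' j' q =>
  induction z using PathAlgebra.path_induction with
  | zero => simp only [PathAlgebra.mul_zero']
  | add a b ha hb => simp only [PathAlgebra.mul_add', ha, hb]
  | smul c a ha => simp only [PathAlgebra.mul_smul', ha]
  | @path i'' j'' r =>
  by_cases h : i = j'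
  · subst h
    by_cases h' : i' = j''
    · subst h'
      simp only [ofPath_mul_ofPath, Quiver.Path.comp_assoc]
    · rw [ofPath_mul_ofPath, ofPath_mul_ofPath_of_ne _ _ h', ofPath_mul_ofPath_of_ne _ _ h',
        PathAlgebra.mul_zero']
  · rw [ofPath_mul_ofPath_of_ne _ _ h, PathAlgebra.zero_mul']
    by_cases h' : i' = j''
    · subst h'
      rw [ofPath_mul_ofPath, ofPath_mul_ofPath_of_ne _ _ h]
    · rw [ofPath_mul_ofPath_of_ne _ _ h', PathAlgebra.mul_zero']

lemma vertex_mul_ofPath {i j : V} (p : Quiver.Path i j) :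
    vertex (k := k) j * ofPath p = ofPath p := by
  rw [vertex, ofPath_mul_ofPath, Quiver.Path.comp_nil]

lemma ofPath_mul_vertex {i j : V} (p : Quiver.Path i j) :
    ofPath (k := k) p * vertex i = ofPath p := by
  rw [vertex, ofPath_mul_ofPath, Quiver.Path.nil_comp]

lemma arrow_mul_ofPath {i j l : V} (p : Quiver.Path i j) (a : j ⟶ l) :
    arrow (k := k) a * ofPath p = ofPath (p.cons a) := by
  rw [arrow, ofPath_mul_ofPath]
  rfl

variable [Fintype V]

noncomputable instance : One (PathAlgebra k V) := ⟨∑ i, vertex i⟩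

lemma one_def : (1 : PathAlgebra k V) = ∑ i, vertex i := rfl

protected lemma one_mul' (x : PathAlgebra k V) : 1 * x = x := by
  induction x using PathAlgebra.path_induction with
  | zero => simp only [PathAlgebra.mul_zero']
  | add a b ha hb => simp only [PathAlgebra.mul_add', ha, hb]
  | smul c a ha => simp only [PathAlgebra.mul_smul', ha]
  | @path i j p =>
    rw [one_def, mul_def, map_sum, LinearMap.sum_apply, Finset.sum_eq_single j]
    · exact vertex_mul_ofPath p
    · intro l _ hl
      exact ofPath_mul_ofPath_of_ne _ _ hl
    · simp

protected lemma mul_one' (x : PathAlgebra k V) : x * 1 = x := by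
  induction x using PathAlgebra.path_induction with
  | zero => simp only [PathAlgebra.zero_mul']
  | add a b ha hb => simp only [PathAlgebra.add_mul', ha, hb]
  | smul c a ha => simp only [PathAlgebra.smul_mul', ha]
  | @path i j p =>
    rw [one_def, mul_def, map_sum, Finset.sum_eq_single i]
    · exact ofPath_mul_vertex p
    · intro l _ hl
      exact ofPath_mul_ofPath_of_ne _ _ hl.symm
    · simp

noncomputable instance : Ring (PathAlgebra k V) :=
  { (inferInstance : AddCommGroup (PathAlgebra k V)),
    (inferInstance : Mul (PathAlgebra k V)),
    (inferInstance : One (PathAlgebra k V)) with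
    left_distrib := PathAlgebra.mul_add'
    right_distrib := PathAlgebra.add_mul'
    zero_mul := PathAlgebra.zero_mul'
    mul_zero := PathAlgebra.mul_zero'
    mul_assoc := PathAlgebra.mul_assoc'
    one_mul := PathAlgebra.one_mul'
    mul_one := PathAlgebra.mul_one' }

noncomputable instance : Algebra k (PathAlgebra k V) :=
  Algebra.ofModule PathAlgebra.smul_mul' PathAlgebra.mul_smul'

variable (k V) in
/-- The arrow ideal `J` of the path algebra: the two-sided ideal generated by all arrows. -/
noncomputable def arrowIdeal : Ideal (PathAlgebra k V) :=
  (TwoSidedIdeal.span {x : PathAlgebra k V | ∃ (i j : V) (a : i ⟶ j), x = arrow a}).asIdeal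

instance : (arrowIdeal k V).IsTwoSided :=
  inferInstanceAs (TwoSidedIdeal.asIdeal _).IsTwoSided

lemma arrow_mem {i j : V} (a : i ⟶ j) : arrow a ∈ arrowIdeal k V :=
  TwoSidedIdeal.subset_span ⟨i, j, a, rfl⟩

end Basic

section Lift

/-- Images of the trivial paths and of the arrows under an algebra map out of the path algebra. -/
structure LiftData (V : Type u) [Quiver.{u} V] [Fintype V] (B : Type*) [Ring B] where
  e : V → B
  f : ∀ {i j : V}, (i ⟶ j) → B
  idem : ∀ i, e i * e i = e i
  orth : ∀ i j, i ≠ j → e i * e j = 0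
  one : ∑ i, e i = 1
  left : ∀ {i j : V} (a : i ⟶ j), e j * f a = f a
  right : ∀ {i j : V} (a : i ⟶ j), f a * e i = f a

variable {k V : Type u} [Field k] [Quiver.{u} V] [Fintype V]
variable {B : Type*} [Ring B] [Algebra k B] (D : LiftData V B)

/-- The value on a path: the product of the values on its arrows. -/
def LiftData.eval {i : V} : ∀ {j : V}, Quiver.Path i j → B
  | _, Quiver.Path.nil => D.e i
  | _, Quiver.Path.cons p a => D.f a * LiftData.eval p

lemma LiftData.e_mul_eval {i j : V} (p : Quiver.Path i j) : D.e j * D.eval p = D.eval p := by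
  cases p with
  | nil => exact D.idem i
  | cons p a => rw [LiftData.eval, ← mul_assoc, D.left]

lemma LiftData.eval_mul_e {i j : V} (p : Quiver.Path i j) : D.eval p * D.e i = D.eval p := by
  induction p with
  | nil => exact D.idem i
  | cons p a ih => rw [LiftData.eval, mul_assoc, ih]

lemma LiftData.eval_comp {i j l : V} (p : Quiver.Path i j) (q : Quiver.Path j l) :
    D.eval (p.comp q) = D.eval q * D.eval p := by
  induction q with
  | nil => exact (D.e_mul_eval p).symm
  | cons q a ih => rw [Quiver.Path.comp_cons, LiftData.eval, LiftData.eval, ih, mul_assoc]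

/-- The linear map that sends a path to the product of the values of its arrows. -/
noncomputable def LiftData.linear : PathAlgebra k V →ₗ[k] B :=
  (basis k V).constr k fun p => D.eval p.2.2

lemma LiftData.linear_ofPath {i j : V} (p : Quiver.Path i j) :
    D.linear (k := k) (ofPath p) = D.eval p := by
  rw [LiftData.linear, ofPath, Module.Basis.constr_basis]

lemma LiftData.linear_mul (x y : PathAlgebra k V) :
    D.linear (x * y) = D.linear x * D.linear y := by
  induction x using PathAlgebra.path_induction with
  | zero => simp
  | add a b ha hb => simp only [add_mul, map_add, ha, hb]
  | smul c a ha => simp only [smul_mul_assoc, map_smul, ha]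
  | @path i j p =>
  induction y using PathAlgebra.path_induction with
  | zero => simp
  | add a b ha hb => simp only [mul_add, map_add, ha, hb]
  | smul c a ha => simp only [mul_smul_comm, map_smul, ha]
  | @path i' j' q =>
  by_cases h : i = j'
  · subst h
    simp only [ofPath_mul_ofPath, D.linear_ofPath, D.eval_comp]
  · rw [ofPath_mul_ofPath_of_ne _ _ h, map_zero, D.linear_ofPath, D.linear_ofPath,
      ← D.eval_mul_e p, ← D.e_mul_eval q, mul_assoc, ← mul_assoc (D.e i), D.orth _ _ h, zero_mul,
      mul_zero]

/-- The algebra map out of the path algebra with given values on vertices and arrows. -/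
noncomputable def lift : PathAlgebra k V →ₐ[k] B :=
  AlgHom.ofLinearMap D.linear
    (by rw [one_def, map_sum, ← D.one]
        exact Finset.sum_congr rfl fun i _ => D.linear_ofPath _)
    D.linear_mul

lemma lift_ofPath {i j : V} (p : Quiver.Path i j) : lift (k := k) D (ofPath p) = D.eval p :=
  D.linear_ofPath p

lemma lift_vertex (i : V) : lift (k := k) D (vertex i) = D.e i := lift_ofPath D _

lemma lift_arrow {i j : V} (a : i ⟶ j) : lift (k := k) D (arrow a) = D.f a := by
  rw [arrow, lift_ofPath]
  exact D.right a

end Lift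

section Filtration

variable {k V : Type u} [Field k] [Quiver.{u} V] [Fintype V]

variable (k V) in
/-- The span of the paths of length at least `n`. -/
noncomputable def filt (n : ℕ) : Submodule k (PathAlgebra k V) :=
  Submodule.span k {x | ∃ (i j : V) (p : Quiver.Path i j), n ≤ p.length ∧ x = ofPath p}

lemma ofPath_mem_filt {n : ℕ} {i j : V} (p : Quiver.Path i j) (h : n ≤ p.length) :
    ofPath p ∈ filt k V n :=
  Submodule.subset_span ⟨i, j, p, h, rfl⟩

lemma mem_filt_zero (x : PathAlgebra k V) : x ∈ filt k V 0 := by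
  induction x using PathAlgebra.path_induction with
  | zero => exact zero_mem _
  | add a b ha hb => exact add_mem ha hb
  | smul c a ha => exact Submodule.smul_mem _ c ha
  | path p => exact ofPath_mem_filt p (Nat.zero_le _)

lemma mul_mem_filt {m n : ℕ} {x y : PathAlgebra k V} (hx : x ∈ filt k V m) (hy : y ∈ filt k V n) :
    x * y ∈ filt k V (m + n) := by
  have h := Submodule.mul_mem_mul hx hy
  rw [filt, filt, Submodule.span_mul_span] at h
  refine Submodule.span_induction (p := fun z _ => z ∈ filt k V (m + n)) ?_ (zero_mem _)
    (fun _ _ _ _ => add_mem) (fun c _ _ => Submodule.smul_mem _ c) h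
  rintro _ ⟨_, ⟨i, j, p, hp, rfl⟩, _, ⟨i', j', q, hq, rfl⟩, rfl⟩
  by_cases h : i = j'
  · subst h
    simp only [ofPath_mul_ofPath]
    refine ofPath_mem_filt _ ?_
    rw [Quiver.Path.length_comp]
    omega
  · simp only [ofPath_mul_ofPath_of_ne _ _ h]
    exact zero_mem _

lemma mem_filt_one_of_mem_arrowIdeal {x : PathAlgebra k V} (hx : x ∈ arrowIdeal k V) :
    x ∈ filt k V 1 := by
  have h : x ∈ TwoSidedIdeal.span
      {x : PathAlgebra k V | ∃ (i j : V) (a : i ⟶ j), x = arrow a} := hx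
  rw [TwoSidedIdeal.mem_span_iff] at h
  have hadd : ∀ {x y : PathAlgebra k V}, x ∈ (filt k V 1 : Set (PathAlgebra k V)) →
      y ∈ (filt k V 1 : Set (PathAlgebra k V)) → x + y ∈ (filt k V 1 : Set (PathAlgebra k V)) :=
    fun {x y} hx hy => (filt k V 1).add_mem hx hy
  have hneg : ∀ {x : PathAlgebra k V}, x ∈ (filt k V 1 : Set (PathAlgebra k V)) →
      -x ∈ (filt k V 1 : Set (PathAlgebra k V)) :=
    fun {x} hx => (filt k V 1).neg_mem hx
  have hleft : ∀ {x y : PathAlgebra k V}, y ∈ (filt k V 1 : Set (PathAlgebra k V)) →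
      x * y ∈ (filt k V 1 : Set (PathAlgebra k V)) := by
    intro x y hy
    have := mul_mem_filt (mem_filt_zero x) hy
    rwa [zero_add] at this
  have hright : ∀ {x y : PathAlgebra k V}, x ∈ (filt k V 1 : Set (PathAlgebra k V)) →
      x * y ∈ (filt k V 1 : Set (PathAlgebra k V)) := by
    intro x y hx
    have := mul_mem_filt hx (mem_filt_zero y)
    rwa [add_zero] at this
  have := h (TwoSidedIdeal.mk' _ (filt k V 1).zero_mem hadd hneg hleft hright) ?_
  · rwa [TwoSidedIdeal.mem_mk'] at this
  · rintro _ ⟨i, j, a, rfl⟩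
    rw [SetLike.mem_coe, TwoSidedIdeal.mem_mk']
    exact ofPath_mem_filt _ le_rfl

lemma arrowIdeal_sq : arrowIdeal k V ^ 2 = arrowIdeal k V * arrowIdeal k V := by
  have h := Ideal.IsTwoSided.pow_succ (I := arrowIdeal k V) (n := 1)
  rwa [Submodule.pow_one] at h

lemma mem_filt_two_of_mem_sq {x : PathAlgebra k V} (hx : x ∈ arrowIdeal k V ^ 2) :
    x ∈ filt k V 2 := by
  rw [arrowIdeal_sq] at hx
  refine Submodule.smul_induction_on hx ?_ (fun _ _ => add_mem)
  intro a ha b hb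
  exact mul_mem_filt (m := 1) (n := 1) (mem_filt_one_of_mem_arrowIdeal ha)
    (mem_filt_one_of_mem_arrowIdeal hb)

lemma ofPath_mem_sq {i j : V} (p : Quiver.Path i j) (h : 2 ≤ p.length) :
    ofPath p ∈ arrowIdeal k V ^ 2 := by
  cases p with
  | nil => simp at h
  | cons p b =>
    cases p with
    | nil => simp at h
    | cons p a =>
      rw [← arrow_mul_ofPath, ← arrow_mul_ofPath, arrowIdeal_sq]
      exact Ideal.mul_mem_mul (arrow_mem b) (Ideal.mul_mem_right _ _ (arrow_mem a))

lemma repr_of_mem_filt {n : ℕ} {x : PathAlgebra k V} (hx : x ∈ filt k V n) (p : QuiverPath V)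
    (hp : p.2.2.length < n) : (basis k V).repr x p = 0 := by
  have : filt k V n ≤ LinearMap.ker ((basis k V).coord p) := by
    refine Submodule.span_le.2 ?_
    rintro _ ⟨i, j, q, hq, rfl⟩
    rw [SetLike.mem_coe, LinearMap.mem_ker, Module.Basis.coord_apply, ofPath,
      Module.Basis.repr_self, Finsupp.single_apply_eq_zero]
    rintro rfl
    exact absurd hp (not_lt.2 hq)
  exact this hx

end Filtration

end PathAlgebra

section RadSqZero

variable (k V : Type u) [Field k] [Quiver.{u} V] [Fintype V]

/-- The radical square zero algebra `kQ/J²` of a quiver. -/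
def RadSqZero : Type u := PathAlgebra k V ⧸ (PathAlgebra.arrowIdeal k V ^ 2)

noncomputable instance : Ring (RadSqZero k V) :=
  inferInstanceAs (Ring (PathAlgebra k V ⧸ (PathAlgebra.arrowIdeal k V ^ 2)))

noncomputable instance : Algebra k (RadSqZero k V) :=
  inferInstanceAs (Algebra k (PathAlgebra k V ⧸ (PathAlgebra.arrowIdeal k V ^ 2)))

end RadSqZero

namespace RadSqZero

open PathAlgebra

variable {k V : Type u} [Field k] [Quiver.{u} V] [Fintype V]

/-- The quotient map from `kQ` to `kQ/J²`. -/
noncomputable def mk : PathAlgebra k V →ₐ[k] RadSqZero k V :=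
  Ideal.Quotient.mkₐ k (arrowIdeal k V ^ 2)

lemma mk_surjective : Function.Surjective (mk : PathAlgebra k V →ₐ[k] RadSqZero k V) :=
  Ideal.Quotient.mk_surjective

lemma mk_eq_zero {x : PathAlgebra k V} : mk x = 0 ↔ x ∈ arrowIdeal k V ^ 2 :=
  Ideal.Quotient.eq_zero_iff_mem

/-- The idempotent of `kQ/J²` at a vertex. -/
noncomputable def vertex (i : V) : RadSqZero k V := mk (PathAlgebra.vertex i)

/-- The element of `kQ/J²` given by an arrow. -/
noncomputable def arrow {i j : V} (a : i ⟶ j) : RadSqZero k V :=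
  mk (PathAlgebra.arrow a)

lemma vertex_mul_self (i : V) : (vertex i : RadSqZero k V) * vertex i = vertex i := by
  rw [vertex, ← map_mul]
  congr 1
  exact vertex_mul_ofPath _

lemma vertex_mul_of_ne {i j : V} (h : i ≠ j) : (vertex i : RadSqZero k V) * vertex j = 0 := by
  rw [vertex, vertex, ← map_mul]
  rw [PathAlgebra.vertex, PathAlgebra.vertex, ofPath_mul_ofPath_of_ne _ _ h, map_zero]

lemma sum_vertex : ∑ i, (vertex i : RadSqZero k V) = 1 := by
  rw [← map_one mk, one_def, map_sum]
  rfl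

lemma vertex_mul_arrow {i j : V} (a : i ⟶ j) : vertex j * arrow (k := k) a = arrow a := by
  rw [vertex, arrow, ← map_mul, PathAlgebra.arrow, vertex_mul_ofPath]

lemma arrow_mul_vertex {i j : V} (a : i ⟶ j) : arrow (k := k) a * vertex i = arrow a := by
  rw [vertex, arrow, ← map_mul, PathAlgebra.arrow, ofPath_mul_vertex]

lemma vertex_mul_arrow_of_ne {i j l : V} (a : i ⟶ j) (h : l ≠ j) :
    vertex l * arrow (k := k) a = 0 := by
  rw [← vertex_mul_arrow, ← mul_assoc, vertex_mul_of_ne h, zero_mul]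

lemma arrow_mul_vertex_of_ne {i j l : V} (a : i ⟶ j) (h : i ≠ l) :
    arrow (k := k) a * vertex l = 0 := by
  rw [← arrow_mul_vertex, mul_assoc, vertex_mul_of_ne h, mul_zero]

lemma arrow_mul_arrow {i j i' j' : V} (a : i ⟶ j) (b : i' ⟶ j') :
    arrow (k := k) a * arrow b = 0 := by
  rw [arrow, arrow, ← map_mul, mk_eq_zero, arrowIdeal_sq]
  exact Ideal.mul_mem_mul (arrow_mem a) (arrow_mem b)

open Classical in
/-- The augmentation data: arrows are sent to zero. -/
noncomputable def augData : LiftData V (V → k) where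
  e i := Pi.single i 1
  f _ := 0
  idem i := by rw [← Pi.single_mul, one_mul]
  orth i j h := by
    ext l
    by_cases hl : l = i
    · subst hl; simp [h]
    · simp [hl]
  one := by
    ext l
    simp
  left {_ j} _ := mul_zero (Pi.single j (1 : k) : V → k)
  right {i _} _ := zero_mul (Pi.single i (1 : k) : V → k)

lemma augData_eval {i j : V} (p : Quiver.Path i j) (h : 1 ≤ p.length) :
    (augData : LiftData V (V → k)).eval p = 0 := by
  cases p with
  | nil => simp at h
  | cons p a => exact zero_mul _

lemma lift_augData_of_mem_filt {x : PathAlgebra k V} (hx : x ∈ filt k V 1) :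
    PathAlgebra.lift (k := k) (augData (k := k)) x = 0 := by
  have hle : filt k V 1 ≤ LinearMap.ker (PathAlgebra.lift (k := k) (V := V) (augData (k := k))).toLinearMap := by
    refine Submodule.span_le.2 ?_
    rintro _ ⟨i, j, q, hq, rfl⟩
    rw [SetLike.mem_coe, LinearMap.mem_ker, AlgHom.toLinearMap_apply, lift_ofPath]
    exact augData_eval q hq
  exact hle hx

/-- The augmentation `kQ/J² → kQ/J`, the latter identified with functions on the vertices. -/
noncomputable def aug : RadSqZero k V →ₐ[k] (V → k) :=
  Ideal.Quotient.liftₐ (arrowIdeal k V ^ 2) (PathAlgebra.lift augData) fun _ hx =>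
    lift_augData_of_mem_filt (mem_filt_one_of_mem_arrowIdeal (Ideal.pow_le_self two_ne_zero hx))

open Classical in
lemma aug_vertex (i : V) : aug (vertex i : RadSqZero k V) = Pi.single i 1 :=
  lift_vertex augData i

lemma aug_arrow {i j : V} (a : i ⟶ j) : aug (arrow (k := k) a) = 0 :=
  lift_arrow augData a

/-- The coefficient at an arrow. -/
noncomputable def coeff {i j : V} (a : i ⟶ j) : RadSqZero k V →ₗ[k] k :=
  (((arrowIdeal k V ^ 2).restrictScalars k).liftQ ((basis k V).coord ⟨i, j, a.toPath⟩)
    (fun _ hx => repr_of_mem_filt (mem_filt_two_of_mem_sq hx) _ (Nat.lt_succ_self 1))) ∘ₗ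
  (Submodule.Quotient.restrictScalarsEquiv k (arrowIdeal k V ^ 2)).symm.toLinearMap

lemma coeff_mk {i j : V} (a : i ⟶ j) (x : PathAlgebra k V) :
    coeff a (mk x) = (basis k V).repr x ⟨i, j, a.toPath⟩ := rfl

lemma coeff_vertex {i j : V} (a : i ⟶ j) (l : V) : coeff a (vertex l : RadSqZero k V) = 0 := by
  rw [vertex, coeff_mk, PathAlgebra.vertex, ofPath, Module.Basis.repr_self,
    Finsupp.single_apply_eq_zero]
  intro h
  have := congrArg (fun p : QuiverPath V => p.2.2.length) h
  simp [Quiver.Hom.toPath] at this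

open Classical in
lemma coeff_arrow {i j i' j' : V} (a : i ⟶ j) (b : i' ⟶ j') :
    coeff a (arrow (k := k) b) =
      if (⟨i, j, a⟩ : Σ i j : V, i ⟶ j) = ⟨i', j', b⟩ then 1 else 0 := by
  rw [arrow, coeff_mk, PathAlgebra.arrow, ofPath, Module.Basis.repr_self, Finsupp.single_apply]
  refine if_congr ?_ rfl rfl
  constructor
  · intro h
    cases h
    rfl
  · intro h
    cases h
    rfl

variable [∀ i j : V, Fintype (i ⟶ j)]

lemma decomp (x : RadSqZero k V) :
    x = ∑ i, aug x i • vertex i + ∑ i, ∑ j, ∑ a : i ⟶ j, coeff a x • arrow a := by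
  classical
  obtain ⟨x, rfl⟩ := mk_surjective x
  induction x using PathAlgebra.path_induction with
  | zero => simp
  | add a b ha hb =>
    rw [map_add]
    nth_rewrite 1 [ha, hb]
    simp only [map_add, Pi.add_apply, add_smul, Finset.sum_add_distrib]
    abel
  | smul c a ha =>
    rw [map_smul]
    nth_rewrite 1 [ha]
    simp only [map_smul, Pi.smul_apply, smul_assoc, Finset.smul_sum, smul_add]
  | @path i j p =>
    cases p with
    | nil =>
      change vertex i = ∑ l, aug (vertex i) l • vertex l +
        ∑ i', ∑ j', ∑ a : i' ⟶ j', coeff a (vertex i) • arrow a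
      simp [aug_vertex, coeff_vertex, Pi.single_apply]
    | cons p b =>
      cases p with
      | nil =>
        change arrow b = ∑ l, aug (arrow b) l • vertex l +
          ∑ i', ∑ j', ∑ a : i' ⟶ j', coeff a (arrow b) • arrow a
        simp only [aug_arrow, Pi.zero_apply, zero_smul, Finset.sum_const_zero, zero_add]
        rw [Finset.sum_eq_single i, Finset.sum_eq_single j, Finset.sum_eq_single b]
        · simp [coeff_arrow]
        · intro c _ hc
          simp [coeff_arrow, hc]
        · simp
        · intro j' _ hj
          refine Finset.sum_eq_zero fun c _ => ?_
          rw [coeff_arrow, if_neg, zero_smul]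
          rintro h
          cases h
          exact hj rfl
        · simp
        · intro i' _ hi
          refine Finset.sum_eq_zero fun j' _ => Finset.sum_eq_zero fun c _ => ?_
          rw [coeff_arrow, if_neg, zero_smul]
          rintro h
          cases h
          exact hi rfl
        · simp
      | cons p a =>
        have h : mk (ofPath ((p.cons a).cons b)) = (0 : RadSqZero k V) :=
          mk_eq_zero.2 (ofPath_mem_sq _ (by simp))
        rw [h]
        simp

lemma arrow_mul {i j : V} (a : i ⟶ j) (x : RadSqZero k V) :
    arrow a * x = aug x i • arrow a := by
  classical
  conv_lhs => rw [decomp x]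
  simp only [mul_add, Finset.mul_sum, mul_smul_comm, arrow_mul_arrow, smul_zero,
    Finset.sum_const_zero, add_zero]
  rw [Finset.sum_eq_single i, arrow_mul_vertex]
  · intro l _ hl
    rw [arrow_mul_vertex_of_ne _ hl.symm, smul_zero]
  · simp

end RadSqZero

section Differential

variable {Λ M : Type*} [Ring Λ] [AddCommGroup M] [Module Λ M]

/-- A differential module `(M, d)` is contractible if its identity map is null homotopic. -/
def IsContractibleDiff (d : M →ₗ[Λ] M) : Prop :=
  ∃ r : M →ₗ[Λ] M, (LinearMap.id : M →ₗ[Λ] M) = r ∘ₗ d + d ∘ₗ r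

/-- A differential module `(M, d)` is reduced if it has no nonzero contractible direct summand
(in the category of differential modules, so that both summands are stable under `d`). -/
def IsReducedDiff (d : M →ₗ[Λ] M) : Prop :=
  ∀ (N N' : Submodule Λ M) (hN : ∀ x ∈ N, d x ∈ N) (_ : ∀ x ∈ N', d x ∈ N'),
    IsCompl N N' → IsContractibleDiff (d.restrict hN) → N = ⊥

end Differential

namespace RadSqZero

section Projective

variable {k V : Type u} [Field k] [Quiver.{u} V] [Fintype V]
variable {M : Type*} [AddCommGroup M] [Module (RadSqZero k V) M]

variable [∀ i j : V, Fintype (i ⟶ j)]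

lemma arrow_smul_arrow_smul {i j i' j' : V} (a : i ⟶ j) (b : i' ⟶ j') (c : RadSqZero k V)
    (m : M) : arrow (k := k) a • c • arrow (k := k) b • m = 0 := by
  rw [smul_smul, smul_smul, arrow_mul, smul_mul_assoc, arrow_mul_arrow, smul_zero,
    zero_smul]

lemma arrow_smul_mem_jacobson {i j : V} (a : i ⟶ j) (m : M) :
    arrow (k := k) a • m ∈ Module.jacobson (RadSqZero k V) M := by
  refine Submodule.mem_sInf.2 fun N hN => ?_
  have hN' : IsCoatom N := hN
  by_contra h
  have htop := hN'.2 (N ⊔ Submodule.span (RadSqZero k V) {arrow (k := k) a • m})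
    (left_lt_sup.2 fun hle => h (hle (Submodule.mem_span_singleton_self _)))
  have hm : m ∈ N ⊔ Submodule.span (RadSqZero k V) {arrow (k := k) a • m} := by
    rw [htop]; trivial
  obtain ⟨n, hn, z, hz, rfl⟩ := Submodule.mem_sup.1 hm
  obtain ⟨c, hc⟩ := Submodule.mem_span_singleton.1 hz
  refine h ?_
  rw [smul_add]
  refine add_mem (N.smul_mem _ hn) ?_
  rw [← hc, arrow_smul_arrow_smul]
  exact zero_mem _

lemma smul_mem_jacobson_of_aug {c : RadSqZero k V} (hc : aug c = 0) (m : M) :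
    c • m ∈ Module.jacobson (RadSqZero k V) M := by
  rw [decomp c, hc]
  simp only [Pi.zero_apply, zero_smul, Finset.sum_const_zero, zero_add, Finset.sum_smul]
  refine sum_mem fun i _ => sum_mem fun j _ => sum_mem fun a _ => ?_
  rw [← smul_one_mul (coeff a c), mul_smul]
  exact Submodule.smul_mem _ _ (arrow_smul_mem_jacobson a m)

end Projective

section Coefficients

variable {k V : Type u} [Field k] [Quiver.{u} V] [Fintype V]
variable {M : Type*} [AddCommGroup M] [Module (RadSqZero k V) M]
variable [Module.Projective (RadSqZero k V) M]

variable (k V M) in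
/-- A section of the canonical surjection from a free module. -/
noncomputable def freeSection : M →ₗ[RadSqZero k V] M →₀ RadSqZero k V :=
  (Module.Projective.out (R := RadSqZero k V) (P := M)).choose

lemma freeSection_spec (x : M) :
    (freeSection k V M x).sum (fun m c => c • m) = x := by
  have := (Module.Projective.out (R := RadSqZero k V) (P := M)).choose_spec x
  rwa [Finsupp.linearCombination_apply] at this

/-- The submodule where one coordinate of the augmentation vanishes. -/
noncomputable def augKer (m : M) (i : V) : Submodule (RadSqZero k V) M where
  carrier := {x | aug (freeSection k V M x m) i = 0}
  add_mem' {x y} hx hy := by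
    simp only [Set.mem_ofPred_eq] at hx hy ⊢
    simp [hx, hy]
  zero_mem' := by simp
  smul_mem' c x hx := by
    simp only [Set.mem_ofPred_eq] at hx ⊢
    simp [hx]

lemma mem_augKer {m : M} {i : V} {x : M} :
    x ∈ augKer (k := k) m i ↔ aug (freeSection k V M x m) i = 0 := Iff.rfl

lemma freeSection_injective : Function.Injective (freeSection k V M) := fun x y h => by
  rw [← freeSection_spec (k := k) (V := V) x, h, freeSection_spec]

section Arrow

variable [Module k M] [IsScalarTower k (RadSqZero k V) M]

/-- A choice of coefficients with respect to the arrows. -/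
noncomputable def arrowCoeff {i j : V} (a : i ⟶ j) : M →ₗ[k] M :=
  (Algebra.lsmul k k M (vertex (k := k) i)) ∘ₗ (Finsupp.linearCombination k (id : M → M)) ∘ₗ
    (Finsupp.mapRange.linearMap (coeff a)) ∘ₗ ((freeSection k V M).restrictScalars k)

lemma arrowCoeff_apply {i j : V} (a : i ⟶ j) (x : M) :
    arrowCoeff (k := k) a x =
      vertex (k := k) i • (freeSection k V M x).sum (fun m c => coeff a c • m) := by
  simp only [arrowCoeff, LinearMap.comp_apply, Algebra.lsmul_coe, LinearMap.restrictScalars_apply,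
    Finsupp.linearCombination_apply, Finsupp.mapRange.linearMap_apply]
  rw [Finsupp.sum_mapRange_index (by simp)]
  rfl

lemma vertex_smul_arrowCoeff {i j : V} (a : i ⟶ j) (x : M) :
    vertex (k := k) i • arrowCoeff (k := k) a x = arrowCoeff (k := k) a x := by
  rw [arrowCoeff_apply, smul_smul, vertex_mul_self]

end Arrow

lemma aug_of_mem_jacobson {x : M} (hx : x ∈ Module.jacobson (RadSqZero k V) M) (m : M) :
    aug (freeSection k V M x m) = 0 := by
  ext i
  by_contra h
  have hc : IsCoatom (augKer (k := k) m i) := by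
    refine ⟨fun htop => h (mem_augKer.1 (htop ▸ Submodule.mem_top)), fun K hK => ?_⟩
    obtain ⟨z, hzK, hz⟩ := SetLike.exists_of_lt hK
    rw [mem_augKer] at hz
    refine eq_top_iff.2 fun w _ => ?_
    have hw : w - algebraMap k (RadSqZero k V)
        (aug (freeSection k V M w m) i / aug (freeSection k V M z m) i) • z ∈ augKer (k := k) m i := by
      rw [mem_augKer]
      simp only [map_sub, map_smul, Finsupp.sub_apply, Finsupp.smul_apply, smul_eq_mul, map_mul,
        AlgHom.commutes, Pi.sub_apply, Pi.mul_apply, Pi.algebraMap_apply, Algebra.algebraMap_self,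
        RingHom.id_apply]
      field_simp
      ring
    have := add_mem (hK.le hw) (K.smul_mem (algebraMap k (RadSqZero k V)
        (aug (freeSection k V M w m) i / aug (freeSection k V M z m) i)) hzK)
    rwa [sub_add_cancel] at this
  exact h (mem_augKer.1 (Submodule.mem_sInf.1 hx _ hc))

variable [∀ i j : V, Fintype (i ⟶ j)]

lemma mem_jacobson_of_aug {x : M} (h : ∀ m, aug (freeSection k V M x m) = 0) :
    x ∈ Module.jacobson (RadSqZero k V) M := by
  rw [← freeSection_spec (k := k) (V := V) x]
  exact sum_mem fun m _ => smul_mem_jacobson_of_aug (h m) m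

lemma arrow_smul_of_mem_jacobson {i j : V} (a : i ⟶ j) {x : M}
    (hx : x ∈ Module.jacobson (RadSqZero k V) M) : arrow (k := k) a • x = 0 := by
  refine freeSection_injective (k := k) (V := V) ?_
  ext1 m
  simp [arrow_mul, aug_of_mem_jacobson hx m]

/-- The coefficients of an element of the radical of a projective module with respect to the
arrows ending in a vertex are unique modulo the radical. -/
lemma mem_jacobson_of_sum_arrow_smul {j : V} (y : ∀ i, (i ⟶ j) → M)
    (h : ∑ i, ∑ a : i ⟶ j, arrow (k := k) a • y i a = 0) (i : V) (a : i ⟶ j) :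
    vertex (k := k) i • y i a ∈ Module.jacobson (RadSqZero k V) M := by
  classical
  refine mem_jacobson_of_aug fun m => ?_
  have h1 := congrArg (fun z => coeff a (freeSection k V M z m)) h
  simp only [map_sum, map_smul, Finsupp.coe_finsetSum, Finset.sum_apply, Finsupp.smul_apply,
    smul_eq_mul, arrow_mul, map_zero, Finsupp.zero_apply, coeff_arrow] at h1
  rw [Finset.sum_eq_single i, Finset.sum_eq_single a] at h1
  · ext l
    simp only [map_smul, Finsupp.smul_apply, smul_eq_mul, map_mul, aug_vertex, Pi.mul_apply,
      Pi.single_apply, Pi.zero_apply]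
    split_ifs with hl
    · subst hl
      simpa using h1
    · simp
  · intro b _ hb
    rw [if_neg, mul_zero]
    intro h
    cases h
    exact hb rfl
  · simp
  · intro i' _ hi
    refine Finset.sum_eq_zero fun c _ => ?_
    rw [if_neg, mul_zero]
    intro h
    cases h
    exact hi rfl
  · simp

variable [Module k M] [IsScalarTower k (RadSqZero k V) M]

lemma sum_arrowCoeff {j : V} {x : M} (hx : x ∈ Module.jacobson (RadSqZero k V) M)
    (hj : vertex (k := k) j • x = x) :
    ∑ i, ∑ a : i ⟶ j, arrow (k := k) a • arrowCoeff (k := k) a x = x := by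
  classical
  conv_rhs => rw [← hj, ← freeSection_spec (k := k) (V := V) x]
  simp only [arrowCoeff_apply, smul_smul, arrow_mul_vertex, Finsupp.sum, Finset.smul_sum]
  have : ∀ m, vertex j * freeSection k V M x m =
      ∑ i, ∑ a : i ⟶ j, coeff a (freeSection k V M x m) • arrow (k := k) a := by
    intro m
    conv_lhs => rw [decomp (freeSection k V M x m), aug_of_mem_jacobson hx m]
    simp only [Pi.zero_apply, zero_smul, Finset.sum_const_zero, zero_add, Finset.mul_sum,
      mul_smul_comm]
    refine Finset.sum_congr rfl fun i _ => ?_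
    rw [Finset.sum_eq_single j]
    · simp only [vertex_mul_arrow]
    · intro l _ hl
      simp only [vertex_mul_arrow_of_ne _ hl.symm, smul_zero, Finset.sum_const_zero]
    · simp
  simp only [this, Finset.sum_smul]
  rw [Finset.sum_comm]
  refine Finset.sum_congr rfl fun i _ => ?_
  rw [Finset.sum_comm]
  refine Finset.sum_congr rfl fun a _ => Finset.sum_congr rfl fun m _ => ?_
  rw [smul_assoc, smul_comm]

end Coefficients

end RadSqZero

namespace RadSqZero

section Reduced

variable {k V : Type u} [Field k] [Quiver.{u} V] [Fintype V]
variable {M : Type*} [AddCommGroup M] [Module (RadSqZero k V) M]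

lemma sum_vertex_smul (x : M) : ∑ i : V, (vertex i : RadSqZero k V) • x = x := by
  rw [← Finset.sum_smul, sum_vertex, one_smul]

/-- An element `d x` with `vertex i • x = x` on which some linear form takes the value
`vertex i` spans a contractible direct summand together with `x`. -/
lemma eq_zero_of_form {d : M →ₗ[RadSqZero k V] M} (hd : d ∘ₗ d = 0) (hred : IsReducedDiff d)
    {x : M} {i : V} (hx : vertex (k := k) i • x = x) (h : M →ₗ[RadSqZero k V] RadSqZero k V)
    (h1 : h x = 0) (h2 : h (d x) = vertex i) : x = 0 := by
  have hdd : ∀ m, d (d m) = 0 := fun m => LinearMap.congr_fun hd m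
  have hdx : vertex (k := k) i • d x = d x := by rw [← map_smul, hx]
  let r : M →ₗ[RadSqZero k V] M := h.smulRight x
  have hr : ∀ m, r m = h m • x := fun _ => rfl
  let p : M →ₗ[RadSqZero k V] M := r ∘ₗ d + d ∘ₗ r
  have hp : ∀ m, p m = h (d m) • x + h m • d x := fun m => by simp [p, hr]
  have hpx : p x = x := by rw [hp, h1, h2, hx, zero_smul, add_zero]
  have hpdx : p (d x) = d x := by rw [hp, hdd, h2, hdx, map_zero, zero_smul, zero_add]
  have hpp : ∀ m, p (p m) = p m := fun m => by
    conv_lhs => rw [hp m, map_add, map_smul, map_smul, hpx, hpdx]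
    rw [hp m]
  have hpd : ∀ m, p (d m) = d (p m) := fun m => by
    rw [hp, hp, hdd, map_zero, zero_smul, zero_add, map_add, map_smul, map_smul, hdd, smul_zero,
      add_zero]
  have hN : ∀ y ∈ LinearMap.range p, d y ∈ LinearMap.range p := by
    rintro _ ⟨y, rfl⟩
    exact ⟨d y, hpd y⟩
  have hN' : ∀ y ∈ LinearMap.ker p, d y ∈ LinearMap.ker p := by
    intro y hy
    rw [LinearMap.mem_ker] at hy ⊢
    rw [hpd, hy, map_zero]
  have hfix : ∀ y ∈ LinearMap.range p, p y = y := by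
    rintro _ ⟨y, rfl⟩
    exact hpp y
  have hc : IsCompl (LinearMap.range p) (LinearMap.ker p) := by
    constructor
    · rw [Submodule.disjoint_def]
      intro y hy hy'
      rw [← hfix y hy]
      exact hy'
    · rw [codisjoint_iff, eq_top_iff]
      intro y _
      rw [← add_sub_cancel (p y) y]
      refine Submodule.add_mem_sup ⟨y, rfl⟩ ?_
      rw [LinearMap.mem_ker, map_sub, hpp, sub_self]
  have hrN : ∀ y ∈ LinearMap.range p, r y ∈ LinearMap.range p := by
    intro y _
    exact ⟨r y, by rw [hr, map_smul, hpx]⟩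
  have hbot := hred _ _ hN hN' hc ⟨r.restrict hrN, by
    ext ⟨y, hy⟩
    exact (hfix y hy).symm⟩
  have : x ∈ LinearMap.range p := ⟨x, hpx⟩
  rwa [hbot, Submodule.mem_bot] at this

variable [∀ i j : V, Fintype (i ⟶ j)] [Module.Projective (RadSqZero k V) M]

/-- The differential of a reduced differential projective module is a radical map. -/
lemma mem_jacobson_of_isReducedDiff {d : M →ₗ[RadSqZero k V] M} (hd : d ∘ₗ d = 0)
    (hred : IsReducedDiff d) (x : M) : d x ∈ Module.jacobson (RadSqZero k V) M := by
  classical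
  have hdd : ∀ m, d (d m) = 0 := fun m => LinearMap.congr_fun hd m
  suffices H : ∀ (i : V) (x : M), vertex (k := k) i • x = x →
      d x ∈ Module.jacobson (RadSqZero k V) M by
    rw [← sum_vertex_smul (k := k) (V := V) x, map_sum]
    exact sum_mem fun i _ => H i _ (by rw [smul_smul, vertex_mul_self])
  intro i x hx
  by_contra hnot
  have hdx : vertex (k := k) i • d x = d x := by rw [← map_smul, hx]
  obtain ⟨m, hm⟩ : ∃ m, aug (freeSection k V M (d x) m) ≠ 0 := by
    by_contra! hall
    exact hnot (mem_jacobson_of_aug hall)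
  set w := freeSection k V M (d x) m with hw
  have hvw : vertex i * w = w := by
    rw [hw]
    conv_rhs => rw [← hdx]
    simp
  have hwi : aug w i ≠ 0 := by
    intro h0
    refine hm ?_
    rw [← hvw]
    ext l
    rw [map_mul, aug_vertex, Pi.mul_apply]
    by_cases hl : l = i
    · subst hl; simp [h0]
    · simp [hl]
  -- a right inverse of `w` up to `vertex i`
  obtain ⟨v, hv⟩ : ∃ v, w * v = vertex i := by
    let c := aug w i
    let n := w - c • vertex i
    have hn : aug (n * vertex i) = 0 := by
      ext l
      simp only [n, map_mul, map_sub, map_smul, aug_vertex, Pi.mul_apply, Pi.sub_apply,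
        Pi.smul_apply, Pi.zero_apply]
      by_cases hl : l = i
      · subst hl; simp [c]
      · simp [hl]
    have hnn : (n * vertex i) * (n * vertex i) = 0 := by
      have e1 := decomp (n * vertex i)
      rw [hn] at e1
      simp only [Pi.zero_apply, zero_smul, Finset.sum_const_zero, zero_add] at e1
      nth_rewrite 1 [e1]
      simp only [Finset.sum_mul, smul_mul_assoc, arrow_mul, hn, Pi.zero_apply, zero_smul, smul_zero,
        Finset.sum_const_zero]
    have hvn : vertex i * (n * vertex i) = n * vertex i := by
      simp only [n, ← mul_assoc, mul_sub, hvw, mul_smul_comm, vertex_mul_self]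
    have hnv : n * vertex i * vertex i = n * vertex i := by
      rw [mul_assoc, vertex_mul_self]
    have hwn : w * vertex i = c • vertex i + n * vertex i := by
      simp only [n, sub_mul, smul_mul_assoc, vertex_mul_self]
      abel
    refine ⟨vertex i * (c⁻¹ • vertex i - (c⁻¹ * c⁻¹) • (n * vertex i)), ?_⟩
    rw [← mul_assoc, hwn, add_mul, mul_sub, mul_sub, smul_mul_smul_comm, smul_mul_smul_comm,
      mul_smul_comm, mul_smul_comm, hnn, smul_zero, sub_zero, vertex_mul_self, hvn, hnv,
      mul_inv_cancel₀ hwi, one_smul, mul_inv_cancel_left₀ hwi]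
    abel
  -- the linear form
  let h0 : M →ₗ[RadSqZero k V] RadSqZero k V :=
    (LinearMap.toSpanSingleton (RadSqZero k V) (RadSqZero k V) v) ∘ₗ
      (Finsupp.lapply m) ∘ₗ (freeSection k V M)
  have h0d : h0 (d x) = vertex i := by
    simp only [h0, LinearMap.comp_apply, Finsupp.lapply_apply, LinearMap.toSpanSingleton_apply,
      smul_eq_mul]
    exact hv
  let h : M →ₗ[RadSqZero k V] RadSqZero k V :=
    h0 - (LinearMap.toSpanSingleton (RadSqZero k V) (RadSqZero k V) (h0 x)) ∘ₗ h0 ∘ₗ d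
  have hh : ∀ y, h y = h0 y - h0 (d y) * h0 x := fun y => by simp [h]
  have hx0 : x = 0 := by
    refine eq_zero_of_form hd hred hx h ?_ ?_
    · rw [hh, h0d]
      conv_lhs => rw [← hx, map_smul, smul_eq_mul, ← mul_assoc, vertex_mul_self, sub_self]
    · rw [hh, hdd, map_zero, zero_mul, sub_zero, h0d]
  refine hnot ?_
  rw [hx0, map_zero]
  exact zero_mem _

end Reduced

section KoszulAction

variable {k V : Type u} [Field k] [Quiver.{u} V] [Fintype V] [∀ i j : V, Fintype (i ⟶ j)]
variable {M : Type*} [AddCommGroup M] [Module (RadSqZero k V) M]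
variable [Module k M] [IsScalarTower k (RadSqZero k V) M]

/-- A family of `k`-linear endomorphisms of the top `M / rad M` of a module `M`, one for each
arrow, is the family of components of a radical endomorphism `d` of `M` if, for an arrow
`a : i ⟶ j`, the component `g a` maps `(M / rad M)_j` to `(M / rad M)_i` and vanishes on the
other vertices, and if `d` is recovered from its components: for `x ∈ M_j`, the element `d x` is
the sum, over all arrows `a` with target `j`, of the products of `a` with a lift to `M` of the
value of `g a` at the class of `x`. -/
structure IsComponents (d : M →ₗ[RadSqZero k V] M)
    (g : ∀ {i j : V}, (i ⟶ j) →
      (M ⧸ Module.jacobson (RadSqZero k V) M) →ₗ[k] (M ⧸ Module.jacobson (RadSqZero k V) M)) :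
    Prop where
  left : ∀ {i j : V} (a : i ⟶ j) t, vertex (k := k) i • g a t = g a t
  right : ∀ {i j : V} (a : i ⟶ j) t, g a (vertex (k := k) j • t) = g a t
  sum : ∀ (j : V) (x : M) (y : ∀ i : V, (i ⟶ j) → M),
    (∀ i a, (Submodule.Quotient.mk (y i a) : M ⧸ Module.jacobson (RadSqZero k V) M) =
      g a (Submodule.Quotient.mk x)) →
    d (vertex (k := k) j • x) = ∑ i, ∑ a : i ⟶ j, arrow (k := k) a • y i a

variable [Module.Projective (RadSqZero k V) M]

lemma apply_eq_zero_of_mem_jacobson {d : M →ₗ[RadSqZero k V] M}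
    (hd : ∀ x, d x ∈ Module.jacobson (RadSqZero k V) M) {x : M}
    (hx : x ∈ Module.jacobson (RadSqZero k V) M) : d x = 0 := by
  rw [← freeSection_spec (k := k) (V := V) x, Finsupp.sum, map_sum]
  refine Finset.sum_eq_zero fun m _ => ?_
  rw [map_smul, decomp (freeSection k V M x m), aug_of_mem_jacobson hx m]
  simp only [Pi.zero_apply, zero_smul, Finset.sum_const_zero, zero_add, Finset.sum_smul]
  refine Finset.sum_eq_zero fun i _ => Finset.sum_eq_zero fun j _ => Finset.sum_eq_zero fun a _ => ?_
  rw [smul_assoc, arrow_smul_of_mem_jacobson a (hd m), smul_zero]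

/-- A radical endomorphism of a projective module has exactly one family of components. -/
theorem existsUnique_isComponents {d : M →ₗ[RadSqZero k V] M}
    (hd : ∀ x, d x ∈ Module.jacobson (RadSqZero k V) M) :
    ∃! g : ∀ {i j : V}, (i ⟶ j) →
      (M ⧸ Module.jacobson (RadSqZero k V) M) →ₗ[k] (M ⧸ Module.jacobson (RadSqZero k V) M),
      IsComponents d g := by
  let R := Module.jacobson (RadSqZero k V) M
  let φ : ∀ {i j : V}, (i ⟶ j) → M →ₗ[k] (M ⧸ R) := fun {i j} a =>
    (R.mkQ.restrictScalars k) ∘ₗ arrowCoeff (k := k) a ∘ₗ (d.restrictScalars k) ∘ₗ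
      (Algebra.lsmul k k M (vertex (k := k) j))
  have hφ : ∀ {i j : V} (a : i ⟶ j) (x : M),
      φ a x = Submodule.Quotient.mk (arrowCoeff (k := k) a (d (vertex (k := k) j • x))) :=
    fun a x => rfl
  let g : ∀ {i j : V}, (i ⟶ j) → (M ⧸ R) →ₗ[k] (M ⧸ R) := fun {i j} a =>
    ((R.restrictScalars k).liftQ (φ a) (fun x hx => by
      rw [LinearMap.mem_ker, hφ, map_smul, apply_eq_zero_of_mem_jacobson hd hx, smul_zero,
        map_zero, Submodule.Quotient.mk_zero])) ∘ₗ
      (Submodule.Quotient.restrictScalarsEquiv k R).symm.toLinearMap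
  have hg : ∀ {i j : V} (a : i ⟶ j) (x : M),
      g a (Submodule.Quotient.mk x) =
        Submodule.Quotient.mk (arrowCoeff (k := k) a (d (vertex (k := k) j • x))) :=
    fun a x => rfl
  have key : ∀ {i j : V} (a : i ⟶ j) {y y' : M},
      (Submodule.Quotient.mk y : M ⧸ R) = Submodule.Quotient.mk y' →
      arrow (k := k) a • y = arrow (k := k) a • y' := fun a y y' h => by
    rw [Submodule.Quotient.eq] at h
    rw [← sub_eq_zero, ← smul_sub, arrow_smul_of_mem_jacobson a h]
  refine ⟨fun {i j} => g, ⟨?_, ?_, ?_⟩, ?_⟩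
  · intro i j a t
    obtain ⟨x, rfl⟩ := Submodule.Quotient.mk_surjective _ t
    rw [hg, ← Submodule.Quotient.mk_smul, vertex_smul_arrowCoeff]
  · intro i j a t
    obtain ⟨x, rfl⟩ := Submodule.Quotient.mk_surjective _ t
    rw [← Submodule.Quotient.mk_smul, hg, hg, smul_smul, vertex_mul_self]
  · intro j x y hy
    rw [← sum_arrowCoeff (k := k) (j := j) (hd (vertex (k := k) j • x))
      (by rw [← map_smul, smul_smul, vertex_mul_self])]
    refine Finset.sum_congr rfl fun i _ => Finset.sum_congr rfl fun a _ => ?_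
    exact key a ((hg a x).symm.trans (hy i a).symm)
  · intro g' hg'
    funext i j a
    refine LinearMap.ext fun t => ?_
    obtain ⟨x, rfl⟩ := Submodule.Quotient.mk_surjective _ t
    choose y' hy' using fun (i : V) (a : i ⟶ j) =>
      Submodule.Quotient.mk_surjective R (g' a (Submodule.Quotient.mk x))
    have e' := hg'.sum j x y' hy'
    rw [← sum_arrowCoeff (k := k) (j := j) (hd (vertex (k := k) j • x))
      (by rw [← map_smul, smul_smul, vertex_mul_self]), ← sub_eq_zero] at e'
    simp only [← Finset.sum_sub_distrib, ← smul_sub] at e'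
    have h := mem_jacobson_of_sum_arrow_smul _ e' i a
    rw [smul_sub, vertex_smul_arrowCoeff, ← Submodule.Quotient.eq, Submodule.Quotient.mk_smul,
      hy', hg'.left] at h
    exact h.symm

end KoszulAction

end RadSqZero

section DiffProj

/-- A differential projective module over `Λ`: a projective `Λ`-module `M` with an endomorphism
`d` such that `d² = 0`. -/
structure DiffProj (Λ : Type u) [Ring Λ] : Type (u + 1) where
  carrier : Type u
  [addCommGroup : AddCommGroup carrier]
  [module : Module Λ carrier]
  [projective : Module.Projective Λ carrier]
  d : carrier →ₗ[Λ] carrier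
  d_comp_d : d ∘ₗ d = 0

namespace DiffProj

variable {Λ : Type u} [Ring Λ]

instance : CoeSort (DiffProj Λ) (Type u) := ⟨DiffProj.carrier⟩

instance (M : DiffProj Λ) : AddCommGroup M := M.addCommGroup

instance (M : DiffProj Λ) : Module Λ M := M.module

instance (M : DiffProj Λ) : Module.Projective Λ M := M.projective

/-- A differential projective module is reduced if it has no nonzero contractible direct
summand. -/
def IsReduced (M : DiffProj Λ) : Prop := IsReducedDiff M.d

/-- A differential module is exact if `Ker d = Im d`. -/
def IsExact (M : DiffProj Λ) : Prop := LinearMap.ker M.d = LinearMap.range M.d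

/-- A morphism of differential modules. -/
@[ext]
structure Hom (M N : DiffProj Λ) : Type u where
  val : M →ₗ[Λ] N
  comm : val ∘ₗ M.d = N.d ∘ₗ val

/-- The category of differential projective modules. -/
instance : Category (DiffProj Λ) where
  Hom M N := Hom M N
  id M := ⟨LinearMap.id, rfl⟩
  comp f g := ⟨g.val ∘ₗ f.val, by
    rw [LinearMap.comp_assoc, f.comm, ← LinearMap.comp_assoc, g.comm, LinearMap.comp_assoc]⟩

@[ext]
lemma hom_ext {M N : DiffProj Λ} {f g : M ⟶ N} (h : f.val = g.val) : f = g := Hom.ext h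

@[simp]
lemma id_val (M : DiffProj Λ) : (𝟙 M : M ⟶ M).val = LinearMap.id := rfl

@[simp]
lemma comp_val {M N L : DiffProj Λ} (f : M ⟶ N) (g : N ⟶ L) :
    (f ≫ g).val = g.val ∘ₗ f.val := rfl

instance (M N : DiffProj Λ) : Zero (M ⟶ N) :=
  ⟨⟨0, by rw [LinearMap.zero_comp, LinearMap.comp_zero]⟩⟩

instance (M N : DiffProj Λ) : Add (M ⟶ N) :=
  ⟨fun f g => ⟨f.val + g.val, by rw [LinearMap.add_comp, LinearMap.comp_add, f.comm, g.comm]⟩⟩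

instance (M N : DiffProj Λ) : Neg (M ⟶ N) :=
  ⟨fun f => ⟨-f.val, by rw [LinearMap.neg_comp, LinearMap.comp_neg, f.comm]⟩⟩

@[simp]
lemma zero_val (M N : DiffProj Λ) : (0 : M ⟶ N).val = 0 := rfl

@[simp]
lemma add_val {M N : DiffProj Λ} (f g : M ⟶ N) : (f + g).val = f.val + g.val := rfl

@[simp]
lemma neg_val {M N : DiffProj Λ} (f : M ⟶ N) : (-f).val = -f.val := rfl

instance (M N : DiffProj Λ) : AddCommGroup (M ⟶ N) where
  add_assoc f g h := hom_ext (add_assoc _ _ _)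
  zero_add f := hom_ext (zero_add _)
  add_zero f := hom_ext (add_zero _)
  add_comm f g := hom_ext (add_comm _ _)
  neg_add_cancel f := hom_ext (neg_add_cancel _)
  nsmul := nsmulRec
  zsmul := zsmulRec

@[simp]
lemma sub_val {M N : DiffProj Λ} (f g : M ⟶ N) : (f - g).val = f.val - g.val := by
  rw [sub_eq_add_neg, add_val, neg_val, sub_eq_add_neg]

instance : Preadditive (DiffProj Λ) where
  add_comp _ _ _ f g h := hom_ext (by simp [LinearMap.comp_add])
  comp_add _ _ _ f g h := hom_ext (by simp [LinearMap.add_comp])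

/-- A linear map is null homotopic if it is of the form `r d + δ r` for a linear map `r`. -/
def IsNullHomotopic {M N : DiffProj Λ} (f : M →ₗ[Λ] N) : Prop :=
  ∃ r : M →ₗ[Λ] N, f = r ∘ₗ M.d + N.d ∘ₗ r

variable (Λ) in
/-- Two morphisms of differential modules are homotopic if their difference is null homotopic. -/
def homotopyRel : HomRel (DiffProj Λ) := fun _ _ f g => IsNullHomotopic (f.val - g.val)

lemma IsNullHomotopic.zero {M N : DiffProj Λ} : IsNullHomotopic (0 : M →ₗ[Λ] N) :=
  ⟨0, by simp⟩

lemma IsNullHomotopic.neg {M N : DiffProj Λ} {f : M →ₗ[Λ] N} (hf : IsNullHomotopic f) :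
    IsNullHomotopic (-f) := by
  obtain ⟨r, rfl⟩ := hf
  exact ⟨-r, by rw [LinearMap.neg_comp, LinearMap.comp_neg, neg_add]⟩

lemma IsNullHomotopic.add {M N : DiffProj Λ} {f g : M →ₗ[Λ] N} (hf : IsNullHomotopic f)
    (hg : IsNullHomotopic g) : IsNullHomotopic (f + g) := by
  obtain ⟨r, rfl⟩ := hf
  obtain ⟨s, rfl⟩ := hg
  exact ⟨r + s, by rw [LinearMap.add_comp, LinearMap.comp_add]; abel⟩

lemma IsNullHomotopic.comp_left {M N L : DiffProj Λ} {f : M →ₗ[Λ] N} (hf : IsNullHomotopic f)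
    (g : N ⟶ L) : IsNullHomotopic (M := M) (N := L) (g.val ∘ₗ f) := by
  obtain ⟨r, rfl⟩ := hf
  refine ⟨g.val ∘ₗ r, ?_⟩
  ext x
  have := LinearMap.congr_fun g.comm (r x)
  simp only [LinearMap.comp_apply] at this
  simp [this]

lemma IsNullHomotopic.comp_right {M N L : DiffProj Λ} {g : N →ₗ[Λ] L} (hg : IsNullHomotopic g)
    (f : M ⟶ N) : IsNullHomotopic (M := M) (N := L) (g ∘ₗ f.val) := by
  obtain ⟨r, rfl⟩ := hg
  refine ⟨r ∘ₗ f.val, ?_⟩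
  rw [LinearMap.add_comp, LinearMap.comp_assoc, ← f.comm, LinearMap.comp_assoc,
    LinearMap.comp_assoc]

instance : Congruence (homotopyRel Λ) where
  equivalence :=
    { refl := fun f => by
        simp only [homotopyRel, sub_self]
        exact IsNullHomotopic.zero
      symm := fun {f g} h => by
        have := IsNullHomotopic.neg h
        rwa [neg_sub] at this
      trans := fun {f g h} h₁ h₂ => by
        have := IsNullHomotopic.add h₁ h₂
        rwa [sub_add_sub_cancel] at this }
  comp_left f g g' h := by
    have := IsNullHomotopic.comp_right h f
    rwa [LinearMap.sub_comp] at this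
  comp_right g h := by
    have := IsNullHomotopic.comp_left h g
    rwa [LinearMap.comp_sub] at this

variable (Λ) in
/-- The homotopy category of differential projective modules: the objects are the differential
projective modules, the morphisms are the homotopy classes of morphisms. -/
abbrev HomotopyCat : Type (u + 1) := CategoryTheory.Quotient (homotopyRel Λ)

instance : Preadditive (HomotopyCat Λ) :=
  CategoryTheory.Quotient.preadditive _ fun M N f₁ f₂ g₁ g₂ hf hg => by
    have := IsNullHomotopic.add hf hg
    rwa [← add_sub_add_comm] at this

/-- A differential projective module as an object of the homotopy category. -/
abbrev toHomotopyCat (M : DiffProj Λ) : HomotopyCat Λ :=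
  (CategoryTheory.Quotient.functor (homotopyRel Λ)).obj M

/-- The homotopy class of a morphism. -/
abbrev homotopyClass {M N : DiffProj Λ} (f : M ⟶ N) : M.toHomotopyCat ⟶ N.toHomotopyCat :=
  (CategoryTheory.Quotient.functor (homotopyRel Λ)).map f

section Coproduct

open Classical in
/-- The direct sum of a family of differential projective modules. -/
noncomputable def directSum {L : Type u} (T : L → DiffProj Λ) : DiffProj Λ where
  carrier := Π₀ l, T l
  d := DFinsupp.mapRange.linearMap fun l => (T l).d
  d_comp_d := by
    ext l x m
    have := LinearMap.congr_fun (T l).d_comp_d x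
    simp only [LinearMap.comp_apply, LinearMap.zero_apply] at this
    simp [DFinsupp.mapRange_single, this]

open Classical in
/-- The inclusion of a summand, as a linear map. -/
noncomputable def incl {L : Type u} (T : L → DiffProj Λ) (l : L) : T l →ₗ[Λ] directSum T :=
  (DFinsupp.lsingle (M := fun l => (T l).carrier) l : T l →ₗ[Λ] Π₀ l, T l)

open Classical in
/-- The linear map out of a direct sum with given restrictions to the summands. -/
noncomputable def descL {L : Type u} (T : L → DiffProj Λ) {W : Type u} [AddCommGroup W]
    [Module Λ W] (f : ∀ l, T l →ₗ[Λ] W) : directSum T →ₗ[Λ] W :=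
  (DFinsupp.lsum ℕ f : (Π₀ l, T l) →ₗ[Λ] W)

lemma descL_incl {L : Type u} (T : L → DiffProj Λ) {W : Type u} [AddCommGroup W]
    [Module Λ W] (f : ∀ l, T l →ₗ[Λ] W) (l : L) (x : T l) : descL T f (incl T l x) = f l x := by
  classical
  exact DFinsupp.lsum_single (M := fun l => (T l).carrier) ℕ f l x

lemma d_incl {L : Type u} (T : L → DiffProj Λ) (l : L) (x : T l) :
    (directSum T).d (incl T l x) = incl T l ((T l).d x) := by
  classical
  exact DFinsupp.mapRange_single (f := fun l => (T l).d) (hf := fun l => map_zero (T l).d)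

lemma ext_incl {L : Type u} (T : L → DiffProj Λ) {W : Type u} [AddCommGroup W]
    [Module Λ W] {f g : directSum T →ₗ[Λ] W} (h : ∀ l x, f (incl T l x) = g (incl T l x)) :
    f = g := by
  classical
  exact DFinsupp.lhom_ext' (M := fun l => (T l).carrier) (φ := (f : (Π₀ l, T l) →ₗ[Λ] W)) (ψ := (g : (Π₀ l, T l) →ₗ[Λ] W))
    fun l => LinearMap.ext (h l)

/-- The inclusion of a summand. -/
noncomputable def directSumι {L : Type u} (T : L → DiffProj Λ) (l : L) : T l ⟶ directSum T where
  val := incl T l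
  comm := LinearMap.ext fun x => (d_incl T l x).symm

lemma comm_apply {M N : DiffProj Λ} (f : M ⟶ N) (x : M) : f.val (M.d x) = N.d (f.val x) :=
  LinearMap.congr_fun f.comm x

/-- The morphism out of a direct sum with given restrictions to the summands. -/
noncomputable def directSumDesc {L : Type u} {T : L → DiffProj Λ} {N : DiffProj Λ}
    (f : ∀ l, T l ⟶ N) : directSum T ⟶ N where
  val := descL T fun l => (f l).val
  comm := ext_incl T fun l x => by
    simp only [LinearMap.comp_apply, d_incl, descL_incl, comm_apply]

lemma directSumι_desc {L : Type u} {T : L → DiffProj Λ} {N : DiffProj Λ}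
    (f : ∀ l, T l ⟶ N) (l : L) : directSumι T l ≫ directSumDesc f = f l :=
  hom_ext (LinearMap.ext fun x => descL_incl T (fun l => (f l).val) l x)

lemma isNullHomotopic_of_directSum {L : Type u} {T : L → DiffProj Λ} {N : DiffProj Λ}
    (f : directSum T ⟶ N) (hf : ∀ l, IsNullHomotopic (directSumι T l ≫ f).val) :
    IsNullHomotopic f.val := by
  choose r hr using hf
  refine ⟨descL T r, ext_incl T fun l x => ?_⟩
  have := LinearMap.congr_fun (hr l) x
  simp only [LinearMap.add_apply, LinearMap.comp_apply, d_incl, descL_incl] at this ⊢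
  exact this

/-- The direct sum, with the homotopy classes of the inclusions, as a cofan in the homotopy
category. -/
noncomputable def directSumCofan {L : Type u} (T : L → DiffProj Λ) :
    Limits.Cofan fun l => (T l).toHomotopyCat :=
  Limits.Cofan.mk (directSum T).toHomotopyCat fun l => homotopyClass (directSumι T l)

/-- The direct sum is a coproduct in the homotopy category. -/
noncomputable def isColimitDirectSumCofan {L : Type u} (T : L → DiffProj Λ) :
    Limits.IsColimit (directSumCofan T) :=
  Limits.Cofan.IsColimit.mk _
    (fun s => homotopyClass (M := directSum T) (N := s.pt.as)
      (directSumDesc fun l => ((CategoryTheory.Quotient.functor (homotopyRel Λ)).map_surjective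
        (X := T l) (Y := s.pt.as) (s.inj l)).choose))
    (fun s l => by
      change homotopyClass _ ≫ homotopyClass _ = _
      rw [← Functor.map_comp, directSumι_desc]
      exact ((CategoryTheory.Quotient.functor (homotopyRel Λ)).map_surjective
        (X := T l) (Y := s.pt.as) (s.inj l)).choose_spec)
    (fun s m hm => by
      obtain ⟨m', rfl⟩ := (CategoryTheory.Quotient.functor (homotopyRel Λ)).map_surjective
        (X := directSum T) (Y := s.pt.as) m
      refine (CategoryTheory.Quotient.functor_map_eq_iff (homotopyRel Λ) _ _).2 ?_
      change IsNullHomotopic (m'.val - Hom.val (directSumDesc _))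
      rw [← sub_val]
      refine isNullHomotopic_of_directSum _ fun l => ?_
      rw [Preadditive.comp_sub, directSumι_desc, sub_val]
      refine (CategoryTheory.Quotient.functor_map_eq_iff (homotopyRel Λ) _ _).1 ?_
      refine Eq.trans ?_ ((CategoryTheory.Quotient.functor (homotopyRel Λ)).map_surjective
        (X := T l) (Y := s.pt.as) (s.inj l)).choose_spec.symm
      rw [Functor.map_comp]
      exact hm l)

/-- The homotopy category admits all small coproducts. -/
instance : Limits.HasCoproducts.{u} (HomotopyCat Λ) := fun L => by
  have : ∀ T : L → HomotopyCat Λ, Limits.HasCoproduct T := fun T =>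
    ⟨⟨⟨directSumCofan fun l => (T l).as, isColimitDirectSumCofan fun l => (T l).as⟩⟩⟩
  exact ⟨fun F => Limits.hasColimit_of_iso Discrete.natIsoFunctor⟩

end Coproduct

end DiffProj

end DiffProj

section Compact

open Limits

/-- For an object `S` and a family of objects `T l`, the natural map from the direct sum of the
groups `Hom(S, T l)` to `Hom(S, ∐ T l)`. -/
noncomputable def coproductComparison {C : Type*} [Category C] [Preadditive C]
    (S : C) {L : Type*} (T : L → C) [HasCoproduct T] :
    (DirectSum L fun l => (S ⟶ T l)) →+ (S ⟶ ∐ T) :=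
  open Classical in
  DirectSum.toAddMonoid fun l => Preadditive.rightComp S (Sigma.ι T l)

/-- An object `S` of an additive category with small coproducts is compact if, for every small
family of objects `T l`, the natural map from the direct sum of the groups `Hom(S, T l)` to
`Hom(S, ∐ T l)` is bijective. -/
def IsCompactObj {C : Type (u + 1)} [Category.{u} C] [Preadditive C] [HasCoproducts.{u} C]
    (S : C) : Prop :=
  ∀ (L : Type u) (T : L → C), Function.Bijective (coproductComparison S T)

end Compact

section KoszulDual

variable {k V : Type u} [Field k] [Quiver.{u} V] [Fintype V] [∀ i j : V, Fintype (i ⟶ j)]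

/-- The vector space underlying a module over `kQ/J²`. -/
noncomputable instance (M : DiffProj (RadSqZero k V)) : Module k M :=
  Module.compHom M (algebraMap k (RadSqZero k V))

instance (M : DiffProj (RadSqZero k V)) : IsScalarTower k (RadSqZero k V) M where
  smul_assoc c x m := by
    rw [Algebra.smul_def, mul_smul]
    rfl

/-- The opposite quiver of a finite quiver is finite. -/
instance fintypeOpposite (W : Type u) [Fintype W] : Fintype Wᵒᵖ :=
  Fintype.ofEquiv W Opposite.equivToOpposite

open Opposite

namespace RadSqZero

/-- The components `γ(d)_{α*}` of the differential of a reduced differential projective module,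
as endomorphisms of the top `M / rad M`. -/
noncomputable def components (M : DiffProj (RadSqZero k V)) (hM : M.IsReduced) :
    ∀ {i j : V}, (i ⟶ j) →
      (M ⧸ Module.jacobson (RadSqZero k V) M) →ₗ[k] (M ⧸ Module.jacobson (RadSqZero k V) M) :=
  (existsUnique_isComponents (mem_jacobson_of_isReducedDiff M.d_comp_d hM)).choose

lemma components_spec (M : DiffProj (RadSqZero k V)) (hM : M.IsReduced) :
    IsComponents M.d (components M hM) :=
  (existsUnique_isComponents (mem_jacobson_of_isReducedDiff M.d_comp_d hM)).choose_spec.1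

lemma components_unique (M : DiffProj (RadSqZero k V)) (hM : M.IsReduced)
    (g : ∀ {i j : V}, (i ⟶ j) →
      (M ⧸ Module.jacobson (RadSqZero k V) M) →ₗ[k] (M ⧸ Module.jacobson (RadSqZero k V) M))
    (hg : IsComponents M.d g) : @g = @components k V _ _ _ _ M hM :=
  (existsUnique_isComponents (mem_jacobson_of_isReducedDiff M.d_comp_d hM)).choose_spec.2 g hg

/-- The trivial path of the opposite quiver at `i` acts on the top of `M` as the trivial path at
`i` does, and the reversed arrow `α*` acts as the component `γ(d)_{α*}` of the differential. -/
noncomputable def koszulLiftData (M : DiffProj (RadSqZero k V)) (hM : M.IsReduced) :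
    PathAlgebra.LiftData Vᵒᵖ (Module.End k (M ⧸ Module.jacobson (RadSqZero k V) M)) where
  e i := Algebra.lsmul k k _ (vertex (k := k) i.unop)
  f a := components M hM a.unop
  idem i := by rw [← map_mul, vertex_mul_self]
  orth i j h := by
    rw [← map_mul, vertex_mul_of_ne (fun h' => h (unop_injective h')), map_zero]
  one := by
    rw [← map_sum, ← map_one (Algebra.lsmul k k (M ⧸ Module.jacobson (RadSqZero k V) M) :
        RadSqZero k V →ₐ[k] Module.End k (M ⧸ Module.jacobson (RadSqZero k V) M)), ← sum_vertex]
    congr 1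
    exact (Fintype.sum_equiv Opposite.equivToOpposite (fun i : V => (vertex i : RadSqZero k V))
      (fun i : Vᵒᵖ => vertex i.unop) fun _ => rfl).symm
  left a := LinearMap.ext fun t => (components_spec M hM).left a.unop t
  right a := LinearMap.ext fun t => (components_spec M hM).right a.unop t

/-- The action of the path algebra of the opposite quiver on the top of `M`. -/
noncomputable def koszulAction (M : DiffProj (RadSqZero k V)) (hM : M.IsReduced) :
    PathAlgebra k Vᵒᵖ →ₐ[k] Module.End k (M ⧸ Module.jacobson (RadSqZero k V) M) :=
  PathAlgebra.lift (koszulLiftData M hM)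

/-- The module `F(M)` over the path algebra of the opposite quiver that belongs to a reduced
differential projective module `M` over `kQ/J²`: its underlying vector space is the top
`M / rad M`. -/
def KoszulDual (M : DiffProj (RadSqZero k V)) (_ : M.IsReduced) : Type u :=
  M ⧸ Module.jacobson (RadSqZero k V) M

namespace KoszulDual

variable (M : DiffProj (RadSqZero k V)) (hM : M.IsReduced)

noncomputable instance : AddCommGroup (KoszulDual M hM) :=
  inferInstanceAs (AddCommGroup (M ⧸ Module.jacobson (RadSqZero k V) M))

noncomputable instance : Module k (KoszulDual M hM) :=
  inferInstanceAs (Module k (M ⧸ Module.jacobson (RadSqZero k V) M))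

noncomputable instance : Module (PathAlgebra k Vᵒᵖ) (KoszulDual M hM) :=
  Module.compHom (M ⧸ Module.jacobson (RadSqZero k V) M) (koszulAction M hM).toRingHom

lemma smul_def (c : PathAlgebra k Vᵒᵖ) (t : KoszulDual M hM) :
    c • t = koszulAction M hM c t := rfl

instance : IsScalarTower k (PathAlgebra k Vᵒᵖ) (KoszulDual M hM) where
  smul_assoc c x m := by
    rw [smul_def, map_smul]
    rfl

/-- The class in `F(M)` of an element of `M`. -/
noncomputable def mk (x : M) : KoszulDual M hM :=
  (Submodule.Quotient.mk x : M ⧸ Module.jacobson (RadSqZero k V) M)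

lemma vertex_smul (i : V) (x : M) :
    PathAlgebra.vertex (k := k) (op i) • mk M hM x = mk M hM (vertex (k := k) i • x) := by
  rw [smul_def, koszulAction, PathAlgebra.lift_vertex]
  rfl

lemma arrow_smul {i j : V} (a : i ⟶ j) (t : KoszulDual M hM) :
    PathAlgebra.arrow (k := k) a.op • t = components M hM a t := by
  rw [smul_def, koszulAction, PathAlgebra.lift_arrow]
  rfl

end KoszulDual

end RadSqZero

/-- The semisimple module `kQ_0` over the path algebra `kQ`, on which all arrows act as zero. -/
abbrev PathAlgebra.vertexModule (k W : Type u) [Field k] [Quiver.{u} W] [Fintype W] : Type u :=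
  PathAlgebra k W ⧸ PathAlgebra.arrowIdeal k W

end KoszulDual

set_option linter.unusedSectionVars false

/-! Write e_i for the trivial paths, A for the path algebra of the opposite quiver, and σ for a
k-linear section, compatible with the e_i, of the projection of a projective module T over Λ = kQ/J²
onto its top. As T is projective and J² = 0, every element of T is uniquely σ(t) + Σ_α α σ(t_α) with
t_α in e_{s(α)} of the top (`headSection_add_sum_headCoeff`, `headCoeff_sum_ar_smul`). Hence a
linear map f between projectives amounts to its components f_0 = `headMap f` on tops and f_α =
`arrowMap α f`, with (gf)_0 = g_0 f_0 and (gf)_α = g_α f_0 + g_0 f_α. For reduced M the component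
d_0 vanishes and d_α is the action of α* on F(M).

Finite dimension is immediate from the normal form, since there are finitely many arrows.

Exactness: d kills the radical and has image inside it, so it amounts to the map x ↦ (α* x)_α from
F(M) to the product of the e_{s(α)} F(M), and M is exact exactly when this map is bijective. The
arrow ideal of A is, as a left module, the direct sum of the A α*. So 0 → J → A → A/J → 0 computes
Ext from A/J, and the kernel and cokernel of the map are Ext⁰ and Ext¹.

Compactness means that every morphism from M to a direct sum becomes null homotopic once finitely
many summands are killed (`isCompactObj_iff`).

Let F(M) be finitely presented. For any N, d² = 0 says d_0² = 0 and d_α d_0 = -d_0 d_α, so the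
homology H(N) of the top under d_0 is an A-module through the d_α, or through the -d_α. A morphism f
: M → N induces an A-linear map F(M) → H(N). If that map is zero, f is homotopic to a morphism with
f_0 = 0. The f_α then form a cocycle for an extension of F(M) by H(N), with arrows acting by -d_α,
and f is null homotopic if the cocycle is a coboundary (`isNullHomotopic_of_coboundary`). When N is
a direct sum, a truncation kills the first obstruction because F(M) is finitely generated. A further
one kills the second because an extension of a finitely presented module splits once finitely many
elements of the submodule are sent to zero (`Cocycle.exists_splitting`).

Conversely, let M be compact and test it against sums of copies of Λ ⊗ A with differential ±Σ α ⊗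
α*. A linear map, or a cocycle, from F(M) to a free module A^(L) yields a morphism from M to such a
sum. Reading off coefficients of the null homotopy shows that linear maps to A^(L) use only finitely
many coordinates, and that cocycles are coboundaries after forgetting finitely many coordinates.
Applied to the cocycle that obstructs splitting a free cover A^(ι) → F(M), the second fact makes
F(M) a retract of A^(ι)/P with P finitely generated. By the first fact the retract lies in the image
of finitely many coordinates, and finite presentation follows (`finitePresentation_of_retract`). -/

/-- The arrows of a quiver, with their source and target. -/
abbrev QuiverArrow (V : Type u) [Quiver.{u} V] : Type u := Σ i j : V, i ⟶ j

/-! ### Modules over a path algebra through trivial paths and arrows -/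

namespace PathAlgebra

variable {k W : Type u} [Field k] [Quiver.{u} W] [Fintype W]
variable {U : Type*} [AddCommGroup U] [Module (PathAlgebra k W) U]

lemma sum_vertex_smul (x : U) : ∑ i : W, vertex (k := k) i • x = x := by
  rw [← Finset.sum_smul, ← one_def, one_smul]

lemma vertex_smul_vertex_smul (i : W) (x : U) :
    vertex (k := k) i • vertex (k := k) i • x = vertex (k := k) i • x := by
  rw [smul_smul, vertex, ofPath_mul_ofPath, Quiver.Path.comp_nil]

lemma vertex_smul_vertex_smul_of_ne {i j : W} (h : i ≠ j) (x : U) :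
    vertex (k := k) i • vertex (k := k) j • x = 0 := by
  rw [smul_smul, vertex, vertex, ofPath_mul_ofPath_of_ne _ _ h, zero_smul]

lemma vertex_smul_arrow_smul {i j : W} (a : i ⟶ j) (x : U) :
    vertex (k := k) j • arrow (k := k) a • x = arrow (k := k) a • x := by
  rw [smul_smul, arrow, vertex_mul_ofPath]

lemma arrow_smul_vertex_smul {i j : W} (a : i ⟶ j) (x : U) :
    arrow (k := k) a • vertex (k := k) i • x = arrow (k := k) a • x := by
  rw [smul_smul, arrow, ofPath_mul_vertex]

variable {U' : Type*} [Module k U] [IsScalarTower k (PathAlgebra k W) U]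
  [AddCommGroup U'] [Module k U'] [Module (PathAlgebra k W) U']
  [IsScalarTower k (PathAlgebra k W) U']

/-- Paths span the algebra, and each is a product of arrows applied to a trivial path, so induction
on the length suffices. -/
lemma map_smul_of_map_vertex_arrow (φ : U →ₗ[k] U')
    (hv : ∀ (i : W) x, φ (vertex (k := k) i • x) = vertex (k := k) i • φ x)
    (ha : ∀ {i j : W} (a : i ⟶ j) x, φ (arrow (k := k) a • x) = arrow (k := k) a • φ x)
    (c : PathAlgebra k W) (x : U) : φ (c • x) = c • φ x := by
  induction c using PathAlgebra.path_induction generalizing x with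
  | zero => simp
  | add a b ha hb => simp only [add_smul, map_add, ha, hb]
  | smul c a ha => simp only [smul_assoc, map_smul, ha]
  | path p =>
    induction p with
    | nil => exact hv _ x
    | cons p a ih => rw [← arrow_mul_ofPath, mul_smul, mul_smul, ha, ih]

/-- A linear map that commutes with the trivial paths and the arrows is linear over the path
algebra. -/
def linearMapOfVertexArrow (φ : U →ₗ[k] U')
    (hv : ∀ (i : W) x, φ (vertex (k := k) i • x) = vertex (k := k) i • φ x)
    (ha : ∀ {i j : W} (a : i ⟶ j) x, φ (arrow (k := k) a • x) = arrow (k := k) a • φ x) :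
    U →ₗ[PathAlgebra k W] U' where
  toFun := φ
  map_add' := map_add φ
  map_smul' := map_smul_of_map_vertex_arrow φ hv ha

end PathAlgebra

/-! ### Modules over kQ/J² and sections of the projection to the top -/

namespace RadSqZero

section Basic

variable {k V : Type u} [Field k] [Quiver.{u} V] [Fintype V]

/-- The element of `kQ/J²` given by an arrow. -/
noncomputable abbrev ar (α : QuiverArrow V) : RadSqZero k V := arrow α.2.2

/-- The element of the path algebra of the opposite quiver given by a reversed arrow. -/
noncomputable abbrev dual (α : QuiverArrow V) : PathAlgebra k Vᵒᵖ := PathAlgebra.arrow α.2.2.op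

/-- The trivial path of the opposite quiver at a vertex. -/
noncomputable abbrev dualVertex (i : V) : PathAlgebra k Vᵒᵖ :=
  PathAlgebra.vertex (Opposite.op i)

variable {T W : Type*} [AddCommGroup T] [Module (RadSqZero k V) T]
  [AddCommGroup W] [Module (RadSqZero k V) W]

lemma vertex_smul_vertex_smul (i : V) (x : T) :
    vertex (k := k) i • vertex (k := k) i • x = vertex (k := k) i • x := by
  rw [smul_smul, vertex_mul_self]

lemma vertex_smul_vertex_smul_of_ne {i j : V} (h : i ≠ j) (x : T) :
    vertex (k := k) i • vertex (k := k) j • x = 0 := by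
  rw [smul_smul, vertex_mul_of_ne h, zero_smul]

lemma ar_smul_ar_smul (α β : QuiverArrow V) (x : T) : ar (k := k) α • ar (k := k) β • x = 0 := by
  rw [smul_smul, arrow_mul_arrow, zero_smul]

lemma ar_smul_vertex_smul (α : QuiverArrow V) (x : T) :
    ar (k := k) α • vertex (k := k) α.1 • x = ar (k := k) α • x := by
  rw [smul_smul, arrow_mul_vertex]

lemma vertex_smul_ar_smul (α : QuiverArrow V) (x : T) :
    vertex (k := k) α.2.1 • ar (k := k) α • x = ar (k := k) α • x := by
  rw [smul_smul, vertex_mul_arrow]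

lemma ar_smul_vertex_smul_of_ne {α : QuiverArrow V} {i : V} (h : α.1 ≠ i) (x : T) :
    ar (k := k) α • vertex (k := k) i • x = 0 := by
  rw [smul_smul, arrow_mul_vertex_of_ne _ h, zero_smul]

lemma vertex_smul_ar_smul_of_ne {α : QuiverArrow V} {i : V} (h : i ≠ α.2.1) (x : T) :
    vertex (k := k) i • ar (k := k) α • x = 0 := by
  rw [smul_smul, vertex_mul_arrow_of_ne _ h, zero_smul]

variable [Module k T] [IsScalarTower k (RadSqZero k V) T]
  [Module k W] [IsScalarTower k (RadSqZero k V) W]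

/-- The part of a linear map that commutes with the vertices. -/
noncomputable def vertexPart (φ : T →ₗ[k] W) : T →ₗ[k] W :=
  ∑ i : V, Algebra.lsmul k k W (vertex (k := k) i) ∘ₗ φ ∘ₗ Algebra.lsmul k k T (vertex (k := k) i)

lemma vertexPart_apply (φ : T →ₗ[k] W) (x : T) :
    vertexPart (V := V) φ x = ∑ i : V, vertex (k := k) i • φ (vertex (k := k) i • x) := by
  simp [vertexPart]

lemma vertexPart_vertex_smul (φ : T →ₗ[k] W) (i : V) (x : T) :
    vertexPart (V := V) φ (vertex (k := k) i • x) = vertex (k := k) i • vertexPart (V := V) φ x := by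
  classical
  rw [vertexPart_apply, vertexPart_apply, Finset.smul_sum, Finset.sum_eq_single i,
    Finset.sum_eq_single i]
  · simp only [vertex_smul_vertex_smul]
  · intro j _ hj
    exact vertex_smul_vertex_smul_of_ne hj.symm _
  · simp
  · intro j _ hj
    rw [vertex_smul_vertex_smul_of_ne hj, map_zero, smul_zero]
  · simp

/-- Linear maps that commute with the vertices can be lifted along such maps. -/
lemma exists_vertexLinear_lift {W' : Type*} [AddCommGroup W'] [Module (RadSqZero k V) W']
    [Module k W'] [IsScalarTower k (RadSqZero k V) W'] (q : W →ₗ[k] W')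
    (hq : ∀ (i : V) x, q (vertex (k := k) i • x) = vertex (k := k) i • q x)
    (ψ : T →ₗ[k] W') (hψ : ∀ (i : V) x, ψ (vertex (k := k) i • x) = vertex (k := k) i • ψ x)
    (h : ∀ x, ∃ y, q y = ψ x) :
    ∃ φ : T →ₗ[k] W, (∀ (i : V) x, φ (vertex (k := k) i • x) = vertex (k := k) i • φ x) ∧
      ∀ x, q (φ x) = ψ x := by
  obtain ⟨φ, hφ⟩ := Module.projective_lifting_property q.rangeRestrict
    (ψ.codRestrict (LinearMap.range q) h) q.surjective_rangeRestrict
  have hφ' : ∀ x, q (φ x) = ψ x := fun x => congrArg Subtype.val (LinearMap.congr_fun hφ x)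
  -- A k-linear lift φ exists because k is a field. Replacing it by Σ e_i φ e_i keeps it a lift,
  -- since q and ψ commute with the e_i and the e_i sum to 1.
  refine ⟨vertexPart (V := V) φ, vertexPart_vertex_smul φ, fun x => ?_⟩
  simp only [vertexPart_apply, map_sum, hq, hφ', hψ, vertex_smul_vertex_smul]
  exact RadSqZero.sum_vertex_smul _

end Basic

section Head

variable {k V : Type u} [Field k] [Quiver.{u} V] [Fintype V]
variable (k V) (T : Type*) [AddCommGroup T] [Module (RadSqZero k V) T]

/-- The top `T / rad T` of a module. -/
abbrev Head : Type _ := T ⧸ Module.jacobson (RadSqZero k V) T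

variable {T}

/-- The class in the top of an element of a module. -/
noncomputable abbrev toHead : T →ₗ[RadSqZero k V] Head k V T := (Module.jacobson (RadSqZero k V) T).mkQ

variable {k V}

lemma toHead_eq_zero {x : T} : toHead k V x = 0 ↔ x ∈ Module.jacobson (RadSqZero k V) T :=
  Submodule.Quotient.mk_eq_zero _

section

variable [∀ i j : V, Fintype (i ⟶ j)]

lemma toHead_ar_smul (α : QuiverArrow V) (x : T) : toHead k V (ar (k := k) α • x) = 0 :=
  toHead_eq_zero.2 (arrow_smul_mem_jacobson _ _)

end

variable [Module k T] [IsScalarTower k (RadSqZero k V) T]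

variable (k V T) in
lemma exists_headSection : ∃ σ : Head k V T →ₗ[k] T,
    (∀ (i : V) t, σ (vertex (k := k) i • t) = vertex (k := k) i • σ t) ∧
      ∀ t, toHead k V (σ t) = t :=
  exists_vertexLinear_lift (V := V) ((toHead k V (T := T)).restrictScalars k)
    (fun _ x => map_smul (toHead k V (T := T)) _ x) LinearMap.id (fun _ _ => rfl)
    (Submodule.mkQ_surjective _)

variable (k V T) in
/-- A linear section of the projection to the top that commutes with the vertices. -/
noncomputable def headSection : Head k V T →ₗ[k] T := (exists_headSection k V T).choose

lemma headSection_vertex_smul (i : V) (t : Head k V T) :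
    headSection k V T (vertex (k := k) i • t) = vertex (k := k) i • headSection k V T t :=
  (exists_headSection k V T).choose_spec.1 i t

@[simp]
lemma toHead_headSection (t : Head k V T) : toHead k V (headSection k V T t) = t :=
  (exists_headSection k V T).choose_spec.2 t

variable [∀ i j : V, Fintype (i ⟶ j)]
variable {W : Type*} [AddCommGroup W] [Module (RadSqZero k V) W]
variable [Module k W] [IsScalarTower k (RadSqZero k V) W]

lemma map_smul_of_map_vertex_ar (φ : T →ₗ[k] W)
    (hv : ∀ (i : V) x, φ (vertex (k := k) i • x) = vertex (k := k) i • φ x)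
    (ha : ∀ (α : QuiverArrow V) x, φ (ar (k := k) α • x) = ar (k := k) α • φ x)
    (c : RadSqZero k V) (x : T) : φ (c • x) = c • φ x := by
  rw [decomp c]
  simp only [add_smul, Finset.sum_smul, map_add, map_sum, smul_assoc, map_smul, hv]
  congr 1
  refine Finset.sum_congr rfl fun i _ => Finset.sum_congr rfl fun j _ =>
    Finset.sum_congr rfl fun a _ => ?_
  rw [ha ⟨i, j, a⟩]

/-- A linear map that commutes with the vertices and the arrows is linear over `kQ/J²`. -/
def linearMapOfVertexAr (φ : T →ₗ[k] W)
    (hv : ∀ (i : V) x, φ (vertex (k := k) i • x) = vertex (k := k) i • φ x)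
    (ha : ∀ (α : QuiverArrow V) x, φ (ar (k := k) α • x) = ar (k := k) α • φ x) :
    T →ₗ[RadSqZero k V] W where
  toFun := φ
  map_add' := map_add φ
  map_smul' := map_smul_of_map_vertex_ar φ hv ha

end Head

end RadSqZero

/-! ### Normal form for elements of a projective module -/

namespace RadSqZero

section Coordinates

variable {k V : Type u} [Field k] [Quiver.{u} V] [Fintype V]
variable {T : Type*} [AddCommGroup T] [Module (RadSqZero k V) T]
  [Module.Projective (RadSqZero k V) T]

section

variable [Module k T] [IsScalarTower k (RadSqZero k V) T]

/-- The coordinate at an arrow of an element of a projective module, with values in the top. -/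
noncomputable def headCoeff (α : QuiverArrow V) : T →ₗ[k] Head k V T :=
  (toHead k V).restrictScalars k ∘ₗ arrowCoeff (k := k) α.2.2 ∘ₗ
    Algebra.lsmul k k T (vertex (k := k) α.2.1) ∘ₗ
    (LinearMap.id - headSection k V T ∘ₗ (toHead k V).restrictScalars k)

/-- Subtracting σ of the class of x moves x into the radical, which is where `sum_arrowCoeff`
recovers an element from its coefficients. -/
lemma headCoeff_apply (α : QuiverArrow V) (x : T) : headCoeff (k := k) α x =
    toHead k V (arrowCoeff (k := k) α.2.2
      (vertex (k := k) α.2.1 • (x - headSection k V T (toHead k V x)))) := rfl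

end

variable [∀ i j : V, Fintype (i ⟶ j)]
variable {W : Type*} [AddCommGroup W] [Module (RadSqZero k V) W]

/-- Arrows kill the radical of a projective module because J² = 0, so multiplying by an arrow only
sees classes in the top. -/
lemma ar_smul_eq_of_toHead_eq (α : QuiverArrow V) {x y : T} (h : toHead k V x = toHead k V y) :
    ar (k := k) α • x = ar (k := k) α • y := by
  rw [← sub_eq_zero, ← map_sub, toHead_eq_zero] at h
  rw [← sub_eq_zero, ← smul_sub]
  exact arrow_smul_of_mem_jacobson _ h

/-- Multiplying the relation by e_j isolates the arrows ending in j, to which the uniqueness in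
`mem_jacobson_of_sum_arrow_smul` applies. -/
lemma vertex_smul_toHead_eq_zero {y : QuiverArrow V → T} (h : ∑ α, ar (k := k) α • y α = 0)
    (α : QuiverArrow V) : vertex (k := k) α.1 • toHead k V (y α) = 0 := by
  classical
  obtain ⟨i, j, a⟩ := α
  rw [← map_smul, toHead_eq_zero]
  refine mem_jacobson_of_sum_arrow_smul (fun i a => y ⟨i, j, a⟩) ?_ i a
  have h' := congrArg (fun z => vertex (k := k) j • z) h
  simp only [Fintype.sum_sigma, smul_zero, Finset.smul_sum] at h'
  rw [← h']
  refine Finset.sum_congr rfl fun i _ => ?_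
  rw [Finset.sum_eq_single j]
  · exact Finset.sum_congr rfl fun a _ => (vertex_smul_ar_smul ⟨i, j, a⟩ _).symm
  · intro l _ hl
    exact Finset.sum_eq_zero fun a _ =>
      vertex_smul_ar_smul_of_ne (α := (⟨i, l, a⟩ : QuiverArrow V)) (i := j) hl.symm _
  · simp

variable [Module k T] [IsScalarTower k (RadSqZero k V) T]

lemma vertex_smul_headCoeff (α : QuiverArrow V) (x : T) :
    vertex (k := k) α.1 • headCoeff (k := k) α x = headCoeff (k := k) α x := by
  rw [headCoeff_apply, ← map_smul, vertex_smul_arrowCoeff]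

@[simp]
lemma headCoeff_headSection (α : QuiverArrow V) (t : Head k V T) :
    headCoeff (k := k) α (headSection k V T t) = 0 := by
  rw [headCoeff_apply, toHead_headSection, sub_self, smul_zero, map_zero, map_zero]

/-- Existence of the normal form: x - σ(class of x) lies in the radical and is a sum of arrow
multiples. Each factor may be replaced by σ of its class, because arrows only see the class. -/
lemma headSection_add_sum_headCoeff (x : T) :
    headSection k V T (toHead k V x) +
      ∑ α, ar (k := k) α • headSection k V T (headCoeff (k := k) α x) = x := by
  rw [← eq_sub_iff_add_eq', ← RadSqZero.sum_vertex_smul (k := k) (V := V)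
    (x - headSection k V T (toHead k V x))]
  simp only [Fintype.sum_sigma]
  have h (j : V) := sum_arrowCoeff (k := k) (j := j)
    (x := vertex (k := k) j • (x - headSection k V T (toHead k V x)))
    (by
      rw [← toHead_eq_zero, map_smul, map_sub, toHead_headSection, sub_self, smul_zero])
    (vertex_smul_vertex_smul _ _)
  rw [Finset.sum_comm]
  refine Finset.sum_congr rfl fun j _ => ?_
  rw [← h j]
  refine Finset.sum_congr rfl fun i _ => Finset.sum_congr rfl fun a _ => ?_
  refine ar_smul_eq_of_toHead_eq ⟨i, j, a⟩ ?_
  rw [toHead_headSection, headCoeff_apply]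

/-- Uniqueness of the normal form: the sum lies in the radical, so comparing it with its own normal
form and using `vertex_smul_toHead_eq_zero` identifies the coefficients. -/
lemma headCoeff_sum_ar_smul (α : QuiverArrow V) (y : QuiverArrow V → T) :
    headCoeff (k := k) α (∑ β, ar (k := k) β • y β) =
      vertex (k := k) α.1 • toHead k V (y α) := by
  have h := headSection_add_sum_headCoeff (k := k) (V := V) (∑ β : QuiverArrow V, ar (k := k) β • y β)
  have h0 : toHead k V (∑ β : QuiverArrow V, ar (k := k) β • y β) = 0 := by
    rw [map_sum]
    exact Finset.sum_eq_zero fun β _ => toHead_ar_smul β _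
  rw [h0, map_zero, zero_add, ← sub_eq_zero, ← Finset.sum_sub_distrib] at h
  simp only [← smul_sub] at h
  have := vertex_smul_toHead_eq_zero h α
  rwa [map_sub, toHead_headSection, smul_sub, vertex_smul_headCoeff, sub_eq_zero] at this

lemma headCoeff_ar_smul_self (α : QuiverArrow V) (y : T) :
    headCoeff (k := k) α (ar (k := k) α • y) = vertex (k := k) α.1 • toHead k V y := by
  classical
  have := headCoeff_sum_ar_smul (k := k) α (Pi.single α y)
  rw [Finset.sum_eq_single α] at this
  · simpa using this
  · intro β _ hβ
    rw [Pi.single_eq_of_ne hβ, smul_zero]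
  · simp

lemma headCoeff_ar_smul_of_ne {α β : QuiverArrow V} (h : α ≠ β) (y : T) :
    headCoeff (k := k) α (ar (k := k) β • y) = 0 := by
  classical
  have := headCoeff_sum_ar_smul (k := k) α (Pi.single β y)
  rw [Finset.sum_eq_single β] at this
  · simpa [h] using this
  · intro γ _ hγ
    rw [Pi.single_eq_of_ne hγ, smul_zero]
  · simp

lemma headCoeff_vertex_smul (α : QuiverArrow V) (x : T) :
    headCoeff (k := k) α (vertex (k := k) α.2.1 • x) = headCoeff (k := k) α x := by
  rw [headCoeff_apply, headCoeff_apply, map_smul (toHead k V), headSection_vertex_smul, ← smul_sub,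
    vertex_smul_vertex_smul]

lemma headCoeff_vertex_smul_of_ne {α : QuiverArrow V} {l : V} (h : α.2.1 ≠ l) (x : T) :
    headCoeff (k := k) α (vertex (k := k) l • x) = 0 := by
  rw [headCoeff_apply, map_smul (toHead k V), headSection_vertex_smul, ← smul_sub,
    vertex_smul_vertex_smul_of_ne h, map_zero, map_zero]

lemma eq_sum_of_toHead_eq_zero {x : T} (h : toHead k V x = 0) :
    ∑ α, ar (k := k) α • headSection k V T (headCoeff (k := k) α x) = x := by
  have := headSection_add_sum_headCoeff (k := k) (V := V) x
  rwa [h, map_zero, zero_add] at this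

lemma ext_headSection {f g : T →ₗ[RadSqZero k V] W}
    (h : ∀ t, f (headSection k V T t) = g (headSection k V T t)) : f = g := by
  ext x
  rw [← headSection_add_sum_headCoeff (k := k) (V := V) x]
  simp only [map_add, map_sum, map_smul, h]

variable [Module k W] [IsScalarTower k (RadSqZero k V) W]

/-- Linear maps out of a projective module over `kQ/J²` are given by linear maps out of the top
that commute with the vertices. -/
lemma exists_extension (φ : Head k V T →ₗ[k] W)
    (hφ : ∀ (i : V) t, φ (vertex (k := k) i • t) = vertex (k := k) i • φ t) :
    ∃ f : T →ₗ[RadSqZero k V] W, ∀ t, f (headSection k V T t) = φ t := by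
  classical
  -- The normal form forces this formula: an extension must send α σ(t_α) to α φ(t_α).
  let F : T →ₗ[k] W := φ ∘ₗ (toHead k V).restrictScalars k +
    ∑ α : QuiverArrow V, Algebra.lsmul k k W (ar (k := k) α) ∘ₗ φ ∘ₗ headCoeff (k := k) α
  have hF (x : T) : F x = φ (toHead k V x) +
      ∑ α : QuiverArrow V, ar (k := k) α • φ (headCoeff (k := k) α x) := by simp [F]
  refine ⟨linearMapOfVertexAr F (fun l x => ?_) (fun β x => ?_), fun t => ?_⟩
  · rw [hF, hF, smul_add, map_smul, hφ, Finset.smul_sum]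
    congr 1
    refine Finset.sum_congr rfl fun α _ => ?_
    by_cases h : α.2.1 = l
    · subst h
      rw [headCoeff_vertex_smul, vertex_smul_ar_smul]
    · rw [headCoeff_vertex_smul_of_ne h, vertex_smul_ar_smul_of_ne (Ne.symm h), map_zero,
        smul_zero]
  -- On β x only the coordinate at β survives, giving β φ(class of x). On the other side β
  -- annihilates the arrow terms of F x.
  · rw [hF, hF, toHead_ar_smul, map_zero, zero_add, smul_add, Finset.smul_sum,
      Finset.sum_eq_single β, headCoeff_ar_smul_self, hφ, ar_smul_vertex_smul, left_eq_add]
    · exact Finset.sum_eq_zero fun α _ => ar_smul_ar_smul _ _ _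
    · intro α _ hα
      rw [headCoeff_ar_smul_of_ne hα, map_zero, smul_zero]
    · simp
  · change F _ = _
    rw [hF, toHead_headSection]
    simp

end Coordinates

/-! ### The differential of a reduced module in coordinates -/

section Dual

variable {k V : Type u} [Field k] [Quiver.{u} V] [Fintype V] [∀ i j : V, Fintype (i ⟶ j)]
variable (M : DiffProj (RadSqZero k V)) (hM : M.IsReduced)

namespace KoszulDual

/-- The linear isomorphism (the identity) from `F(M)` to the top of `M`. -/
noncomputable def toTop : KoszulDual M hM ≃ₗ[k] Head k V M := LinearEquiv.refl k _

variable {M hM}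

lemma toTop_vertex_smul (i : V) (x : KoszulDual M hM) :
    toTop M hM (dualVertex (k := k) i • x) = vertex (k := k) i • toTop M hM x := by
  obtain ⟨y, rfl⟩ := Submodule.mkQ_surjective _ x
  exact KoszulDual.vertex_smul M hM i y

lemma toTop_symm_vertex_smul (i : V) (x : Head k V M) :
    (toTop M hM).symm (vertex (k := k) i • x) = dualVertex (k := k) i • (toTop M hM).symm x := by
  rw [LinearEquiv.symm_apply_eq, toTop_vertex_smul, LinearEquiv.apply_symm_apply]

/-- The differential of `M` in terms of the action of the reversed arrows on `F(M)`. -/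
lemma d_headSection (x : KoszulDual M hM) :
    M.d (headSection k V M (toTop M hM x)) =
      ∑ α : QuiverArrow V, ar (k := k) α • headSection k V M (toTop M hM (dual (k := k) α • x)) := by
  conv_lhs => rw [← RadSqZero.sum_vertex_smul (k := k) (V := V) (headSection k V M (toTop M hM x))]
  -- The defining property of the components is applied at each target vertex j, with σ(α* x) as the
  -- chosen lifts.
  rw [map_sum, Fintype.sum_sigma, Finset.sum_congr rfl fun j _ =>
    (components_spec M hM).sum j (headSection k V M (toTop M hM x))
      (fun i a => headSection k V M (toTop M hM (dual (k := k) ⟨i, j, a⟩ • x))) ?_,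
    Finset.sum_comm]
  · simp only [Fintype.sum_sigma]
  · intro i a
    refine (toHead_headSection _).trans ?_
    refine (arrow_smul M hM a x).trans ?_
    exact congrArg (components M hM a) (toHead_headSection (T := M) (toTop M hM x)).symm

lemma toHead_d {M : DiffProj (RadSqZero k V)} (hM : M.IsReduced) (x : M) :
    toHead k V (M.d x) = 0 :=
  toHead_eq_zero.2 (mem_jacobson_of_isReducedDiff M.d_comp_d hM x)

end KoszulDual

end Dual

end RadSqZero

/-! ### The arrow ideal as a projective left module, and Ext from kQ/J -/

namespace PathAlgebra

section Arrows

variable {k W : Type u} [Field k] [Quiver.{u} W] [Fintype W]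
variable {U : Type*} [AddCommGroup U] [Module k U] [Module (PathAlgebra k W) U]
  [IsScalarTower k (PathAlgebra k W) U]

/-- The value at a path of the map out of the arrow ideal with given values at the arrows. -/
noncomputable def arrowEval (y : ∀ {i j : W}, (i ⟶ j) → U) {i : W} : ∀ {j : W}, Quiver.Path i j → U
  | _, Quiver.Path.nil => 0
  | _, Quiver.Path.cons Quiver.Path.nil a => y a
  | _, Quiver.Path.cons (Quiver.Path.cons p b) a =>
      arrow (k := k) a • arrowEval y (Quiver.Path.cons p b)

/-- The linear extension of `arrowEval`. -/
noncomputable def arrowEvalLinear (y : ∀ {i j : W}, (i ⟶ j) → U) : PathAlgebra k W →ₗ[k] U :=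
  (basis k W).constr k fun p => arrowEval (k := k) y p.2.2

lemma arrowEvalLinear_ofPath (y : ∀ {i j : W}, (i ⟶ j) → U) {i j : W} (p : Quiver.Path i j) :
    arrowEvalLinear (k := k) y (ofPath p) = arrowEval (k := k) y p := by
  rw [arrowEvalLinear, ofPath, Module.Basis.constr_basis]

lemma arrowEvalLinear_arrow (y : ∀ {i j : W}, (i ⟶ j) → U) {i j : W} (a : i ⟶ j) :
    arrowEvalLinear (k := k) y (arrow a) = y a := by
  rw [arrow, arrowEvalLinear_ofPath]
  simp [Quiver.Hom.toPath, arrowEval]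

lemma arrowEval_cons (y : ∀ {i j : W}, (i ⟶ j) → U) {i j l : W} (p : Quiver.Path i j)
    (hp : 1 ≤ p.length) (a : j ⟶ l) :
    arrowEval (k := k) y (p.cons a) = arrow (k := k) a • arrowEval (k := k) y p := by
  cases p with
  | nil => simp at hp
  | cons p b => rw [arrowEval]

lemma vertex_smul_arrowEval (y : ∀ {i j : W}, (i ⟶ j) → U)
    (hy : ∀ {i j : W} (a : i ⟶ j), vertex (k := k) j • y a = y a) {i j : W}
    (p : Quiver.Path i j) : vertex (k := k) j • arrowEval (k := k) y p = arrowEval (k := k) y p := by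
  cases p with
  | nil => rw [arrowEval, smul_zero]
  | cons p a =>
    cases p with
    | nil => rw [arrowEval, hy]
    | cons p b => rw [arrowEval, vertex_smul_arrow_smul]

lemma filt_le_arrowIdeal : filt k W 1 ≤ (arrowIdeal k W).restrictScalars k := by
  refine Submodule.span_le.2 ?_
  rintro _ ⟨i, j, p, hp, rfl⟩
  cases p with
  | nil => simp at hp
  | cons p a =>
    rw [← arrow_mul_ofPath]
    exact Ideal.mul_mem_right _ _ (arrow_mem a)

/-- Induction for the elements of the arrow ideal. -/
lemma arrowIdeal_induction {P : PathAlgebra k W → Prop} {x : PathAlgebra k W}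
    (hx : x ∈ arrowIdeal k W)
    (path : ∀ {i j : W} (p : Quiver.Path i j), 1 ≤ p.length → P (ofPath p)) (zero : P 0)
    (add : ∀ x y, P x → P y → P (x + y)) (smul : ∀ (c : k) x, P x → P (c • x)) : P x := by
  refine Submodule.span_induction (p := fun x _ => P x) ?_ zero (fun x y _ _ => add x y)
    (fun c x _ => smul c x) (mem_filt_one_of_mem_arrowIdeal hx)
  rintro _ ⟨i, j, p, hp, rfl⟩
  exact path p hp

lemma vertex_smul_arrowEvalLinear (y : ∀ {i j : W}, (i ⟶ j) → U)
    (hy : ∀ {i j : W} (a : i ⟶ j), vertex (k := k) j • y a = y a) (l : W) {x : PathAlgebra k W}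
    (hx : x ∈ arrowIdeal k W) : arrowEvalLinear (k := k) y (vertex l * x) =
      vertex (k := k) l • arrowEvalLinear (k := k) y x := by
  refine arrowIdeal_induction (P := fun x => arrowEvalLinear (k := k) y (vertex l * x) =
    vertex (k := k) l • arrowEvalLinear (k := k) y x) hx ?_ (by simp)
    (fun _ _ h h' => by rw [mul_add, map_add, h, h', map_add, smul_add])
    (fun c _ h => by rw [mul_smul_comm, map_smul, h, map_smul, smul_comm])
  intro i j p _
  rw [arrowEvalLinear_ofPath, ← vertex_smul_arrowEval y hy]
  by_cases h : l = j
  · subst h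
    rw [vertex_mul_ofPath, arrowEvalLinear_ofPath, vertex_smul_arrowEval y hy,
      vertex_smul_arrowEval y hy]
  · rw [vertex_smul_vertex_smul_of_ne h, vertex, ofPath_mul_ofPath_of_ne _ _ h, map_zero]

/-- Left multiplication appends the arrow at the end of a path, while `arrowEval` uses y only at the
first arrow. The identity can fail on trivial paths, which `arrowEval` sends to 0; hence the
restriction to the arrow ideal. -/
lemma arrow_smul_arrowEvalLinear (y : ∀ {i j : W}, (i ⟶ j) → U)
    (hy : ∀ {i j : W} (a : i ⟶ j), vertex (k := k) j • y a = y a) {i j : W} (a : i ⟶ j)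
    {x : PathAlgebra k W} (hx : x ∈ arrowIdeal k W) :
    arrowEvalLinear (k := k) y (arrow a * x) =
      arrow (k := k) a • arrowEvalLinear (k := k) y x := by
  refine arrowIdeal_induction (P := fun x => arrowEvalLinear (k := k) y (arrow a * x) =
    arrow (k := k) a • arrowEvalLinear (k := k) y x) hx ?_ (by simp)
    (fun _ _ h h' => by rw [mul_add, map_add, h, h', map_add, smul_add])
    (fun c _ h => by rw [mul_smul_comm, map_smul, h, map_smul, smul_comm])
  intro i' j' p hp
  by_cases h : i = j'
  · subst h
    rw [arrow_mul_ofPath, arrowEvalLinear_ofPath, arrowEvalLinear_ofPath, arrowEval_cons y p hp]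
  · rw [arrowEvalLinear_ofPath, ← vertex_smul_arrowEval y hy, ← arrow_smul_vertex_smul a,
      vertex_smul_vertex_smul_of_ne h, smul_zero, arrow, ofPath_mul_ofPath_of_ne _ _ h, map_zero]

/-- A linear map out of the arrow ideal may take arbitrary values at the arrows. -/
lemma exists_arrowIdeal_linearMap (y : ∀ {i j : W}, (i ⟶ j) → U)
    (hy : ∀ {i j : W} (a : i ⟶ j), vertex (k := k) j • y a = y a) :
    ∃ φ : arrowIdeal k W →ₗ[PathAlgebra k W] U,
      ∀ {i j : W} (a : i ⟶ j), φ ⟨arrow a, arrow_mem a⟩ = y a :=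
  -- Every path of positive length factors uniquely as a path after its first arrow, so the ideal is
  -- the direct sum of the left modules generated by the arrows a, each isomorphic to kQ e_{t(a)}.
  -- The condition `hy` is what permits a ↦ y a.
  ⟨linearMapOfVertexArrow
    (arrowEvalLinear (k := k) y ∘ₗ (arrowIdeal k W).subtype.restrictScalars k)
    (fun i x => vertex_smul_arrowEvalLinear y hy i x.2)
    (fun a x => arrow_smul_arrowEvalLinear y hy a x.2), fun a => arrowEvalLinear_arrow y a⟩

/-- A linear map out of the arrow ideal is determined by its values at the arrows. -/
lemma arrowIdeal_linearMap_eq {φ : arrowIdeal k W →ₗ[PathAlgebra k W] U} {x : U}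
    (h : ∀ {i j : W} (a : i ⟶ j), φ ⟨arrow a, arrow_mem a⟩ = arrow (k := k) a • x)
    (c : arrowIdeal k W) : φ c = (c : PathAlgebra k W) • x := by
  have key : ∀ {i j : W} (p : Quiver.Path i j) (hp : ofPath p ∈ arrowIdeal k W), 1 ≤ p.length →
      φ ⟨ofPath p, hp⟩ = ofPath (k := k) p • x := by
    intro i j p hp h1
    induction p with
    | nil => simp at h1
    | @cons j l p a ih =>
      cases p with
      | nil => exact h a
      | cons p b =>
        have hp' : ofPath (p.cons b) ∈ arrowIdeal k W :=
          filt_le_arrowIdeal (ofPath_mem_filt _ (by simp))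
        have e : (⟨ofPath ((p.cons b).cons a), hp⟩ : arrowIdeal k W) =
            arrow (k := k) a • ⟨ofPath (p.cons b), hp'⟩ :=
          Subtype.ext (arrow_mul_ofPath _ _).symm
        rw [e, map_smul, ih hp' (by simp), smul_smul, arrow_mul_ofPath]
  obtain ⟨c, hc⟩ := c
  suffices H : ∃ hc, φ ⟨c, hc⟩ = c • x from H.2
  refine arrowIdeal_induction (P := fun c => ∃ hc, φ ⟨c, hc⟩ = c • x) hc ?_ ?_ ?_ ?_
  · exact fun p hp => ⟨filt_le_arrowIdeal (ofPath_mem_filt _ hp), key p _ hp⟩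
  · exact ⟨zero_mem _, by rw [zero_smul]; exact map_zero φ⟩
  · rintro a b ⟨ha, ea⟩ ⟨hb, eb⟩
    exact ⟨add_mem ha hb, by rw [add_smul, ← ea, ← eb, ← map_add]; rfl⟩
  · rintro t a ⟨ha, ea⟩
    refine ⟨((arrowIdeal k W).restrictScalars k).smul_mem t ha, ?_⟩
    rw [smul_assoc, ← ea, ← algebraMap_smul (PathAlgebra k W) t (φ _), ← map_smul]
    congr 1
    exact Subtype.ext (Algebra.smul_def t a)

end Arrows

section Ext

open Abelian

variable {k W : Type u} [Field k] [Quiver.{u} W] [Fintype W]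

variable (k W) in
/-- The short exact sequence `0 → J → kQ → kQ/J → 0`. -/
noncomputable def vertexSequence : ShortComplex (ModuleCat.{u} (PathAlgebra k W)) :=
  ShortComplex.mk (ModuleCat.ofHom (arrowIdeal k W).subtype)
    (ModuleCat.ofHom (arrowIdeal k W).mkQ) (by
      ext x
      exact (Submodule.Quotient.mk_eq_zero _).2 x.2)

lemma vertexSequence_shortExact : (vertexSequence k W).ShortExact where
  exact := by
    rw [ShortComplex.moduleCat_exact_iff]
    intro x hx
    exact ⟨⟨x, (Submodule.Quotient.mk_eq_zero _).1 hx⟩, rfl⟩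
  mono_f := (ModuleCat.mono_iff_injective _).2 Subtype.val_injective
  epi_g := (ModuleCat.epi_iff_surjective _).2 (Submodule.mkQ_surjective _)

variable {U : Type u} [AddCommGroup U] [Module k U] [Module (PathAlgebra k W) U]
  [IsScalarTower k (PathAlgebra k W) U]

/-- A map out of kQ/J is the choice of an image of 1 that J annihilates, and it is enough that the
arrows annihilate it. -/
lemma subsingleton_ext_zero_iff :
    Subsingleton (Ext (ModuleCat.of (PathAlgebra k W) (vertexModule k W))
        (ModuleCat.of (PathAlgebra k W) U) 0) ↔
      ∀ x : U, (∀ {i j : W} (a : i ⟶ j), arrow (k := k) a • x = 0) → x = 0 := by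
  rw [Ext.homEquiv₀.subsingleton_congr, ModuleCat.homEquiv.subsingleton_congr]
  constructor
  · intro hs x hx
    let φ : vertexModule k W →ₗ[PathAlgebra k W] U :=
      (arrowIdeal k W).liftQ (LinearMap.toSpanSingleton _ _ x) fun c hc => by
        -- The zero map and c ↦ c • x agree on arrows, hence on all of J; so c ↦ c • x descends to
        -- the quotient.
        have := arrowIdeal_linearMap_eq (k := k) (U := U) (φ := 0) (x := x)
          (fun a => (hx a).symm) ⟨c, hc⟩
        exact this.symm
    have h0 : φ = 0 := Subsingleton.elim _ _
    have h1 : φ ((arrowIdeal k W).mkQ 1) = x := one_smul _ x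
    rw [← h1, h0, LinearMap.zero_apply]
  · intro h
    refine ⟨fun φ ψ => ?_⟩
    refine Submodule.linearMap_qext _ (LinearMap.ext_ring (sub_eq_zero.1 (h _ fun a => ?_)))
    rw [smul_sub, sub_eq_zero, ← map_smul, ← map_smul]
    have : arrow (k := k) a • (1 : PathAlgebra k W) ∈ arrowIdeal k W := by
      rw [smul_eq_mul, mul_one]
      exact arrow_mem a
    simp only [LinearMap.comp_apply, Submodule.mkQ_apply, (Submodule.Quotient.mk_eq_zero _).2 this,
      map_zero]

/-- As kQ is projective, the long exact sequence presents Ext¹ as the cokernel of the restriction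
Hom(kQ, U) → Hom(J, U), and Hom(kQ, U) is U. -/
lemma subsingleton_ext_one_iff :
    Subsingleton (Ext (ModuleCat.of (PathAlgebra k W) (vertexModule k W))
        (ModuleCat.of (PathAlgebra k W) U) 1) ↔
      ∀ φ : arrowIdeal k W →ₗ[PathAlgebra k W] U, ∃ x : U, ∀ c, φ c = (c : PathAlgebra k W) • x := by
  have hS := vertexSequence_shortExact (k := k) (W := W)
  have : Projective (vertexSequence k W).X₂ :=
    inferInstanceAs (Projective (ModuleCat.of (PathAlgebra k W) (PathAlgebra k W)))
  change Subsingleton (Ext (vertexSequence k W).X₃ _ 1) ↔ _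
  constructor
  · intro hs φ
    let f : (vertexSequence k W).X₁ ⟶ ModuleCat.of (PathAlgebra k W) U := ModuleCat.ofHom φ
    obtain ⟨g, hg⟩ := Ext.contravariant_sequence_exact₁ hS (ModuleCat.of (PathAlgebra k W) U)
      (Ext.mk₀ f) (n₁ := 1) rfl (Subsingleton.elim _ _)
    obtain ⟨g, rfl⟩ := Ext.homEquiv₀.symm.surjective g
    rw [Ext.homEquiv₀_symm_apply, Ext.mk₀_comp_mk₀] at hg
    have hg' := Ext.homEquiv₀.symm.injective hg
    refine ⟨g.hom (1 : PathAlgebra k W), fun c => ?_⟩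
    have e : f.hom c = g.hom (c : PathAlgebra k W) := by
      rw [← hg']
      rfl
    have e' := map_smul (show PathAlgebra k W →ₗ[PathAlgebra k W] U from g.hom) c.1 1
    rw [smul_eq_mul, mul_one] at e'
    exact e.trans e'
  · intro h
    refine subsingleton_of_forall_eq 0 fun z => ?_
    obtain ⟨f, rfl⟩ := Ext.contravariant_sequence_exact₃ hS _ z (n₀ := 0)
      (Ext.eq_zero_of_projective _) rfl
    obtain ⟨f, rfl⟩ := Ext.homEquiv₀.symm.surjective f
    obtain ⟨x, hx⟩ := h f.hom
    let g : (vertexSequence k W).X₂ ⟶ ModuleCat.of (PathAlgebra k W) U :=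
      ModuleCat.ofHom (LinearMap.toSpanSingleton (PathAlgebra k W) U x)
    have hfg : f = (vertexSequence k W).f ≫ g := by
      ext c
      exact hx c
    -- A map that extends to kQ has zero image under the connecting homomorphism, since the
    -- extension class is killed by the inclusion of J.
    rw [Ext.homEquiv₀_symm_apply, hfg, ← Ext.mk₀_comp_mk₀, ← Ext.comp_assoc_of_second_deg_zero,
      hS.extClass_comp,
      Ext.zero_comp]

/-- The vanishing of `Ext` from the semisimple module in terms of the action of the arrows. -/
lemma subsingleton_ext_one_iff_arrow :
    Subsingleton (Ext (ModuleCat.of (PathAlgebra k W) (vertexModule k W))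
        (ModuleCat.of (PathAlgebra k W) U) 1) ↔
      ∀ y : ∀ {i j : W}, (i ⟶ j) → U,
        (∀ {i j : W} (a : i ⟶ j), vertex (k := k) j • y a = y a) →
        ∃ x : U, ∀ {i j : W} (a : i ⟶ j), arrow (k := k) a • x = y a := by
  rw [subsingleton_ext_one_iff]
  constructor
  · intro h y hy
    obtain ⟨φ, hφ⟩ := exists_arrowIdeal_linearMap (k := k) y hy
    obtain ⟨x, hx⟩ := h φ
    exact ⟨x, fun a => by rw [← hφ a, hx]⟩
  · intro h φ
    obtain ⟨x, hx⟩ := h (fun a => φ ⟨arrow a, arrow_mem a⟩) (fun a => by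
      rw [← map_smul]
      congr 1
      exact Subtype.ext (vertex_mul_ofPath _))
    exact ⟨x, arrowIdeal_linearMap_eq fun a => (hx a).symm⟩

end Ext

end PathAlgebra

/-! ### Finite dimension and exactness -/

namespace RadSqZero

namespace KoszulDual

variable {k V : Type u} [Field k] [Quiver.{u} V] [Fintype V] [∀ i j : V, Fintype (i ⟶ j)]
variable {M : DiffProj (RadSqZero k V)} {hM : M.IsReduced}

/-- The normal form makes M a quotient of a product of copies of its top, one for σ and one for each
of the finitely many arrows. -/
lemma finiteDimensional_iff : FiniteDimensional k M ↔ FiniteDimensional k (KoszulDual M hM) := by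
  constructor
  · intro h
    have : FiniteDimensional k (Head k V M) := inferInstance
    exact Module.Finite.equiv (toTop M hM).symm
  · intro h
    have : FiniteDimensional k (Head k V M) := Module.Finite.equiv (toTop M hM)
    let F : (Head k V M × (QuiverArrow V → Head k V M)) →ₗ[k] M :=
      headSection k V M ∘ₗ LinearMap.fst _ _ _ + ∑ α : QuiverArrow V,
        Algebra.lsmul k k M (ar (k := k) α) ∘ₗ headSection k V M ∘ₗ LinearMap.proj α ∘ₗ
          LinearMap.snd _ _ _
    refine Module.Finite.of_surjective F fun x =>
      ⟨(toHead k V x, fun α => headCoeff (k := k) α x), ?_⟩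
    conv_rhs => rw [← headSection_add_sum_headCoeff (k := k) (V := V) x]
    simp [F]

/-- Exactness in terms of the action of the reversed arrows. -/
lemma isExact_iff : M.IsExact ↔
    (∀ x : KoszulDual M hM, (∀ α : QuiverArrow V, dual (k := k) α • x = 0) → x = 0) ∧
    ∀ y : QuiverArrow V → KoszulDual M hM, (∀ α, dualVertex (k := k) α.1 • y α = y α) →
      ∃ x : KoszulDual M hM, ∀ α, dual (k := k) α • x = y α := by
  -- A radical endomorphism kills the radical, so d factors through the top. Its image is again in
  -- the radical, so exactness forces kernel, image and radical to coincide.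
  have hker {x : M} (hx : toHead k V x = 0) : M.d x = 0 :=
    apply_eq_zero_of_mem_jacobson (k := k) (V := V) (fun y => toHead_eq_zero.1 (toHead_d hM y))
      (toHead_eq_zero.1 hx)
  have hd (x : M) : M.d x = M.d (headSection k V M (toHead k V x)) := by
    rw [← sub_eq_zero, ← map_sub]
    exact hker (by rw [map_sub, toHead_headSection, sub_self])
  have hcoeff (α : QuiverArrow V) (x : KoszulDual M hM) :
      headCoeff (k := k) α (M.d (headSection k V M (toTop M hM x))) =
        toTop M hM (dual (k := k) α • x) := by
    rw [d_headSection, headCoeff_sum_ar_smul, toHead_headSection, ← toTop_vertex_smul,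
      PathAlgebra.vertex_smul_arrow_smul]
  constructor
  · intro h
    refine ⟨fun x hx => ?_, fun y hy => ?_⟩
    · have : headSection k V M (toTop M hM x) ∈ LinearMap.ker M.d := by
        rw [LinearMap.mem_ker, d_headSection]
        exact Finset.sum_eq_zero fun α _ => by rw [hx, map_zero, map_zero, smul_zero]
      rw [h] at this
      obtain ⟨z, hz⟩ := this
      have h0 := toHead_d hM z
      rw [hz, toHead_headSection] at h0
      exact (toTop M hM).injective (h0.trans (map_zero _).symm)
    · have : ∑ α : QuiverArrow V, ar (k := k) α • headSection k V M (toTop M hM (y α)) ∈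
          LinearMap.ker M.d := by
        refine hker ?_
        rw [map_sum]
        exact Finset.sum_eq_zero fun α _ => toHead_ar_smul α _
      rw [h] at this
      obtain ⟨z, hz⟩ := this
      refine ⟨(toTop M hM).symm (toHead k V z), fun α => (toTop M hM).injective ?_⟩
      rw [← hcoeff, LinearEquiv.apply_symm_apply, ← hd, hz, headCoeff_sum_ar_smul,
        toHead_headSection, ← toTop_vertex_smul]
      exact congrArg _ (hy α)
  · rintro ⟨h0, h1⟩
    apply le_antisymm
    · intro m hm
      rw [LinearMap.mem_ker] at hm
      -- The α-coordinate of d m is α* applied to the class of m, so injectivity puts m in the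
      -- radical; surjectivity then realizes its arrow coordinates.
      have hm0 : toHead k V m = 0 := by
        refine ((toTop M hM).symm.map_eq_zero_iff).1 (h0 _ fun α => (toTop M hM).injective ?_)
        rw [← hcoeff, LinearEquiv.apply_symm_apply, ← hd, hm, map_zero, map_zero]
      obtain ⟨x, hx⟩ := h1 (fun α => (toTop M hM).symm (headCoeff (k := k) α m)) fun α => by
        rw [← toTop_symm_vertex_smul, vertex_smul_headCoeff]
      refine ⟨headSection k V M (toTop M hM x), ?_⟩
      rw [d_headSection, ← eq_sum_of_toHead_eq_zero hm0]
      simp only [hx, LinearEquiv.apply_symm_apply]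
    · rintro _ ⟨z, rfl⟩
      exact hker (toHead_d hM z)

/-- The reversed arrow α* ends in s(α), so the families of elements of e_{s(α)} F(M) in
`isExact_iff` are those that describe Ext¹ over the opposite quiver. -/
lemma isExact_iff_ext : M.IsExact ↔
    ∀ n : ℕ, n = 0 ∨ n = 1 →
      Subsingleton (Abelian.Ext
        (ModuleCat.of (PathAlgebra k Vᵒᵖ) (PathAlgebra.vertexModule k Vᵒᵖ))
        (ModuleCat.of (PathAlgebra k Vᵒᵖ) (KoszulDual M hM)) n) := by
  simp only [forall_eq_or_imp, forall_eq]
  rw [PathAlgebra.subsingleton_ext_zero_iff, PathAlgebra.subsingleton_ext_one_iff_arrow,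
    isExact_iff (hM := hM)]
  refine and_congr ?_ ?_
  · exact ⟨fun h x hx => h x fun α => hx α.2.2.op, fun h x hx => h x fun a => hx ⟨_, _, a.unop⟩⟩
  · refine ⟨fun h y hy => ?_, fun h y hy => ?_⟩
    · obtain ⟨x, hx⟩ := h (fun α => y α.2.2.op) fun α => hy α.2.2.op
      exact ⟨x, fun a => hx ⟨_, _, a.unop⟩⟩
    · obtain ⟨x, hx⟩ := h (fun a => y ⟨_, _, a.unop⟩) fun a => hy ⟨_, _, a.unop⟩
      exact ⟨x, fun α => hx α.2.2.op⟩

end KoszulDual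

end RadSqZero

/-! ### Compactness as factorization through finitely many summands -/

section Comparison

open Limits

variable {C : Type*} [Category C] [Preadditive C] (S : C) {L : Type*} (T : L → C) [HasCoproduct T]

lemma coproductComparison_of [DecidableEq L] (l : L) (f : S ⟶ T l) :
    coproductComparison S T (DirectSum.of (fun l => (S ⟶ T l)) l f) = f ≫ Sigma.ι T l := by
  classical
  simp only [coproductComparison]
  convert DirectSum.toAddMonoid_of (fun l => Preadditive.rightComp S (Sigma.ι T l)) l f
  rfl

open Classical in
/-- The projection of a coproduct onto a summand. -/
noncomputable def coproductProj (l : L) : ∐ T ⟶ T l :=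
  Sigma.desc fun l' => if h : l' = l then eqToHom (congrArg T h) else 0

lemma ι_coproductProj_self (l : L) : Sigma.ι T l ≫ coproductProj T l = 𝟙 _ := by
  simp [coproductProj]

lemma ι_coproductProj_of_ne {l l' : L} (h : l' ≠ l) : Sigma.ι T l' ≫ coproductProj T l = 0 := by
  simp [coproductProj, h]

lemma coproductComparison_comp_proj (x : DirectSum L fun l => (S ⟶ T l)) (l : L) :
    coproductComparison S T x ≫ coproductProj T l = x l := by
  classical
  induction x using DirectSum.induction_on with
  | zero => simp
  | of l' f =>
    rw [coproductComparison_of, Category.assoc]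
    by_cases h : l' = l
    · subst h
      rw [ι_coproductProj_self, Category.comp_id, DirectSum.of_eq_same]
    · rw [ι_coproductProj_of_ne T h, comp_zero, DirectSum.of_eq_of_ne _ _ _ (Ne.symm h)]
  | add x y hx hy => rw [map_add, Preadditive.add_comp, hx, hy, DirectSum.add_apply]

/-- Projecting to the summands recovers each component, so compactness is only a surjectivity
condition. -/
lemma coproductComparison_injective : Function.Injective (coproductComparison S T) := by
  intro x y h
  refine DFinsupp.ext fun l => ?_
  rw [← coproductComparison_comp_proj, ← coproductComparison_comp_proj, h]

lemma mem_range_coproductComparison_iff (g : S ⟶ ∐ T) :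
    (∃ x, coproductComparison S T x = g) ↔
      ∃ (s : Finset L) (f : ∀ l, S ⟶ T l), g = ∑ l ∈ s, f l ≫ Sigma.ι T l := by
  classical
  constructor
  · rintro ⟨x, rfl⟩
    refine ⟨DFinsupp.support x, x, ?_⟩
    conv_lhs => rw [← DirectSum.sum_support_of x]
    rw [map_sum]
    exact Finset.sum_congr rfl fun l _ => coproductComparison_of S T l _
  · rintro ⟨s, f, rfl⟩
    refine ⟨∑ l ∈ s, DirectSum.of (fun l => (S ⟶ T l)) l (f l), ?_⟩
    rw [map_sum]
    exact Finset.sum_congr rfl fun l _ => coproductComparison_of S T l _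

end Comparison

namespace DiffProj

variable {Λ : Type u} [Ring Λ]

open Classical in
/-- The endomorphism of a direct sum that sends the summands in a finite set to zero. -/
noncomputable def truncation {L : Type u} (T : L → DiffProj Λ) (s : Finset L) :
    directSum T ⟶ directSum T :=
  directSumDesc fun l => if l ∈ s then 0 else directSumι T l

lemma truncation_incl_of_mem {L : Type u} (T : L → DiffProj Λ) {s : Finset L} {l : L}
    (h : l ∈ s) (x : T l) : (truncation T s).val (incl T l x) = 0 := by
  refine (descL_incl T _ l x).trans ?_
  simp only [if_pos h]
  rfl

lemma truncation_incl_of_notMem {L : Type u} (T : L → DiffProj Λ) {s : Finset L} {l : L}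
    (h : l ∉ s) (x : T l) : (truncation T s).val (incl T l x) = incl T l x := by
  refine (descL_incl T _ l x).trans ?_
  simp only [if_neg h]
  rfl

lemma directSumι_truncation_of_mem {L : Type u} (T : L → DiffProj Λ) {s : Finset L} {l : L}
    (h : l ∈ s) : directSumι T l ≫ truncation T s = 0 :=
  hom_ext (LinearMap.ext fun x => truncation_incl_of_mem T h x)

open Classical in
lemma truncation_comp_truncation {L : Type u} (T : L → DiffProj Λ) (s t : Finset L) :
    truncation T s ≫ truncation T t = truncation T (s ∪ t) := by
  refine hom_ext (ext_incl T fun l x => ?_)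
  rw [comp_val, LinearMap.comp_apply]
  by_cases hs : l ∈ s
  · rw [truncation_incl_of_mem T hs, map_zero, truncation_incl_of_mem T (Finset.mem_union_left t hs)]
  · rw [truncation_incl_of_notMem T hs]
    by_cases ht : l ∈ t
    · rw [truncation_incl_of_mem T ht, truncation_incl_of_mem T (Finset.mem_union_right s ht)]
    · rw [truncation_incl_of_notMem T ht, truncation_incl_of_notMem T (by simp [hs, ht])]

open Classical in
/-- The projection of a direct sum onto a summand. -/
noncomputable def directSumProj {L : Type u} (T : L → DiffProj Λ) (l : L) : directSum T ⟶ T l :=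
  directSumDesc fun l' => if h : l' = l then eqToHom (congrArg T h) else 0

/-- This form turns null homotopy of f followed by a truncation into an expression for the class of
f as a finite sum of maps through summands. -/
lemma truncation_eq {L : Type u} (T : L → DiffProj Λ) (s : Finset L) :
    truncation T s = 𝟙 _ - ∑ l ∈ s, directSumProj T l ≫ directSumι T l := by
  classical
  have h1 (l l' : L) : directSumι T l ≫ directSumProj T l' ≫ directSumι T l' =
      if l = l' then directSumι T l else 0 := by
    rw [← Category.assoc, directSumProj, directSumι_desc]
    split_ifs with h
    · subst h
      simp
    · simp
  refine hom_ext (ext_incl T fun l x => ?_)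
  suffices h : directSumι T l ≫ truncation T s =
      directSumι T l ≫ (𝟙 _ - ∑ l ∈ s, directSumProj T l ≫ directSumι T l) from
    LinearMap.congr_fun (congrArg Hom.val h) x
  rw [Preadditive.comp_sub, Preadditive.comp_sum, Finset.sum_congr rfl fun l' _ => h1 l l',
    Finset.sum_ite_eq, Category.comp_id, truncation, directSumι_desc]
  split_ifs <;> simp

lemma homotopyClass_eq_zero_iff {M N : DiffProj Λ} (f : M ⟶ N) :
    homotopyClass f = 0 ↔ IsNullHomotopic f.val := by
  have h : homotopyClass (0 : M ⟶ N) = 0 := rfl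
  rw [← h]
  refine (CategoryTheory.Quotient.functor_map_eq_iff (homotopyRel Λ) f 0).trans ?_
  change IsNullHomotopic (f.val - 0) ↔ _
  rw [sub_zero]

instance : (CategoryTheory.Quotient.functor (homotopyRel Λ)).Additive where

lemma homotopyClass_comp {M N P : DiffProj Λ} (f : M ⟶ N) (g : N ⟶ P) :
    homotopyClass (f ≫ g) = homotopyClass f ≫ homotopyClass g :=
  (CategoryTheory.Quotient.functor (homotopyRel Λ)).map_comp f g

lemma homotopyClass_sub {M N : DiffProj Λ} (f g : M ⟶ N) :
    homotopyClass (f - g) = homotopyClass f - homotopyClass g :=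
  (CategoryTheory.Quotient.functor (homotopyRel Λ)).map_sub

lemma homotopyClass_sum {M N : DiffProj Λ} {L : Type*} (s : Finset L) (f : L → (M ⟶ N)) :
    homotopyClass (∑ l ∈ s, f l) = ∑ l ∈ s, homotopyClass (f l) :=
  (CategoryTheory.Quotient.functor (homotopyRel Λ)).map_sum f s

/-- Compactness in terms of morphisms of differential modules. -/
theorem isCompactObj_iff (M : DiffProj Λ) : IsCompactObj M.toHomotopyCat ↔
    ∀ (L : Type u) (T : L → DiffProj Λ) (f : M ⟶ directSum T),
      ∃ s : Finset L, IsNullHomotopic (f ≫ truncation T s).val := by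
  -- The chosen coproduct of the homotopy category is identified with the concrete direct sum, so
  -- truncations can act on it.
  have key (L : Type u) (T : L → DiffProj Λ) :
      ∃ e : (∐ fun l => (T l).toHomotopyCat) ≅ (directSum T).toHomotopyCat,
        ∀ l, Limits.Sigma.ι (fun l => (T l).toHomotopyCat) l ≫ e.hom =
          homotopyClass (directSumι T l) := by
    let e := Limits.IsColimit.coconePointUniqueUpToIso
      (Limits.colimit.isColimit (Discrete.functor fun l => (T l).toHomotopyCat))
      (isColimitDirectSumCofan T)
    exact ⟨e, fun l => Limits.IsColimit.comp_coconePointUniqueUpToIso_hom _ _ (Discrete.mk l)⟩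
  constructor
  · intro h L T f
    obtain ⟨e, he⟩ := key L T
    obtain ⟨s, g, hg⟩ := (mem_range_coproductComparison_iff _ _ _).1
      ((h L fun l => (T l).toHomotopyCat).2 (homotopyClass f ≫ e.inv))
    refine ⟨s, ?_⟩
    simp only [Iso.comp_inv_eq, Preadditive.sum_comp, Category.assoc, he] at hg
    rw [← homotopyClass_eq_zero_iff, homotopyClass_comp, hg, Preadditive.sum_comp]
    refine Finset.sum_eq_zero fun l hl => ?_
    rw [Category.assoc, ← homotopyClass_comp, directSumι_truncation_of_mem T hl,
      (homotopyClass_eq_zero_iff _).2 IsNullHomotopic.zero, Limits.comp_zero]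
  · intro h L T
    refine ⟨coproductComparison_injective _ _, fun g => ?_⟩
    obtain ⟨e, he⟩ := key L fun l => (T l).as
    obtain ⟨f, hf⟩ := (CategoryTheory.Quotient.functor (homotopyRel Λ)).map_surjective
      (X := M) (Y := directSum fun l => (T l).as) (g ≫ e.hom)
    obtain ⟨s, hs⟩ := h L (fun l => (T l).as) f
    -- The components are the coordinates of f at the summands in s; what `truncation_eq` leaves
    -- over is null homotopic.
    refine (mem_range_coproductComparison_iff _ _ _).2
      ⟨s, fun l => homotopyClass (f ≫ directSumProj (fun l => (T l).as) l), ?_⟩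
    rw [← cancel_mono e.hom, ← hf, Preadditive.sum_comp]
    rw [← homotopyClass_eq_zero_iff, truncation_eq, Preadditive.comp_sub, Category.comp_id,
      Preadditive.comp_sum, homotopyClass_sub, sub_eq_zero, homotopyClass_sum] at hs
    refine hs.trans ?_
    refine Finset.sum_congr rfl fun l _ => ?_
    rw [← Category.assoc, homotopyClass_comp, ← he l, Category.assoc]
    rfl

/-- Every element of a direct sum is killed by a truncation. -/
lemma exists_truncation_eq_zero {L : Type u} (T : L → DiffProj Λ) (x : directSum T) :
    ∃ s : Finset L, ∀ t, s ⊆ t → (truncation T t).val x = 0 := by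
  classical
  induction x using DFinsupp.induction with
  | h0 => exact ⟨∅, fun t _ => map_zero _⟩
  | ha l y x _ _ ih =>
    obtain ⟨s, hs⟩ := ih
    refine ⟨insert l s, fun t ht => ?_⟩
    have h1 := truncation_incl_of_mem T (ht (Finset.mem_insert_self l s)) y
    have h2 := hs t ((Finset.subset_insert l s).trans ht)
    refine (map_add (truncation T t).val _ _).trans ?_
    exact (congrArg₂ (· + ·) h1 h2).trans (add_zero _)

end DiffProj

/-! ### Extensions given by cocycles and their splitting after truncation -/

namespace PathAlgebra

section Rep

variable {k W : Type u} [Field k] [Quiver.{u} W] [Fintype W]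
variable {U : Type*} [AddCommGroup U] [Module k U]

/-- The module over the path algebra given by operators for the vertices and the arrows. -/
def RepModule (_ : LiftData W (Module.End k U)) : Type _ := U

namespace RepModule

variable (D : LiftData W (Module.End k U))

noncomputable instance : AddCommGroup (RepModule D) := inferInstanceAs (AddCommGroup U)

noncomputable instance : Module k (RepModule D) := inferInstanceAs (Module k U)

noncomputable instance : Module (PathAlgebra k W) (RepModule D) :=
  Module.compHom U (lift (k := k) D).toRingHom

/-- The linear isomorphism (the identity) onto the underlying vector space. -/
def equiv : RepModule D ≃ₗ[k] U := LinearEquiv.refl k U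

lemma equiv_smul (c : PathAlgebra k W) (x : RepModule D) :
    equiv D (c • x) = lift (k := k) D c (equiv D x) := rfl

instance : IsScalarTower k (PathAlgebra k W) (RepModule D) where
  smul_assoc c x m := by
    change lift (k := k) D (c • x) (equiv D m) = c • lift (k := k) D x (equiv D m)
    rw [map_smul, LinearMap.smul_apply]

lemma equiv_vertex_smul (i : W) (x : RepModule D) :
    equiv D (vertex (k := k) i • x) = D.e i (equiv D x) := by
  rw [equiv_smul, lift_vertex]

lemma equiv_arrow_smul {i j : W} (a : i ⟶ j) (x : RepModule D) :
    equiv D (arrow (k := k) a • x) = D.f a (equiv D x) := by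
  rw [equiv_smul, lift_arrow]

end RepModule

end Rep

section Splitting

variable {k W : Type u} [Field k] [Quiver.{u} W] [Fintype W]
variable {U X : Type*} [AddCommGroup U] [Module k U] [Module (PathAlgebra k W) U]
  [IsScalarTower k (PathAlgebra k W) U]
  [AddCommGroup X] [Module k X] [Module (PathAlgebra k W) X]
  [IsScalarTower k (PathAlgebra k W) X]

variable (U X) in
/-- Linear maps `X → U`, one for each arrow, compatible with the vertices: these are the cocycles
that give the extensions of `X` by `U`. -/
structure Cocycle where
  map : ∀ {i j : W}, (i ⟶ j) → X →ₗ[k] U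
  left : ∀ {i j : W} (a : i ⟶ j) x, vertex (k := k) j • map a x = map a x
  right : ∀ {i j : W} (a : i ⟶ j) x, map a (vertex (k := k) i • x) = map a x

/-- The composition of a cocycle with a linear map. -/
noncomputable def Cocycle.comp (f : Cocycle (k := k) (W := W) U X) (p : U →ₗ[PathAlgebra k W] U) :
    Cocycle (k := k) (W := W) U X where
  map a := p.restrictScalars k ∘ₗ f.map a
  left a x := by
    simp only [LinearMap.comp_apply, LinearMap.restrictScalars_apply]
    rw [← map_smul, f.left]
  right a x := by
    simp only [LinearMap.comp_apply, f.right]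

lemma Cocycle.comp_map (f : Cocycle (k := k) (W := W) U X) (p : U →ₗ[PathAlgebra k W] U)
    {i j : W} (a : i ⟶ j) (x : X) : (f.comp p).map a x = p (f.map a x) := rfl

/-- The operators of the vertices and the arrows on the extension of `X` by `U` given by a
cocycle. -/
noncomputable def Cocycle.liftData (f : Cocycle (k := k) (W := W) U X) :
    LiftData W (Module.End k (U × X)) where
  e i := (Algebra.lsmul k k U (vertex (k := k) i)).prodMap (Algebra.lsmul k k X (vertex (k := k) i))
  f a := ((Algebra.lsmul k k U (arrow (k := k) a)).coprod (f.map a)).prod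
    (Algebra.lsmul k k X (arrow (k := k) a) ∘ₗ LinearMap.snd k U X)
  idem i := LinearMap.ext fun x => Prod.ext (vertex_smul_vertex_smul i _)
    (vertex_smul_vertex_smul i _)
  orth i j h := LinearMap.ext fun x => Prod.ext (vertex_smul_vertex_smul_of_ne h _)
    (vertex_smul_vertex_smul_of_ne h _)
  one := by
    refine LinearMap.ext fun x => ?_
    rw [LinearMap.sum_apply]
    refine Prod.ext ?_ ?_
    · rw [Prod.fst_sum]
      exact sum_vertex_smul x.1
    · rw [Prod.snd_sum]
      exact sum_vertex_smul x.2
  left {_ j} a := LinearMap.ext fun x => Prod.ext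
    (by
      change vertex (k := k) j • (arrow (k := k) a • x.1 + f.map a x.2) = _
      rw [smul_add, vertex_smul_arrow_smul, f.left]
      rfl) (vertex_smul_arrow_smul a _)
  right {i _} a := LinearMap.ext fun x => Prod.ext
    (by
      change arrow (k := k) a • vertex (k := k) i • x.1 + f.map a (vertex (k := k) i • x.2) = _
      rw [arrow_smul_vertex_smul, f.right]
      rfl) (arrow_smul_vertex_smul a _)

/-- The extension of `X` by `U` given by a cocycle. -/
abbrev Cocycle.Extension (f : Cocycle (k := k) (W := W) U X) : Type _ := RepModule f.liftData

variable (f : Cocycle (k := k) (W := W) U X)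

/-- The linear isomorphism from the extension given by a cocycle to the product. -/
noncomputable def Cocycle.toProd : f.Extension ≃ₗ[k] U × X := RepModule.equiv f.liftData

lemma Cocycle.toProd_vertex_smul (i : W) (x : f.Extension) :
    f.toProd (vertex (k := k) i • x) =
      (vertex (k := k) i • (f.toProd x).1, vertex (k := k) i • (f.toProd x).2) :=
  RepModule.equiv_vertex_smul f.liftData i x

lemma Cocycle.toProd_arrow_smul {i j : W} (a : i ⟶ j) (x : f.Extension) :
    f.toProd (arrow (k := k) a • x) =
      (arrow (k := k) a • (f.toProd x).1 + f.map a (f.toProd x).2,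
        arrow (k := k) a • (f.toProd x).2) :=
  RepModule.equiv_arrow_smul f.liftData a x

/-- The projection of the extension given by a cocycle. -/
noncomputable def Cocycle.proj : f.Extension →ₗ[PathAlgebra k W] X :=
  linearMapOfVertexArrow (LinearMap.snd k U X ∘ₗ f.toProd.toLinearMap)
    (fun i x => congrArg Prod.snd (f.toProd_vertex_smul i x))
    (fun a x => congrArg Prod.snd (f.toProd_arrow_smul a x))

lemma Cocycle.proj_apply (x : f.Extension) : f.proj x = (f.toProd x).2 := rfl

/-- The map of extensions induced by a linear map. -/
noncomputable def Cocycle.push (p : U →ₗ[PathAlgebra k W] U) :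
    f.Extension →ₗ[PathAlgebra k W] (f.comp p).Extension :=
  linearMapOfVertexArrow ((f.comp p).toProd.symm.toLinearMap ∘ₗ
      (p.restrictScalars k).prodMap LinearMap.id ∘ₗ f.toProd.toLinearMap)
    (fun i x => (f.comp p).toProd.injective (by
      rw [Cocycle.toProd_vertex_smul]
      simp only [LinearMap.comp_apply, LinearEquiv.coe_coe, LinearEquiv.apply_symm_apply,
        LinearMap.prodMap_apply, Cocycle.toProd_vertex_smul, LinearMap.restrictScalars_apply,
        map_smul p, LinearMap.id_apply]))
    (fun a x => (f.comp p).toProd.injective (by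
      rw [Cocycle.toProd_arrow_smul]
      simp only [LinearMap.comp_apply, LinearEquiv.coe_coe, LinearEquiv.apply_symm_apply,
        LinearMap.prodMap_apply, Cocycle.toProd_arrow_smul, LinearMap.restrictScalars_apply,
        map_smul p, LinearMap.id_apply, map_add, Cocycle.comp_map]))

lemma Cocycle.toProd_push (p : U →ₗ[PathAlgebra k W] U) (x : f.Extension) :
    (f.comp p).toProd (f.push p x) = (p (f.toProd x).1, (f.toProd x).2) := rfl

/-- An extension of a finitely presented module by a module which is a filtered union of the
kernels of endomorphisms splits after composition with one of these endomorphisms. -/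
theorem Cocycle.exists_splitting [Module.FinitePresentation (PathAlgebra k W) X] {L : Type*}
    (p : Finset L → U →ₗ[PathAlgebra k W] U) (hp : ∀ u, ∃ s, ∀ t, s ⊆ t → p t u = 0) :
    ∃ (s : Finset L) (h : X →ₗ[k] U),
      (∀ (i : W) x, h (vertex (k := k) i • x) = vertex (k := k) i • h x) ∧
      ∀ {i j : W} (a : i ⟶ j) x,
        h (arrow (k := k) a • x) = arrow (k := k) a • h x + p s (f.map a x) := by
  classical
  obtain ⟨n, m, π, g, hπ, hg⟩ := Module.FinitePresentation.exists_fin' (PathAlgebra k W) X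
  -- Φ lifts π to the extension; the zero U-components on the basis are an arbitrary choice.
  let Φ : (Fin n → PathAlgebra k W) →ₗ[PathAlgebra k W] f.Extension :=
    (Pi.basisFun (PathAlgebra k W) (Fin n)).constr ℕ fun j =>
      f.toProd.symm (0, π (Pi.basisFun (PathAlgebra k W) (Fin n) j))
  have hΦ : f.proj ∘ₗ Φ = π :=
    (Pi.basisFun (PathAlgebra k W) (Fin n)).ext fun j => by
      rw [LinearMap.comp_apply, Module.Basis.constr_basis, Cocycle.proj_apply,
        LinearEquiv.apply_symm_apply]
  choose s hs using hp
  -- Φ sends each of the finitely many relations into U. S is large enough for p S to kill all these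
  -- values.
  let S : Finset L := Finset.univ.sup fun j =>
    s (f.toProd (Φ (g (Pi.basisFun (PathAlgebra k W) (Fin m) j)))).1
  have hgΦ : (f.push (p S) ∘ₗ Φ) ∘ₗ g = 0 :=
    (Pi.basisFun (PathAlgebra k W) (Fin m)).ext fun j => by
      refine (f.comp (p S)).toProd.injective (Prod.ext ?_ ?_)
      · exact hs _ S (Finset.le_sup (f := fun j =>
          s (f.toProd (Φ (g (Pi.basisFun (PathAlgebra k W) (Fin m) j)))).1) (Finset.mem_univ j))
      · exact (LinearMap.congr_fun hΦ _).trans (hg.apply_apply_eq_zero _)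
  have hle : LinearMap.ker π ≤ LinearMap.ker (f.push (p S) ∘ₗ Φ) := by
    intro v hv
    obtain ⟨w, rfl⟩ := (hg v).1 hv
    exact LinearMap.congr_fun hgΦ w
  -- After pushing out along p S the lift respects the relations, so it descends to a section of the
  -- projection. Its first component is the required h, and linearity of the section is the
  -- coboundary identity.
  let ψ : X →ₗ[PathAlgebra k W] (f.comp (p S)).Extension :=
    (LinearMap.ker π).liftQ _ hle ∘ₗ (π.quotKerEquivOfSurjective hπ).symm.toLinearMap
  have hψ (x : X) : ((f.comp (p S)).toProd (ψ x)).2 = x := by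
    obtain ⟨v, rfl⟩ := hπ x
    have e : (π.quotKerEquivOfSurjective hπ).symm (π v) = Submodule.Quotient.mk v := by
      rw [LinearEquiv.symm_apply_eq]
      rfl
    have e' : ψ (π v) = f.push (p S) (Φ v) := by
      simp only [ψ, LinearMap.comp_apply, LinearEquiv.coe_coe, e, Submodule.liftQ_apply]
    rw [e', Cocycle.toProd_push]
    exact LinearMap.congr_fun hΦ v
  refine ⟨S, LinearMap.fst k U X ∘ₗ (f.comp (p S)).toProd.toLinearMap ∘ₗ ψ.restrictScalars k,
    fun i x => ?_, fun a x => ?_⟩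
  · simp only [LinearMap.comp_apply, LinearMap.restrictScalars_apply, LinearEquiv.coe_coe,
      map_smul ψ, Cocycle.toProd_vertex_smul, LinearMap.fst_apply]
  · simp only [LinearMap.comp_apply, LinearMap.restrictScalars_apply, LinearEquiv.coe_coe,
      map_smul ψ, Cocycle.toProd_arrow_smul, LinearMap.fst_apply, hψ]
    rfl

end Splitting

end PathAlgebra

/-! ### Linear maps between projective modules through their components -/

namespace RadSqZero

section Components

variable {k V : Type u} [Field k] [Quiver.{u} V] [Fintype V] [∀ i j : V, Fintype (i ⟶ j)]
variable {T : Type*} [AddCommGroup T] [Module (RadSqZero k V) T]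
  [Module.Projective (RadSqZero k V) T] [Module k T] [IsScalarTower k (RadSqZero k V) T]
variable {T' : Type*} [AddCommGroup T'] [Module (RadSqZero k V) T']
  [Module.Projective (RadSqZero k V) T'] [Module k T'] [IsScalarTower k (RadSqZero k V) T']
variable {T'' : Type*} [AddCommGroup T''] [Module (RadSqZero k V) T'']
  [Module.Projective (RadSqZero k V) T''] [Module k T''] [IsScalarTower k (RadSqZero k V) T'']

/-- The map induced on tops. -/
noncomputable def headMap (f : T →ₗ[RadSqZero k V] T') : Head k V T →ₗ[k] Head k V T' :=
  (Submodule.mapQ _ _ f (Module.le_comap_jacobson f)).restrictScalars k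

@[simp]
lemma headMap_toHead (f : T →ₗ[RadSqZero k V] T') (x : T) :
    headMap f (toHead k V x) = toHead k V (f x) := rfl

lemma headMap_vertex_smul (f : T →ₗ[RadSqZero k V] T') (i : V) (t : Head k V T) :
    headMap f (vertex (k := k) i • t) = vertex (k := k) i • headMap f t :=
  map_smul (Submodule.mapQ _ _ f (Module.le_comap_jacobson f)) _ t

lemma headMap_comp (g : T' →ₗ[RadSqZero k V] T'') (f : T →ₗ[RadSqZero k V] T')
    (t : Head k V T) : headMap (g ∘ₗ f) t = headMap g (headMap f t) := by
  obtain ⟨x, rfl⟩ := Submodule.mkQ_surjective _ t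
  rfl

/-- The component at an arrow of a linear map between projective modules. -/
noncomputable def arrowMap (α : QuiverArrow V) (f : T →ₗ[RadSqZero k V] T') :
    Head k V T →ₗ[k] Head k V T' :=
  headCoeff (k := k) α ∘ₗ f.restrictScalars k ∘ₗ headSection k V T

lemma arrowMap_apply (α : QuiverArrow V) (f : T →ₗ[RadSqZero k V] T') (t : Head k V T) :
    arrowMap α f t = headCoeff (k := k) α (f (headSection k V T t)) := rfl

lemma vertex_smul_arrowMap (α : QuiverArrow V) (f : T →ₗ[RadSqZero k V] T') (t : Head k V T) :
    vertex (k := k) α.1 • arrowMap α f t = arrowMap α f t :=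
  vertex_smul_headCoeff _ _

lemma arrowMap_vertex_smul (α : QuiverArrow V) (f : T →ₗ[RadSqZero k V] T') (t : Head k V T) :
    arrowMap α f (vertex (k := k) α.2.1 • t) = arrowMap α f t := by
  rw [arrowMap_apply, headSection_vertex_smul, map_smul f, headCoeff_vertex_smul, arrowMap_apply]

lemma headSection_headMap_add_sum (f : T →ₗ[RadSqZero k V] T') (t : Head k V T) :
    headSection k V T' (headMap f t) +
      ∑ α : QuiverArrow V, ar (k := k) α • headSection k V T' (arrowMap α f t) =
    f (headSection k V T t) := by
  rw [← headSection_add_sum_headCoeff (k := k) (V := V) (f (headSection k V T t)),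
    ← headMap_toHead, toHead_headSection]
  rfl

/-- The product of two arrows is zero, so the α-part of a composite takes α from exactly one factor
and the map on tops from the other. -/
lemma arrowMap_comp (α : QuiverArrow V) (g : T' →ₗ[RadSqZero k V] T'')
    (f : T →ₗ[RadSqZero k V] T') (t : Head k V T) : arrowMap α (g ∘ₗ f) t =
      arrowMap α g (headMap f t) + headMap g (arrowMap α f t) := by
  rw [arrowMap_apply, LinearMap.comp_apply, ← headSection_headMap_add_sum, map_add, map_add,
    map_sum g]
  simp only [map_smul g]
  rw [headCoeff_sum_ar_smul, ← headMap_toHead, toHead_headSection, ← headMap_vertex_smul,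
    vertex_smul_arrowMap, arrowMap_apply α g]

lemma headMap_add (f g : T →ₗ[RadSqZero k V] T') (t : Head k V T) :
    headMap (f + g) t = headMap f t + headMap g t := by
  obtain ⟨x, rfl⟩ := Submodule.mkQ_surjective _ t
  rfl

lemma headMap_sub (f g : T →ₗ[RadSqZero k V] T') (t : Head k V T) :
    headMap (f - g) t = headMap f t - headMap g t := by
  obtain ⟨x, rfl⟩ := Submodule.mkQ_surjective _ t
  rfl

lemma arrowMap_add (α : QuiverArrow V) (f g : T →ₗ[RadSqZero k V] T') (t : Head k V T) :
    arrowMap α (f + g) t = arrowMap α f t + arrowMap α g t := by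
  simp only [arrowMap_apply, LinearMap.add_apply, map_add]

/-- A linear map between projective modules is determined by its components. -/
lemma ext_components {f g : T →ₗ[RadSqZero k V] T'} (h : ∀ t, headMap f t = headMap g t)
    (h' : ∀ α t, arrowMap α f t = arrowMap α g t) : f = g :=
  ext_headSection (k := k) fun t => by
    rw [← headSection_headMap_add_sum, ← headSection_headMap_add_sum, h]
    simp only [h']

/-- The components of a linear map between projective modules are arbitrary. -/
lemma exists_linearMap_of_components (r : Head k V T →ₗ[k] Head k V T')
    (hr : ∀ (i : V) t, r (vertex (k := k) i • t) = vertex (k := k) i • r t)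
    (q : QuiverArrow V → Head k V T →ₗ[k] Head k V T') :
    ∃ f : T →ₗ[RadSqZero k V] T', (∀ t, headMap f t = r t) ∧
      ∀ α t, arrowMap α f t = vertex (k := k) α.1 • q α (vertex (k := k) α.2.1 • t) := by
  -- Inserting e_{t(α)} before q α makes the α-term commute with the vertices. No e_{s(α)} is needed
  -- on the other side, because α absorbs it.
  let φ : Head k V T →ₗ[k] T' := headSection k V T' ∘ₗ r + ∑ α : QuiverArrow V,
    Algebra.lsmul k k T' (ar (k := k) α) ∘ₗ headSection k V T' ∘ₗ q α ∘ₗ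
      Algebra.lsmul k k (Head k V T) (vertex (k := k) α.2.1)
  have hφ (t : Head k V T) : φ t = headSection k V T' (r t) + ∑ α : QuiverArrow V,
      ar (k := k) α • headSection k V T' (q α (vertex (k := k) α.2.1 • t)) := by simp [φ]
  obtain ⟨f, hf⟩ := exists_extension (k := k) φ fun l t => by
    rw [hφ, hφ, hr, headSection_vertex_smul, smul_add, Finset.smul_sum]
    congr 1
    refine Finset.sum_congr rfl fun α _ => ?_
    by_cases h : α.2.1 = l
    · subst h
      rw [vertex_smul_vertex_smul, vertex_smul_ar_smul]
    · rw [vertex_smul_vertex_smul_of_ne h, map_zero, map_zero, smul_zero,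
        vertex_smul_ar_smul_of_ne (Ne.symm h)]
  refine ⟨f, fun t => ?_, fun α t => ?_⟩
  · conv_lhs => rw [← toHead_headSection t, headMap_toHead, hf, hφ, map_add, toHead_headSection,
      map_sum]
    simp only [toHead_ar_smul, Finset.sum_const_zero, add_zero]
  · rw [arrowMap_apply, hf, hφ, map_add, headCoeff_headSection, zero_add, headCoeff_sum_ar_smul,
      toHead_headSection]

end Components

end RadSqZero

/-! ### Homotopies in components and the homology of the top -/

namespace RadSqZero

variable {k V : Type u} [Field k] [Quiver.{u} V] [Fintype V] [∀ i j : V, Fintype (i ⟶ j)]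

section Differential

variable {M N : DiffProj (RadSqZero k V)}

/-- This is the α-component of d² = 0. Anticommuting with d_0, the operator d_α acts on the homology
of the top. -/
lemma arrowMap_d_headMap_d (α : QuiverArrow V) (t : Head k V N) :
    arrowMap α N.d (headMap N.d t) = -headMap N.d (arrowMap α N.d t) := by
  rw [eq_neg_iff_add_eq_zero, ← arrowMap_comp, N.d_comp_d]
  simp [arrowMap_apply]

lemma headMap_d_comm (f : M ⟶ N) (t : Head k V M) :
    headMap f.val (headMap M.d t) = headMap N.d (headMap f.val t) := by
  rw [← headMap_comp, f.comm, headMap_comp]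

/-- This is the α-component of f d = d f. On cycles of d_0 it says that f_0 commutes with d_α up to
the boundary d_0 f_α. -/
lemma arrowMap_d_comm (α : QuiverArrow V) (f : M ⟶ N) (t : Head k V M) :
    arrowMap α f.val (headMap M.d t) + headMap f.val (arrowMap α M.d t) =
      arrowMap α N.d (headMap f.val t) + headMap N.d (arrowMap α f.val t) := by
  rw [← arrowMap_comp, f.comm, arrowMap_comp]

lemma headMap_d_of_isReduced (hM : M.IsReduced) (t : Head k V M) : headMap M.d t = 0 := by
  obtain ⟨x, rfl⟩ := Submodule.mkQ_surjective _ t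
  exact KoszulDual.toHead_d hM x

lemma arrowMap_d_toTop (hM : M.IsReduced) (α : QuiverArrow V) (x : KoszulDual M hM) :
    arrowMap α M.d (KoszulDual.toTop M hM x) = KoszulDual.toTop M hM (dual (k := k) α • x) := by
  rw [arrowMap_apply, KoszulDual.d_headSection, headCoeff_sum_ar_smul, toHead_headSection,
    ← KoszulDual.toTop_vertex_smul, PathAlgebra.vertex_smul_arrow_smul]

/-- A morphism out of a reduced module is null homotopic if its components are. -/
lemma isNullHomotopic_of_components (hM : M.IsReduced) (f : M ⟶ N)
    (r : Head k V M →ₗ[k] Head k V N)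
    (hr : ∀ (i : V) t, r (vertex (k := k) i • t) = vertex (k := k) i • r t)
    (q : QuiverArrow V → Head k V M →ₗ[k] Head k V N)
    (h : ∀ t, headMap f.val t = headMap N.d (r t))
    (h' : ∀ α t, arrowMap α f.val t =
      r (arrowMap α M.d t) + arrowMap α N.d (r t) + headMap N.d (q α t)) :
    DiffProj.IsNullHomotopic f.val := by
  obtain ⟨R, hR, hR'⟩ := exists_linearMap_of_components r hr q
  refine ⟨R, ext_components (fun t => ?_) fun α t => ?_⟩
  · rw [headMap_add, headMap_comp, headMap_comp, headMap_d_of_isReduced hM, map_zero, zero_add, hR,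
      h]
  -- The map R realizes e_{s(α)} q_α e_{t(α)} rather than q_α, so the hypothesis is multiplied by
  -- these idempotents, which the other components already absorb.
  · rw [arrowMap_add, arrowMap_comp, arrowMap_comp, headMap_d_of_isReduced hM, map_zero, zero_add,
      hR, hR, hR', headMap_vertex_smul, ← vertex_smul_arrowMap α f.val,
      ← arrowMap_vertex_smul α f.val, h', smul_add, smul_add, ← hr, vertex_smul_arrowMap,
      arrowMap_vertex_smul, vertex_smul_arrowMap, hr, arrowMap_vertex_smul, add_assoc]

end Differential

section Homology

/-- The homology of the top of a differential projective module. -/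
abbrev HeadHomology (N : DiffProj (RadSqZero k V)) : Type u :=
  LinearMap.ker (headMap N.d) ⧸
    (LinearMap.range (headMap N.d)).submoduleOf (LinearMap.ker (headMap N.d))

variable {N N' : DiffProj (RadSqZero k V)}

/-- The homology class of a cycle. -/
noncomputable def headClass (z : Head k V N) (hz : headMap N.d z = 0) : HeadHomology N :=
  Submodule.Quotient.mk ⟨z, hz⟩

lemma headClass_eq_iff {z z' : Head k V N} {hz : headMap N.d z = 0} {hz' : headMap N.d z' = 0} :
    headClass z hz = headClass z' hz' ↔ ∃ w, headMap N.d w = z - z' :=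
  Submodule.Quotient.eq _

lemma headClass_congr {z z' : Head k V N} (hz : headMap N.d z = 0) (hz' : headMap N.d z' = 0)
    (h : z = z') : headClass z hz = headClass z' hz' := by
  subst h
  rfl

lemma headClass_surjective (x : HeadHomology N) : ∃ z hz, headClass z hz = x := by
  obtain ⟨⟨z, hz⟩, rfl⟩ := Submodule.Quotient.mk_surjective _ x
  exact ⟨z, hz, rfl⟩

/-- The map in homology induced by a linear map that preserves cycles and boundaries. -/
noncomputable def homologyMap (φ : Head k V N →ₗ[k] Head k V N')
    (h : ∀ z, headMap N.d z = 0 → headMap N'.d (φ z) = 0)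
    (h' : ∀ w, ∃ w', headMap N'.d w' = φ (headMap N.d w)) :
    HeadHomology N →ₗ[k] HeadHomology N' :=
  Submodule.mapQ _ _ (φ.restrict h) (by
    rintro ⟨z, hz⟩ ⟨w, hw⟩
    obtain ⟨w', hw'⟩ := h' w
    exact ⟨w', hw'.trans (congrArg φ hw)⟩)

/-- The operator of a vertex on the homology of the top. -/
noncomputable def homologyVertex (N : DiffProj (RadSqZero k V)) (i : V) :
    HeadHomology N →ₗ[k] HeadHomology N :=
  homologyMap (Algebra.lsmul k k _ (vertex (k := k) i))
    (fun z hz => by rw [Algebra.lsmul_coe, headMap_vertex_smul, hz, smul_zero])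
    (fun w => ⟨vertex (k := k) i • w, by rw [Algebra.lsmul_coe, headMap_vertex_smul]⟩)

lemma homologyVertex_headClass (i : V) (z : Head k V N) (hz : headMap N.d z = 0) :
    homologyVertex N i (headClass z hz) = headClass (vertex (k := k) i • z)
      (by rw [headMap_vertex_smul, hz, smul_zero]) := rfl

/-- The operator of a reversed arrow on the homology of the top. -/
noncomputable def homologyArrow (N : DiffProj (RadSqZero k V)) (α : QuiverArrow V) :
    HeadHomology N →ₗ[k] HeadHomology N :=
  homologyMap (arrowMap α N.d)
    (fun z hz => by rw [← neg_eq_zero, ← arrowMap_d_headMap_d, hz, map_zero])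
    (fun w => ⟨-arrowMap α N.d w, by rw [arrowMap_d_headMap_d, map_neg]⟩)

/-- The action of the opposite quiver on the homology of the top, with the arrows scaled. -/
noncomputable def homologyLiftData (N : DiffProj (RadSqZero k V)) (c : k) :
    PathAlgebra.LiftData Vᵒᵖ (Module.End k (HeadHomology N)) where
  e i := homologyVertex N i.unop
  -- The scalar is 1 for classes of maps on tops and -1 for cocycles: in f = r d + d r the two arrow
  -- terms carry the same sign, whereas a coboundary needs opposite ones.
  f {i j} a := c • homologyArrow N ⟨j.unop, i.unop, a.unop⟩
  idem i := LinearMap.ext fun x => by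
    obtain ⟨z, hz, rfl⟩ := headClass_surjective x
    rw [Module.End.mul_apply, homologyVertex_headClass, homologyVertex_headClass]
    exact headClass_congr _ _ (vertex_smul_vertex_smul i.unop z)
  orth i j h := LinearMap.ext fun x => by
    obtain ⟨z, hz, rfl⟩ := headClass_surjective x
    rw [Module.End.mul_apply, homologyVertex_headClass, homologyVertex_headClass]
    exact headClass_congr _ (map_zero _)
      (vertex_smul_vertex_smul_of_ne (fun h' => h (Opposite.unop_injective h')) z)
  one := LinearMap.ext fun x => by
    obtain ⟨z, hz, rfl⟩ := headClass_surjective x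
    have h1 (i : V) : homologyVertex N i (headClass z hz) =
      Submodule.mkQ _ (⟨vertex (k := k) i • z, by
        rw [LinearMap.mem_ker, headMap_vertex_smul, hz, smul_zero]⟩ :
        LinearMap.ker (headMap N.d)) := rfl
    rw [LinearMap.sum_apply]
    refine (Fintype.sum_equiv Opposite.equivToOpposite.symm _
      (fun i => homologyVertex N i (headClass z hz)) (fun _ => rfl)).trans ?_
    simp only [h1]
    rw [← map_sum]
    refine congrArg (Submodule.mkQ _) (Subtype.ext ?_)
    rw [AddSubmonoidClass.coe_finsetSum]
    exact RadSqZero.sum_vertex_smul z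
  left {i j} a := LinearMap.ext fun x => by
    obtain ⟨z, hz, rfl⟩ := headClass_surjective x
    rw [Module.End.mul_apply, LinearMap.smul_apply, map_smul]
    congr 1
    exact headClass_congr _ _
      (vertex_smul_arrowMap (⟨j.unop, i.unop, a.unop⟩ : QuiverArrow V) N.d z)
  right {i j} a := LinearMap.ext fun x => by
    obtain ⟨z, hz, rfl⟩ := headClass_surjective x
    rw [Module.End.mul_apply, LinearMap.smul_apply, LinearMap.smul_apply]
    congr 1
    exact headClass_congr _ _
      (arrowMap_vertex_smul (⟨j.unop, i.unop, a.unop⟩ : QuiverArrow V) N.d z)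

/-- The homology of the top as a module over the path algebra of the opposite quiver. -/
abbrev HomologyModule (N : DiffProj (RadSqZero k V)) (c : k) : Type u :=
  PathAlgebra.RepModule (homologyLiftData N c)

/-- The class of a cycle in the homology module. -/
noncomputable def cycleClass (c : k) (z : Head k V N) (hz : headMap N.d z = 0) :
    HomologyModule N c :=
  (PathAlgebra.RepModule.equiv (homologyLiftData N c)).symm (headClass z hz)

lemma cycleClass_eq_iff {c : k} {z z' : Head k V N} {hz : headMap N.d z = 0}
    {hz' : headMap N.d z' = 0} :
    cycleClass c z hz = cycleClass c z' hz' ↔ ∃ w, headMap N.d w = z - z' :=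
  headClass_eq_iff

lemma cycleClass_surjective {c : k} (x : HomologyModule N c) : ∃ z hz, cycleClass c z hz = x :=
  headClass_surjective x

lemma cycleClass_eq_zero_iff {c : k} {z : Head k V N} {hz : headMap N.d z = 0} :
    cycleClass c z hz = 0 ↔ ∃ w, headMap N.d w = z := by
  have h : (0 : HomologyModule N c) = cycleClass c 0 (map_zero _) := rfl
  rw [h, cycleClass_eq_iff, sub_zero]

lemma dualVertex_smul_cycleClass {c : k} (i : V) {z : Head k V N} (hz : headMap N.d z = 0) :
    dualVertex (k := k) i • cycleClass c z hz = cycleClass c (vertex (k := k) i • z)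
      (by rw [headMap_vertex_smul, hz, smul_zero]) :=
  PathAlgebra.RepModule.equiv_vertex_smul (homologyLiftData N c) (Opposite.op i) _

lemma headMap_d_arrowMap_d (α : QuiverArrow V) {z : Head k V N} (hz : headMap N.d z = 0) :
    headMap N.d (arrowMap α N.d z) = 0 := by
  rw [← neg_eq_zero, ← arrowMap_d_headMap_d, hz, map_zero]

lemma dual_smul_cycleClass {c : k} (α : QuiverArrow V) {z : Head k V N}
    (hz : headMap N.d z = 0) :
    dual (k := k) α • cycleClass c z hz = cycleClass c (c • arrowMap α N.d z)
      (by rw [map_smul, headMap_d_arrowMap_d α hz, smul_zero]) :=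
  PathAlgebra.RepModule.equiv_arrow_smul (homologyLiftData N c) α.2.2.op _

/-- The linear map into the homology module given by a linear map with values in cycles. -/
noncomputable def toHomology {X : Type*} [AddCommGroup X] [Module k X] (c : k)
    (φ : X →ₗ[k] Head k V N) (h : ∀ x, headMap N.d (φ x) = 0) : X →ₗ[k] HomologyModule N c :=
  (PathAlgebra.RepModule.equiv (homologyLiftData N c)).symm.toLinearMap ∘ₗ
    Submodule.mkQ _ ∘ₗ φ.codRestrict _ h

/-- The linear map of homology modules induced by a morphism. -/
noncomputable def homologyModuleMap (c : k) (p : N ⟶ N) :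
    HomologyModule N c →ₗ[PathAlgebra k Vᵒᵖ] HomologyModule N c :=
  PathAlgebra.linearMapOfVertexArrow
    ((PathAlgebra.RepModule.equiv (homologyLiftData N c)).symm.toLinearMap ∘ₗ
      homologyMap (headMap p.val) (fun z hz => by rw [← headMap_d_comm, hz, map_zero])
        (fun w => ⟨headMap p.val w, by rw [headMap_d_comm]⟩) ∘ₗ
      (PathAlgebra.RepModule.equiv (homologyLiftData N c)).toLinearMap)
    (fun i x => by
      obtain ⟨z, hz, rfl⟩ := cycleClass_surjective x
      have e := dualVertex_smul_cycleClass (c := c) i.unop hz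
      have e' := dualVertex_smul_cycleClass (c := c) i.unop
        (z := headMap p.val z) (by rw [← headMap_d_comm, hz, map_zero])
      refine (congrArg _ e).trans (Eq.trans ?_ e'.symm)
      exact headClass_congr _ _ (headMap_vertex_smul p.val i.unop z))
    (fun {i j} a x => by
      obtain ⟨z, hz, rfl⟩ := cycleClass_surjective x
      have e := dual_smul_cycleClass (c := c) ⟨j.unop, i.unop, a.unop⟩ hz
      have e' := dual_smul_cycleClass (c := c) ⟨j.unop, i.unop, a.unop⟩
        (z := headMap p.val z) (by rw [← headMap_d_comm, hz, map_zero])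
      refine (congrArg _ e).trans (Eq.trans ?_ e'.symm)
      have h1 := arrowMap_d_comm ⟨j.unop, i.unop, a.unop⟩ p z
      rw [hz, map_zero, zero_add] at h1
      -- On the cycle z the defect of commutation with the arrow is the boundary of c times the
      -- arrow component of p at z.
      have h2 : headMap N.d (c • arrowMap ⟨j.unop, i.unop, a.unop⟩ p.val z) =
          headMap p.val (c • arrowMap ⟨j.unop, i.unop, a.unop⟩ N.d z) -
            c • arrowMap ⟨j.unop, i.unop, a.unop⟩ N.d (headMap p.val z) := by
        rw [map_smul, map_smul, h1, smul_add, add_sub_cancel_left]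
      exact cycleClass_eq_iff.2 ⟨_, h2⟩)

lemma homologyModuleMap_cycleClass (c : k) (p : N ⟶ N) (z : Head k V N)
    (hz : headMap N.d z = 0) : homologyModuleMap c p (cycleClass c z hz) =
      cycleClass c (headMap p.val z) (by rw [← headMap_d_comm, hz, map_zero]) := rfl

end Homology

end RadSqZero

/-! ### A finitely presented F(M) makes M compact -/

lemma exists_linearMap_lift {k U W W' : Type*} [Field k] [AddCommGroup U] [Module k U]
    [AddCommGroup W] [Module k W] [AddCommGroup W'] [Module k W'] (q : W →ₗ[k] W')
    (ψ : U →ₗ[k] W') (h : ∀ x, ∃ y, q y = ψ x) : ∃ φ : U →ₗ[k] W, ∀ x, q (φ x) = ψ x := by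
  obtain ⟨φ, hφ⟩ := Module.projective_lifting_property q.rangeRestrict
    (ψ.codRestrict (LinearMap.range q) h) q.surjective_rangeRestrict
  exact ⟨φ, fun x => congrArg Subtype.val (LinearMap.congr_fun hφ x)⟩

namespace RadSqZero

variable {k V : Type u} [Field k] [Quiver.{u} V] [Fintype V] [∀ i j : V, Fintype (i ⟶ j)]
variable {M N : DiffProj (RadSqZero k V)} (hM : M.IsReduced)

lemma headMap_d_headMap_of_isReduced (hM : M.IsReduced) (f : M ⟶ N) (t : Head k V M) :
    headMap N.d (headMap f.val t) = 0 := by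
  rw [← headMap_d_comm, headMap_d_of_isReduced hM, map_zero]

/-- The map from `F(M)` to the homology of the top of `N` induced by a morphism. -/
noncomputable def topClassMap (f : M ⟶ N) :
    KoszulDual M hM →ₗ[PathAlgebra k Vᵒᵖ] HomologyModule N (1 : k) :=
  PathAlgebra.linearMapOfVertexArrow
    (toHomology 1 (headMap f.val ∘ₗ (KoszulDual.toTop M hM).toLinearMap)
      fun x => headMap_d_headMap_of_isReduced hM f _)
    (fun i x => by
      refine Eq.trans ?_ (dualVertex_smul_cycleClass i.unop _).symm
      refine headClass_congr _ _ ?_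
      exact (congrArg _ (KoszulDual.toTop_vertex_smul i.unop x)).trans (headMap_vertex_smul _ _ _))
    (fun {i j} a x => by
      refine Eq.trans ?_ (dual_smul_cycleClass ⟨j.unop, i.unop, a.unop⟩ _).symm
      refine cycleClass_eq_iff.2
        ⟨arrowMap ⟨j.unop, i.unop, a.unop⟩ f.val (KoszulDual.toTop M hM x), ?_⟩
      have h1 := arrowMap_d_comm ⟨j.unop, i.unop, a.unop⟩ f (KoszulDual.toTop M hM x)
      rw [headMap_d_of_isReduced hM, map_zero, zero_add, arrowMap_d_toTop] at h1
      rw [one_smul]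
      exact (eq_sub_of_add_eq' h1.symm))

lemma topClassMap_apply (f : M ⟶ N) (x : KoszulDual M hM) : topClassMap hM f x =
    cycleClass 1 (headMap f.val (KoszulDual.toTop M hM x))
      (headMap_d_headMap_of_isReduced hM f _) := rfl

/-- A morphism whose map on tops has values in the boundaries is homotopic to a morphism that is
zero on tops. -/
lemma exists_homotopic_of_boundary (hM : M.IsReduced) (f : M ⟶ N)
    (h : ∀ t, ∃ w, headMap N.d w = headMap f.val t) :
    ∃ g : M ⟶ N, (∀ t, headMap g.val t = 0) ∧ DiffProj.IsNullHomotopic (f.val - g.val) := by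
  -- As d_0 = 0 on M, the map on tops of R d + d R is d_0 r. Choosing d_0 r = f_0 lets this homotopy
  -- cancel f_0.
  obtain ⟨r, hr, hr'⟩ := exists_vertexLinear_lift (V := V) (headMap N.d)
    (headMap_vertex_smul N.d) (headMap f.val) (headMap_vertex_smul f.val) h
  obtain ⟨R, hR, -⟩ := exists_linearMap_of_components r hr 0
  let n : M ⟶ N := ⟨R ∘ₗ M.d + N.d ∘ₗ R, by
    rw [LinearMap.add_comp, LinearMap.comp_add, LinearMap.comp_assoc, M.d_comp_d,
      ← LinearMap.comp_assoc R N.d N.d, N.d_comp_d, LinearMap.comp_zero, LinearMap.zero_comp, zero_add,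
      add_zero, LinearMap.comp_assoc]⟩
  refine ⟨f - n, fun t => ?_, R, ?_⟩
  · rw [DiffProj.sub_val, headMap_sub, headMap_add, headMap_comp, headMap_comp,
      headMap_d_of_isReduced hM, map_zero, zero_add, hR, hr', sub_self]
  · rw [DiffProj.sub_val, sub_sub_cancel]

/-- The cocycle given by a morphism that is zero on tops. -/
noncomputable def radicalCocycle (f : M ⟶ N) (hf : ∀ t, headMap f.val t = 0) :
    PathAlgebra.Cocycle (k := k) (W := Vᵒᵖ) (HomologyModule N (-1 : k)) (KoszulDual M hM) where
  map {i j} a := toHomology (-1)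
    (arrowMap ⟨j.unop, i.unop, a.unop⟩ f.val ∘ₗ (KoszulDual.toTop M hM).toLinearMap) fun x => by
      -- With f_0 = 0 and d_0 = 0 on M, the α-component of f d = d f reduces to d_0 f_α = 0, so f_α
      -- takes values in cycles.
      have h1 := arrowMap_d_comm ⟨j.unop, i.unop, a.unop⟩ f (KoszulDual.toTop M hM x)
      rw [headMap_d_of_isReduced hM, map_zero, zero_add, hf, hf, map_zero, zero_add] at h1
      exact h1.symm
  left {i j} a x := by
    refine (dualVertex_smul_cycleClass j.unop _).trans ?_
    exact headClass_congr _ _ (vertex_smul_arrowMap ⟨j.unop, i.unop, a.unop⟩ f.val _)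
  right {i j} a x := by
    refine headClass_congr _ _ ?_
    exact (congrArg _ (KoszulDual.toTop_vertex_smul i.unop x)).trans
      (arrowMap_vertex_smul ⟨j.unop, i.unop, a.unop⟩ f.val _)

/-- A morphism that is zero on tops is null homotopic if its cocycle is a coboundary. -/
lemma isNullHomotopic_of_coboundary (f : M ⟶ N) (hf : ∀ t, headMap f.val t = 0)
    (h : KoszulDual M hM →ₗ[k] HomologyModule N (-1 : k))
    (hv : ∀ (i : Vᵒᵖ) x, h (PathAlgebra.vertex (k := k) i • x) =
      PathAlgebra.vertex (k := k) i • h x)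
    (ha : ∀ {i j : Vᵒᵖ} (a : i ⟶ j) x, h (PathAlgebra.arrow (k := k) a • x) =
      PathAlgebra.arrow (k := k) a • h x + (radicalCocycle hM f hf).map a x) :
    DiffProj.IsNullHomotopic f.val := by
  -- The splitting h has values in homology; it is lifted linearly to cycles and then made
  -- compatible with the vertices.
  obtain ⟨r₀, hr₀⟩ := exists_linearMap_lift
    (toHomology (N := N) (-1 : k) (LinearMap.ker (headMap N.d)).subtype fun z => z.2)
    (h ∘ₗ (KoszulDual.toTop M hM).symm.toLinearMap) fun t => by
      obtain ⟨z, hz, e⟩ := cycleClass_surjective (h ((KoszulDual.toTop M hM).symm t))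
      exact ⟨⟨z, hz⟩, e⟩
  let r := vertexPart (V := V) ((LinearMap.ker (headMap N.d)).subtype ∘ₗ r₀)
  have hr (t : Head k V M) : ∃ hz : headMap N.d (r t) = 0,
      cycleClass (-1 : k) (r t) hz = h ((KoszulDual.toTop M hM).symm t) := by
    let z : LinearMap.ker (headMap N.d) := ∑ i : V,
      ⟨vertex (k := k) i • (r₀ (vertex (k := k) i • t)).1, by
        rw [LinearMap.mem_ker, headMap_vertex_smul, (r₀ _).2, smul_zero]⟩
    have hz : r t = z.1 := by
      rw [vertexPart_apply, AddSubmonoidClass.coe_finsetSum]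
      rfl
    refine ⟨by rw [hz]; exact z.2, ?_⟩
    refine (headClass_congr _ z.2 hz).trans ?_
    change toHomology (N := N) (-1 : k) (LinearMap.ker (headMap N.d)).subtype (fun z => z.2) z = _
    rw [map_sum, ← PathAlgebra.sum_vertex_smul (k := k) (W := Vᵒᵖ) (h ((KoszulDual.toTop M hM).symm t))]
    refine Fintype.sum_equiv Opposite.equivToOpposite _ _ fun i => ?_
    refine (dualVertex_smul_cycleClass i (r₀ (vertex (k := k) i • t)).2).symm.trans ?_
    have e : cycleClass (-1 : k) _ (r₀ (vertex (k := k) i • t)).2 =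
      h ((KoszulDual.toTop M hM).symm (vertex (k := k) i • t)) := hr₀ _
    rw [e, KoszulDual.toTop_symm_vertex_smul, hv, PathAlgebra.vertex_smul_vertex_smul]
    rfl
  -- As arrows act on the homology by -d_α, the coboundary identity says that f_α - r d_α - d_α r
  -- has values in boundaries. A linear choice of preimages under d_0 supplies the arrow components
  -- of the homotopy.
  have hq (α : QuiverArrow V) : ∃ q : Head k V M →ₗ[k] Head k V N, ∀ t, headMap N.d (q t) =
      (arrowMap α f.val - r ∘ₗ arrowMap α M.d - arrowMap α N.d ∘ₗ r) t := by
    refine exists_linearMap_lift _ _ fun t => ?_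
    obtain ⟨x, rfl⟩ := (KoszulDual.toTop M hM).surjective t
    have h1 := ha α.2.2.op x
    obtain ⟨hz, hz'⟩ := hr (KoszulDual.toTop M hM x)
    obtain ⟨hy, hy'⟩ := hr (arrowMap α M.d (KoszulDual.toTop M hM x))
    rw [LinearEquiv.symm_apply_apply] at hz'
    have e : h ((KoszulDual.toTop M hM).symm (arrowMap α M.d (KoszulDual.toTop M hM x))) =
        h (dual (k := k) α • x) := by
      rw [arrowMap_d_toTop, LinearEquiv.symm_apply_apply]
    rw [← hz', ← hy'.trans e] at h1
    have h2 := (h1.trans (congrArg (· + _) (dual_smul_cycleClass α hz))).symm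
    obtain ⟨w, hw⟩ := cycleClass_eq_iff.1 h2
    refine ⟨w, hw.trans ?_⟩
    simp only [LinearMap.sub_apply, LinearMap.comp_apply, arrowMap_d_toTop, neg_smul, one_smul]
    change _ + arrowMap α f.val (KoszulDual.toTop M hM x) - _ = _
    abel
  choose q hq using hq
  refine isNullHomotopic_of_components hM f r (vertexPart_vertex_smul _) q (fun t => ?_)
    fun α t => ?_
  · rw [hf, (hr t).1]
  · rw [hq]
    simp only [LinearMap.sub_apply, LinearMap.comp_apply]
    abel

variable {L : Type u} (T : L → DiffProj (RadSqZero k V))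

lemma exists_headMap_truncation_eq_zero (t : Head k V (DiffProj.directSum T)) :
    ∃ s : Finset L, ∀ s', s ⊆ s' → headMap (DiffProj.truncation T s').val t = 0 := by
  obtain ⟨x, rfl⟩ := Submodule.mkQ_surjective _ t
  obtain ⟨s, hs⟩ := DiffProj.exists_truncation_eq_zero T x
  exact ⟨s, fun s' h => (congrArg (toHead k V) (hs s' h)).trans (map_zero _)⟩

lemma exists_homologyModuleMap_truncation_eq_zero (c : k)
    (u : HomologyModule (DiffProj.directSum T) c) :
    ∃ s : Finset L, ∀ s', s ⊆ s' → homologyModuleMap c (DiffProj.truncation T s') u = 0 := by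
  obtain ⟨z, hz, rfl⟩ := cycleClass_surjective u
  obtain ⟨s, hs⟩ := exists_headMap_truncation_eq_zero T z
  exact ⟨s, fun s' h => headClass_congr _ (map_zero _) (hs s' h)⟩

/-- If `F(M)` is finitely presented, then every morphism from `M` to a direct sum factors up to
homotopy through a finite direct sum. -/
theorem exists_isNullHomotopic_truncation
    [Module.FinitePresentation (PathAlgebra k Vᵒᵖ) (KoszulDual M hM)]
    (f : M ⟶ DiffProj.directSum T) :
    ∃ s : Finset L, DiffProj.IsNullHomotopic (f ≫ DiffProj.truncation T s).val := by
  classical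
  obtain ⟨G, hG⟩ := Module.Finite.fg_top (R := PathAlgebra k Vᵒᵖ) (M := KoszulDual M hM)
  choose s hs using exists_homologyModuleMap_truncation_eq_zero T (1 : k)
  -- Finite generation of F(M) makes one truncation kill the induced map into homology, since it
  -- need only kill the images of the generators.
  let s₁ : Finset L := G.sup fun x => s (topClassMap hM f x)
  have h0 : homologyModuleMap 1 (DiffProj.truncation T s₁) ∘ₗ topClassMap hM f = 0 :=
    LinearMap.ext_on (s := (G : Set (KoszulDual M hM))) hG fun x hx =>
      hs _ _ (Finset.le_sup (f := fun x => s (topClassMap hM f x)) hx)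
  obtain ⟨g, hg, hfg⟩ := exists_homotopic_of_boundary hM (f ≫ DiffProj.truncation T s₁) fun t => by
    have h1 := LinearMap.congr_fun h0 ((KoszulDual.toTop M hM).symm t)
    rw [LinearMap.comp_apply, topClassMap_apply, homologyModuleMap_cycleClass,
      LinearEquiv.apply_symm_apply, LinearMap.zero_apply, cycleClass_eq_zero_iff] at h1
    rwa [DiffProj.comp_val, headMap_comp]
  obtain ⟨s₂, h, hv, ha⟩ := (radicalCocycle hM g hg).exists_splitting
    (fun s => homologyModuleMap (-1) (DiffProj.truncation T s))
    (exists_homologyModuleMap_truncation_eq_zero T (-1 : k))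
  have hg₂ (t) : headMap (g ≫ DiffProj.truncation T s₂).val t = 0 := by
    rw [DiffProj.comp_val, headMap_comp, hg, map_zero]
  have hnull := isNullHomotopic_of_coboundary hM (g ≫ DiffProj.truncation T s₂) hg₂ h hv
    fun {i j} a x => by
      rw [ha]
      congr 1
      -- Since g_0 = 0, the arrow components of g followed by the truncation are those of g followed
      -- by the map on tops; so the pushed cocycle is the cocycle of the truncated morphism.
      have e : headMap (DiffProj.truncation T s₂).val
          (arrowMap ⟨j.unop, i.unop, a.unop⟩ g.val (KoszulDual.toTop M hM x)) =
          arrowMap ⟨j.unop, i.unop, a.unop⟩ (g ≫ DiffProj.truncation T s₂).val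
            (KoszulDual.toTop M hM x) := by
        rw [DiffProj.comp_val, arrowMap_comp, hg, map_zero, zero_add]
      exact headClass_congr _ _ e
  refine ⟨s₁ ∪ s₂, ?_⟩
  have h1 := (hfg.comp_left (DiffProj.truncation T s₂)).add hnull
  rwa [LinearMap.comp_sub, DiffProj.comp_val g, sub_add_cancel, ← DiffProj.comp_val, Category.assoc,
    DiffProj.truncation_comp_truncation] at h1

end RadSqZero

/-! ### Test objects: differential modules induced from free modules -/

open scoped TensorProduct

namespace RadSqZero

section Induced

variable {k V : Type u} [Field k] [Quiver.{u} V] [Fintype V] [∀ i j : V, Fintype (i ⟶ j)]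

lemma mul_ar (x : RadSqZero k V) (α : QuiverArrow V) :
    x * ar α = aug x α.2.1 • ar α := by
  classical
  conv_lhs => rw [decomp x]
  simp only [add_mul, Finset.sum_mul, smul_mul_assoc, arrow_mul_arrow, smul_zero,
    Finset.sum_const_zero, add_zero]
  rw [Finset.sum_eq_single α.2.1, vertex_mul_arrow]
  · intro l _ hl
    rw [vertex_mul_arrow_of_ne _ hl, smul_zero]
  · simp

variable {Y Y' : Type u} [AddCommGroup Y] [Module k Y] [Module (PathAlgebra k Vᵒᵖ) Y]
  [IsScalarTower k (PathAlgebra k Vᵒᵖ) Y]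
  [AddCommGroup Y'] [Module k Y'] [Module (PathAlgebra k Vᵒᵖ) Y']
  [IsScalarTower k (PathAlgebra k Vᵒᵖ) Y']

variable (Y) in
/-- The differential of the free module `Λ ⊗ Y` induced by a module `Y` over the path algebra of
the opposite quiver, scaled by a constant. -/
noncomputable def inducedD (c : k) : RadSqZero k V ⊗[k] Y →ₗ[RadSqZero k V] RadSqZero k V ⊗[k] Y :=
  ∑ α : QuiverArrow V, TensorProduct.AlgebraTensorModule.map
    (LinearMap.toSpanSingleton (RadSqZero k V) (RadSqZero k V) (ar α))
    (c • Algebra.lsmul k k Y (dual (k := k) α))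

lemma inducedD_tmul (c : k) (x : RadSqZero k V) (y : Y) : inducedD Y c (x ⊗ₜ y) =
    ∑ α : QuiverArrow V, (x * ar α) ⊗ₜ (c • dual (k := k) α • y) := by
  simp [inducedD, LinearMap.sum_apply]

lemma inducedD_inducedD (c : k) (z : RadSqZero k V ⊗[k] Y) : inducedD Y c (inducedD Y c z) = 0 := by
  induction z with
  | zero => simp
  | add x y hx hy => rw [map_add, map_add, hx, hy, add_zero]
  | tmul x y =>
    simp only [inducedD_tmul, map_sum, mul_assoc, arrow_mul_arrow, mul_zero,
      TensorProduct.zero_tmul, Finset.sum_const_zero]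

variable (Y) in
/-- The differential module induced by a module over the path algebra of the opposite quiver. -/
noncomputable def induced (c : k) : DiffProj (RadSqZero k V) where
  carrier := RadSqZero k V ⊗[k] Y
  d := inducedD Y c
  d_comp_d := LinearMap.ext fun z => inducedD_inducedD c z

/-- The map on induced modules given by a linear map. -/
noncomputable abbrev inducedMap (φ : Y →ₗ[k] Y') :
    RadSqZero k V ⊗[k] Y →ₗ[RadSqZero k V] RadSqZero k V ⊗[k] Y' :=
  TensorProduct.AlgebraTensorModule.lTensor (RadSqZero k V) (RadSqZero k V) φ

lemma inducedMap_inducedD (c : k) (φ : Y →ₗ[PathAlgebra k Vᵒᵖ] Y') (z : RadSqZero k V ⊗[k] Y) :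
    inducedMap (V := V) (φ.restrictScalars k) (inducedD Y c z) =
      inducedD Y' c (inducedMap (V := V) (φ.restrictScalars k) z) := by
  induction z with
  | zero => simp
  | add x y hx hy => simp only [map_add, hx, hy]
  | tmul x y => simp [inducedD_tmul]

/-- The coefficient of an element of `Λ ⊗ Y` at a linear form on `Λ`. -/
noncomputable def tensorCoeff (l : RadSqZero k V →ₗ[k] k) : RadSqZero k V ⊗[k] Y →ₗ[k] Y :=
  TensorProduct.lid k Y ∘ₗ LinearMap.rTensor Y l

@[simp]
lemma tensorCoeff_tmul (l : RadSqZero k V →ₗ[k] k) (x : RadSqZero k V) (y : Y) :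
    tensorCoeff l (x ⊗ₜ y) = l x • y := by
  simp [tensorCoeff]

variable (k) in
/-- The coefficient at a vertex, as a linear form. -/
noncomputable def vertexForm (i : V) : RadSqZero k V →ₗ[k] k :=
  LinearMap.proj i ∘ₗ (aug (k := k) (V := V)).toLinearMap

@[simp]
lemma vertexForm_apply (i : V) (x : RadSqZero k V) : vertexForm k i x = aug x i := rfl

lemma tensorCoeff_vertexForm_ar_smul (i : V) (α : QuiverArrow V) (z : RadSqZero k V ⊗[k] Y) :
    tensorCoeff (vertexForm k i) (ar (k := k) α • z) = 0 := by
  induction z with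
  | zero => simp
  | add x y hx hy => simp only [smul_add, map_add, hx, hy, add_zero]
  | tmul x y => simp [TensorProduct.smul_tmul', aug_arrow]

lemma tensorCoeff_vertexForm_vertex_smul (i : V) (z : RadSqZero k V ⊗[k] Y) :
    tensorCoeff (vertexForm k i) (vertex (k := k) i • z) = tensorCoeff (vertexForm k i) z := by
  classical
  induction z with
  | zero => simp
  | add x y hx hy => simp only [smul_add, map_add, hx, hy]
  | tmul x y => simp [TensorProduct.smul_tmul', aug_vertex]

lemma tensorCoeff_vertexForm_vertex_smul_of_ne {i j : V} (h : i ≠ j) (z : RadSqZero k V ⊗[k] Y) :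
    tensorCoeff (vertexForm k i) (vertex (k := k) j • z) = 0 := by
  classical
  induction z with
  | zero => simp
  | add x y hx hy => simp only [smul_add, map_add, hx, hy, add_zero]
  | tmul x y => simp [TensorProduct.smul_tmul', aug_vertex, h]

/-- The induced differential has values in the arrow part of Λ ⊗ Y, so vertex coefficients do not
see it. -/
lemma tensorCoeff_vertexForm_inducedD (i : V) (c : k) (z : RadSqZero k V ⊗[k] Y) :
    tensorCoeff (vertexForm k i) (inducedD Y c z) = 0 := by
  induction z with
  | zero => simp
  | add x y hx hy => simp only [map_add, hx, hy, add_zero]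
  | tmul x y => simp [inducedD_tmul, aug_arrow]

lemma coeff_ar_self (α : QuiverArrow V) : coeff α.2.2 (ar (k := k) α) = 1 := by
  rw [coeff_arrow, if_pos rfl]

lemma coeff_ar_of_ne {α β : QuiverArrow V} (h : α ≠ β) : coeff α.2.2 (ar (k := k) β) = 0 := by
  rw [coeff_arrow, if_neg h]

lemma tensorCoeff_coeff_ar_smul_self (α : QuiverArrow V) (z : RadSqZero k V ⊗[k] Y) :
    tensorCoeff (coeff α.2.2) (ar (k := k) α • z) = tensorCoeff (vertexForm k α.1) z := by
  induction z with
  | zero => simp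
  | add x y hx hy => simp only [smul_add, map_add, hx, hy]
  | tmul x y =>
    rw [TensorProduct.smul_tmul', smul_eq_mul, arrow_mul, tensorCoeff_tmul, map_smul,
      coeff_ar_self, tensorCoeff_tmul, vertexForm_apply, smul_eq_mul, mul_one]

lemma tensorCoeff_coeff_ar_smul_of_ne {α β : QuiverArrow V} (h : α ≠ β)
    (z : RadSqZero k V ⊗[k] Y) : tensorCoeff (coeff α.2.2) (ar (k := k) β • z) = 0 := by
  induction z with
  | zero => simp
  | add x y hx hy => simp only [smul_add, map_add, hx, hy, add_zero]
  | tmul x y =>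
    rw [TensorProduct.smul_tmul', smul_eq_mul, arrow_mul, tensorCoeff_tmul, map_smul,
      coeff_ar_of_ne h, smul_zero, zero_smul]

lemma tensorCoeff_coeff_sum_ar_smul (α : QuiverArrow V) (z : QuiverArrow V → RadSqZero k V ⊗[k] Y) :
    tensorCoeff (coeff α.2.2) (∑ β, ar (k := k) β • z β) =
      tensorCoeff (vertexForm k α.1) (z α) := by
  classical
  rw [map_sum, Finset.sum_eq_single α, tensorCoeff_coeff_ar_smul_self]
  · intro β _ hβ
    exact tensorCoeff_coeff_ar_smul_of_ne hβ.symm _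
  · simp

/-- The differential multiplies by arrows on the right in Λ, and x α depends only on the coefficient
of x at e_{t(α)}. -/
lemma tensorCoeff_coeff_inducedD (α : QuiverArrow V) (c : k) (z : RadSqZero k V ⊗[k] Y) :
    tensorCoeff (coeff α.2.2) (inducedD Y c z) =
      c • dual (k := k) α • tensorCoeff (vertexForm k α.2.1) z := by
  classical
  induction z with
  | zero => simp
  | add x y hx hy => simp only [map_add, hx, hy, smul_add]
  | tmul x y =>
    rw [inducedD_tmul, map_sum, Finset.sum_eq_single α]
    · rw [tensorCoeff_tmul, tensorCoeff_tmul, mul_ar, map_smul, coeff_ar_self, vertexForm_apply,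
        smul_eq_mul, mul_one, smul_comm (dual α) (aug x _) y, smul_comm]
    · intro β _ hβ
      rw [tensorCoeff_tmul, mul_ar, map_smul, coeff_ar_of_ne hβ.symm, smul_zero, zero_smul]
    · simp

end Induced

section Family

variable (k V : Type u) [Field k] [Quiver.{u} V] [Fintype V] [∀ i j : V, Fintype (i ⟶ j)]
variable (L : Type u) (c : k)

/-- The constant family of the differential modules induced by the regular module. -/
noncomputable abbrev regularFamily : L → DiffProj (RadSqZero k V) :=
  fun _ => induced (PathAlgebra k Vᵒᵖ) c

variable {k V L}

/-- The comparison of the direct sum of induced modules with the module induced by the free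
module. -/
noncomputable def fromDirectSum : DiffProj.directSum (regularFamily k V L c) →ₗ[RadSqZero k V]
    RadSqZero k V ⊗[k] (L →₀ PathAlgebra k Vᵒᵖ) :=
  DiffProj.descL _ fun l =>
    inducedMap (V := V) ((Finsupp.lsingle l : _ →ₗ[PathAlgebra k Vᵒᵖ] _).restrictScalars k)

lemma fromDirectSum_incl (l : L) (z : regularFamily k V L c l) :
    fromDirectSum c (DiffProj.incl _ l z) =
    inducedMap (V := V) ((Finsupp.lsingle l :
      PathAlgebra k Vᵒᵖ →ₗ[PathAlgebra k Vᵒᵖ] _).restrictScalars k) z :=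
  DiffProj.descL_incl _ _ l z

lemma fromDirectSum_d (z : DiffProj.directSum (regularFamily k V L c)) :
    fromDirectSum c ((DiffProj.directSum _).d z) = inducedD _ c (fromDirectSum c z) := by
  have : fromDirectSum c ∘ₗ (DiffProj.directSum (regularFamily k V L c)).d =
      inducedD _ c ∘ₗ fromDirectSum c := DiffProj.ext_incl _ fun l x => by
    rw [LinearMap.comp_apply, LinearMap.comp_apply, DiffProj.d_incl, fromDirectSum_incl,
      fromDirectSum_incl]
    exact inducedMap_inducedD c _ _
  exact LinearMap.congr_fun this z

open Classical in
/-- The endomorphism of a free module that forgets the coordinates in a finite set. -/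
noncomputable def forget {A : Type*} [Ring A] (s : Finset L) : (L →₀ A) →ₗ[A] L →₀ A :=
  (Finsupp.supported A A (s : Set L)ᶜ).subtype ∘ₗ Finsupp.restrictDom A A (s : Set L)ᶜ

open Classical in
lemma forget_apply {A : Type*} [Ring A] (s : Finset L) (f : L →₀ A) (l : L) :
    forget s f l = if l ∈ s then 0 else f l := by
  simp [forget, Finsupp.filter_apply]

lemma forget_single_of_mem {A : Type*} [Ring A] {s : Finset L} {l : L} (h : l ∈ s) (a : A) :
    forget s (Finsupp.single l a) = 0 := by
  classical
  ext l'
  rw [forget_apply, Finsupp.zero_apply]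
  split_ifs with h'
  · rfl
  · exact Finsupp.single_eq_of_ne (ne_of_mem_of_not_mem h h').symm

lemma forget_single_of_notMem {A : Type*} [Ring A] {s : Finset L} {l : L} (h : l ∉ s) (a : A) :
    forget s (Finsupp.single l a) = Finsupp.single l a := by
  classical
  ext l'
  rw [forget_apply]
  split_ifs with h'
  · exact (Finsupp.single_eq_of_ne (ne_of_mem_of_not_mem h' h)).symm
  · rfl

lemma inducedMap_forget_of_mem {s : Finset L} {l : L} (h : l ∈ s)
    (x : RadSqZero k V ⊗[k] PathAlgebra k Vᵒᵖ) :
    inducedMap (V := V) ((forget s).restrictScalars k) (inducedMap (V := V) ((Finsupp.lsingle l :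
      PathAlgebra k Vᵒᵖ →ₗ[PathAlgebra k Vᵒᵖ] _).restrictScalars k) x) = 0 := by
  induction x with
  | zero => simp
  | add x y hx hy => rw [map_add, map_add, hx, hy, add_zero]
  | tmul x y => simp [forget_single_of_mem h]

lemma inducedMap_forget_of_notMem {s : Finset L} {l : L} (h : l ∉ s)
    (x : RadSqZero k V ⊗[k] PathAlgebra k Vᵒᵖ) :
    inducedMap (V := V) ((forget s).restrictScalars k) (inducedMap (V := V) ((Finsupp.lsingle l :
      PathAlgebra k Vᵒᵖ →ₗ[PathAlgebra k Vᵒᵖ] _).restrictScalars k) x) =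
    inducedMap (V := V) ((Finsupp.lsingle l :
      PathAlgebra k Vᵒᵖ →ₗ[PathAlgebra k Vᵒᵖ] _).restrictScalars k) x := by
  induction x with
  | zero => simp
  | add x y hx hy => rw [map_add, map_add, hx, hy]
  | tmul x y => simp [forget_single_of_notMem h]

/-- Under the comparison with Λ ⊗ A^(L), killing summands becomes forgetting coordinates of the free
module. Both sides are checked on each summand. -/
lemma fromDirectSum_truncation (s : Finset L)
    (z : DiffProj.directSum (regularFamily k V L c)) :
    fromDirectSum c ((DiffProj.truncation _ s).val z) =
      inducedMap (V := V) ((forget s).restrictScalars k) (fromDirectSum c z) := by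
  have : fromDirectSum c ∘ₗ (DiffProj.truncation (regularFamily k V L c) s).val =
      inducedMap (V := V) ((forget s).restrictScalars k) ∘ₗ fromDirectSum c :=
    DiffProj.ext_incl _ fun l x => by
      rw [LinearMap.comp_apply, LinearMap.comp_apply, fromDirectSum_incl]
      by_cases hl : l ∈ s
      · rw [DiffProj.truncation_incl_of_mem _ hl, map_zero]
        exact (inducedMap_forget_of_mem hl _).symm
      · rw [DiffProj.truncation_incl_of_notMem _ hl]
        exact (fromDirectSum_incl c l x).trans (inducedMap_forget_of_notMem hl _).symm
  exact LinearMap.congr_fun this z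

/-- The generators of an induced module. -/
noncomputable def generator :
    PathAlgebra k Vᵒᵖ →ₗ[k] induced (k := k) (V := V) (PathAlgebra k Vᵒᵖ) c where
  toFun y := (1 : RadSqZero k V) ⊗ₜ[k] y
  map_add' := TensorProduct.tmul_add 1
  map_smul' r y := by
    refine (TensorProduct.tmul_smul r (1 : RadSqZero k V) y).trans ?_
    exact (algebraMap_smul (RadSqZero k V) r ((1 : RadSqZero k V) ⊗ₜ[k] y)).symm

variable (L) in
/-- The generators of a direct sum of induced modules. -/
noncomputable def generators : (L →₀ PathAlgebra k Vᵒᵖ) →ₗ[k]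
    DiffProj.directSum (regularFamily k V L c) :=
  Finsupp.lsum k fun l => (DiffProj.incl (regularFamily k V L c) l).restrictScalars k ∘ₗ generator c

lemma generators_single (l : L) (y : PathAlgebra k Vᵒᵖ) :
    generators L c (Finsupp.single l y) = DiffProj.incl (regularFamily k V L c) l (generator c y) := by
  simp [generators]

lemma fromDirectSum_generators (y : L →₀ PathAlgebra k Vᵒᵖ) :
    fromDirectSum c (generators L c y) = (1 : RadSqZero k V) ⊗ₜ[k] y := by
  induction y using Finsupp.induction_linear with
  | zero => simp
  | add x y hx hy => rw [map_add, map_add, hx, hy, TensorProduct.tmul_add]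
  | single l y =>
    rw [generators_single, fromDirectSum_incl]
    rfl

lemma d_generators (y : L →₀ PathAlgebra k Vᵒᵖ) :
    (DiffProj.directSum _).d (generators L c y) =
      ∑ α : QuiverArrow V, ar (k := k) α • generators L c (c • dual (k := k) α • y) := by
  induction y using Finsupp.induction_linear with
  | zero => simp
  | add x y hx hy => simp only [map_add, hx, hy, smul_add, Finset.sum_add_distrib]
  | single l y =>
    rw [generators_single, DiffProj.d_incl]
    simp only [Finsupp.smul_single, generators_single, ← map_smul, ← map_sum]
    congr 1
    refine (inducedD_tmul c 1 y).trans ?_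
    refine Finset.sum_congr rfl fun α _ => ?_
    rw [one_mul]
    refine Eq.trans ?_ (TensorProduct.smul_tmul' (ar (k := k) α) (1 : RadSqZero k V) _).symm
    exact congrArg (· ⊗ₜ[k] _) (mul_one (ar (k := k) α)).symm

end Family

/-! ### Consequences of compactness for maps and cocycles into free modules -/

section Compact

variable {k V : Type u} [Field k] [Quiver.{u} V] [Fintype V] [∀ i j : V, Fintype (i ⟶ j)]
variable {M : DiffProj (RadSqZero k V)}

/-- A morphism from a compact object to the module induced by a free module factors up to homotopy
through finitely many coordinates. -/
lemma exists_forget_eq_of_isCompactObj (h : IsCompactObj M.toHomotopyCat) {L : Type u} {c : k}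
    (f : M ⟶ DiffProj.directSum (regularFamily k V L c)) :
    ∃ (s : Finset L) (R : M →ₗ[RadSqZero k V] RadSqZero k V ⊗[k] (L →₀ PathAlgebra k Vᵒᵖ)), ∀ x,
      inducedMap (V := V) ((forget s).restrictScalars k) (fromDirectSum c (f.val x)) =
        R (M.d x) + inducedD _ c (R x) := by
  obtain ⟨s, r, hr⟩ := (DiffProj.isCompactObj_iff M).1 h L _ f
  refine ⟨s, fromDirectSum c ∘ₗ r, fun x => ?_⟩
  have h1 := congrArg (fromDirectSum c) (LinearMap.congr_fun hr x)
  rw [DiffProj.comp_val, LinearMap.comp_apply, fromDirectSum_truncation] at h1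
  rw [h1, LinearMap.add_apply, map_add, LinearMap.comp_apply, LinearMap.comp_apply,
    fromDirectSum_d]
  rfl

variable {hM : M.IsReduced}

/-- The image of a linear map from the dual of a compact object to a free module
is contained in a finitely generated free module. -/
lemma exists_forget_linearMap_eq_zero (h : IsCompactObj M.toHomotopyCat) {L : Type u}
    (θ : KoszulDual M hM →ₗ[PathAlgebra k Vᵒᵖ] L →₀ PathAlgebra k Vᵒᵖ) :
    ∃ s : Finset L, ∀ x, forget s (θ x) = 0 := by
  classical
  -- The map is x ↦ Σ e_i ⊗ θ(e_i x). The tensor product is over k and not over kQ_0, so the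
  -- vertices have to be inserted by hand.
  let φ : Head k V M →ₗ[k] DiffProj.directSum (regularFamily k V L (1 : k)) :=
    vertexPart (V := V) (generators L (1 : k) ∘ₗ θ.restrictScalars k ∘ₗ
      (KoszulDual.toTop M hM).symm.toLinearMap)
  have hφ (x : KoszulDual M hM) : φ (KoszulDual.toTop M hM x) =
      ∑ i : V, vertex (k := k) i • generators L (1 : k) (θ (dualVertex (k := k) i • x)) := by
    refine (vertexPart_apply _ _).trans (Finset.sum_congr rfl fun i _ => ?_)
    rw [LinearMap.comp_apply, LinearMap.comp_apply, LinearEquiv.coe_coe,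
      KoszulDual.toTop_symm_vertex_smul, LinearEquiv.symm_apply_apply]
    rfl
  obtain ⟨f, hf⟩ := exists_extension φ (vertexPart_vertex_smul _)
  have hcomm : f ∘ₗ M.d = (DiffProj.directSum (regularFamily k V L (1 : k))).d ∘ₗ f := by
    refine ext_headSection (k := k) (V := V) fun t => ?_
    obtain ⟨x, rfl⟩ := (KoszulDual.toTop M hM).surjective t
    rw [LinearMap.comp_apply, LinearMap.comp_apply, KoszulDual.d_headSection, hf, hφ]
    simp only [map_sum, map_smul, hf, hφ, d_generators, one_smul, Finset.smul_sum]
    -- In the sums over vertices only s(α) survives on one side, from α e_i, and only t(α) on the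
    -- other, from e_i α. Both sides reduce to α ⊗ θ(α* x), by linearity of θ.
    refine Eq.trans ?_ Finset.sum_comm
    refine Finset.sum_congr rfl fun α _ => ?_
    rw [Finset.sum_eq_single α.1, Finset.sum_eq_single α.2.1, ar_smul_vertex_smul,
      vertex_smul_ar_smul, PathAlgebra.vertex_smul_arrow_smul, PathAlgebra.arrow_smul_vertex_smul]
    · intro i _ hi
      exact vertex_smul_ar_smul_of_ne hi _
    · simp
    · intro i _ hi
      exact ar_smul_vertex_smul_of_ne hi.symm _
    · simp
  obtain ⟨s, R, hR⟩ := exists_forget_eq_of_isCompactObj h ⟨f, hcomm⟩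
  refine ⟨s, fun x => ?_⟩
  rw [← PathAlgebra.sum_vertex_smul (k := k) (W := Vᵒᵖ) x, map_sum, map_sum]
  refine Finset.sum_eq_zero fun i _ => ?_
  -- Both homotopy terms lie in the arrow part: d of the induced module lands there, and R(d x) is a
  -- sum of arrow multiples. The coefficient at a vertex therefore has to vanish.
  have h1 := congrArg (tensorCoeff (vertexForm k i.unop))
    (hR (headSection k V M (KoszulDual.toTop M hM x)))
  rw [map_add, tensorCoeff_vertexForm_inducedD, add_zero, KoszulDual.d_headSection, hf, hφ] at h1
  simp only [map_sum, map_smul, tensorCoeff_vertexForm_ar_smul, Finset.sum_const_zero] at h1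
  rw [Finset.sum_eq_single i.unop] at h1
  · rw [tensorCoeff_vertexForm_vertex_smul, fromDirectSum_generators] at h1
    simpa using h1
  · intro j _ hj
    exact tensorCoeff_vertexForm_vertex_smul_of_ne hj.symm _
  · simp

/-- Every cocycle on the dual of a compact object with values in a free module is a coboundary up
to finitely many coordinates. -/
lemma exists_forget_cocycle_eq (h : IsCompactObj M.toHomotopyCat) {L : Type u}
    (F : QuiverArrow V → KoszulDual M hM →ₗ[k] L →₀ PathAlgebra k Vᵒᵖ)
    (hl : ∀ α x, dualVertex (k := k) α.1 • F α x = F α x)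
    (hr : ∀ α x, F α (dualVertex (k := k) α.2.1 • x) = F α x) :
    ∃ (s : Finset L) (η : KoszulDual M hM →ₗ[k] L →₀ PathAlgebra k Vᵒᵖ),
      (∀ (i : V) x, η (dualVertex (k := k) i • x) = dualVertex (k := k) i • η x) ∧
      ∀ α x, forget s (F α x) = η (dual (k := k) α • x) - dual (k := k) α • η x := by
  classical
  let φ : Head k V M →ₗ[k] DiffProj.directSum (regularFamily k V L (-1 : k)) :=
    ∑ α : QuiverArrow V, Algebra.lsmul k k _ (ar (k := k) α) ∘ₗ generators L (-1 : k) ∘ₗ F α ∘ₗ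
      (KoszulDual.toTop M hM).symm.toLinearMap
  have hφ (x : KoszulDual M hM) : φ (KoszulDual.toTop M hM x) =
      ∑ α : QuiverArrow V, ar (k := k) α • generators L (-1 : k) (F α x) := by
    simp [φ, LinearMap.sum_apply]
  have hr' (α : QuiverArrow V) (i : V) (hi : i ≠ α.2.1) (x) : F α (dualVertex (k := k) i • x) = 0 := by
    rw [← hr, PathAlgebra.vertex_smul_vertex_smul_of_ne (fun e => hi (Opposite.op_injective e).symm),
      map_zero]
  obtain ⟨f, hf⟩ := exists_extension φ fun i t => by
    obtain ⟨x, rfl⟩ := (KoszulDual.toTop M hM).surjective t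
    rw [← KoszulDual.toTop_vertex_smul, hφ, hφ, Finset.smul_sum]
    refine Finset.sum_congr rfl fun α _ => ?_
    by_cases hi : i = α.2.1
    · subst hi
      rw [hr, vertex_smul_ar_smul]
    · rw [hr' α i hi, vertex_smul_ar_smul_of_ne hi, map_zero, smul_zero]
  -- Both composites vanish because products of two arrows do, whatever the scalar in the induced
  -- differential. The value -1 is chosen to give the coboundary its sign.
  have hcomm : f ∘ₗ M.d = (DiffProj.directSum (regularFamily k V L (-1 : k))).d ∘ₗ f := by
    refine ext_headSection (k := k) (V := V) fun t => ?_
    obtain ⟨x, rfl⟩ := (KoszulDual.toTop M hM).surjective t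
    rw [LinearMap.comp_apply, LinearMap.comp_apply, KoszulDual.d_headSection, hf, hφ]
    simp only [map_sum, map_smul, hf, hφ, d_generators, Finset.smul_sum, ar_smul_ar_smul,
      Finset.sum_const_zero]
  obtain ⟨s, R, hR⟩ := exists_forget_eq_of_isCompactObj h ⟨f, hcomm⟩
  let E (i : V) (x : KoszulDual M hM) : L →₀ PathAlgebra k Vᵒᵖ :=
    tensorCoeff (vertexForm k i) (R (headSection k V M (KoszulDual.toTop M hM x)))
  have hE (i : V) (x) : E i (dualVertex (k := k) i • x) = E i x := by
    simp only [E, KoszulDual.toTop_vertex_smul, headSection_vertex_smul, map_smul,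
      tensorCoeff_vertexForm_vertex_smul]
  have hE' {i j : V} (hij : i ≠ j) (x) : E i (dualVertex (k := k) j • x) = 0 := by
    simp only [E, KoszulDual.toTop_vertex_smul, headSection_vertex_smul, map_smul,
      tensorCoeff_vertexForm_vertex_smul_of_ne hij]
  let η : KoszulDual M hM →ₗ[k] L →₀ PathAlgebra k Vᵒᵖ := ∑ i : V,
    Algebra.lsmul k k _ (dualVertex (k := k) i) ∘ₗ tensorCoeff (vertexForm k i) ∘ₗ
      R.restrictScalars k ∘ₗ headSection k V M ∘ₗ (KoszulDual.toTop M hM).toLinearMap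
  have hη (x) : η x = ∑ i : V, dualVertex (k := k) i • E i x := by
    simp [η, E, LinearMap.sum_apply]
  have hη' (i : V) (x) : η (dualVertex (k := k) i • x) = dualVertex (k := k) i • E i x := by
    rw [hη, Finset.sum_eq_single i, hE]
    · intro j _ hj
      rw [hE' hj, smul_zero]
    · simp
  have hη'' (i : V) (x) : dualVertex (k := k) i • η x = dualVertex (k := k) i • E i x := by
    rw [hη, Finset.smul_sum, Finset.sum_eq_single i, PathAlgebra.vertex_smul_vertex_smul]
    · intro j _ hj
      exact PathAlgebra.vertex_smul_vertex_smul_of_ne (fun e => hj (Opposite.op_injective e).symm) _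
    · simp
  refine ⟨s, η, fun i x => by rw [hη', hη''], fun α x => ?_⟩
  -- At the arrow α the term R d contributes the s(α)-coefficient of R at α* x, and d R contributes
  -- -α* applied to the t(α)-coefficient at x. With η assembled from the e_i-parts of these
  -- coefficients, this is the coboundary of η after multiplication by e_{s(α)}.
  have h1 := congrArg (tensorCoeff (coeff α.2.2)) (hR (headSection k V M (KoszulDual.toTop M hM x)))
  rw [map_add, tensorCoeff_coeff_inducedD, KoszulDual.d_headSection, hf, hφ] at h1
  simp only [map_sum, map_smul, fromDirectSum_generators] at h1
  rw [← map_sum, ← map_sum, tensorCoeff_coeff_sum_ar_smul, tensorCoeff_coeff_sum_ar_smul] at h1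
  have h2 : tensorCoeff (vertexForm k α.1) (inducedMap (V := V) ((forget s).restrictScalars k)
      ((1 : RadSqZero k V) ⊗ₜ[k] F α x)) = forget s (F α x) := by simp
  rw [h2] at h1
  rw [← hl, map_smul, h1, smul_add, neg_one_smul, smul_neg, PathAlgebra.vertex_smul_arrow_smul,
    ← sub_eq_add_neg]
  congr 1
  · rw [← hη', PathAlgebra.vertex_smul_arrow_smul]
  · rw [← PathAlgebra.arrow_smul_vertex_smul _ (η x), hη'', PathAlgebra.arrow_smul_vertex_smul]

end Compact
end RadSqZero

/-! ### Retracts of quotients of free modules and finite presentation -/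

section Presentation

variable {A : Type*} [Ring A] {ι : Type*}

instance (s : Finset ι) : Module.Finite A (Finsupp.supported A A (s : Set ι)) :=
  Module.Finite.equiv (Finsupp.supportedEquivFinsupp (M := A) (R := A) (s : Set ι)).symm

instance (s : Finset ι) : Module.Projective A (Finsupp.supported A A (s : Set ι)) :=
  Module.Projective.of_equiv (Finsupp.supportedEquivFinsupp (M := A) (R := A) (s : Set ι)).symm

lemma exists_le_supported_of_fg {P : Submodule A (ι →₀ A)} (hP : P.FG) :
    ∃ s : Finset ι, P ≤ Finsupp.supported A A (s : Set ι) := by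
  classical
  obtain ⟨G, rfl⟩ := hP
  refine ⟨G.sup Finsupp.support, Submodule.span_le.2 fun p hp => ?_⟩
  rw [SetLike.mem_coe, Finsupp.mem_supported, Finset.coe_subset]
  exact Finset.le_sup (f := Finsupp.support) hp

namespace RadSqZero

lemma forget_eq_zero_iff {s : Finset ι} {p : ι →₀ A} :
    forget s p = 0 ↔ p ∈ Finsupp.supported A A (s : Set ι) := by
  classical
  rw [Finsupp.mem_supported', Finsupp.ext_iff]
  refine forall_congr' fun i => ?_
  rw [forget_apply, Finsupp.zero_apply, Finset.mem_coe]
  split_ifs with h <;> simp [h]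

lemma sub_forget_mem_supported (s : Finset ι) (p : ι →₀ A) :
    p - forget s p ∈ Finsupp.supported A A (s : Set ι) := by
  classical
  rw [← forget_eq_zero_iff]
  ext i
  rw [forget_apply, Finsupp.sub_apply, forget_apply, Finsupp.zero_apply]
  split_ifs <;> simp

/-- A retract `X` of a module `Q` is finitely presented if it is contained in the image of a
finitely presented module under a map to `Q` with finitely generated kernel. -/
lemma finitePresentation_of_le_range {X Q F : Type*} [AddCommGroup X] [Module A X]
    [AddCommGroup Q] [Module A Q] [AddCommGroup F] [Module A F] [Module.FinitePresentation A F]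
    (π : F →ₗ[A] Q) (hker : (LinearMap.ker π).FG) (μ : Q →ₗ[A] X) (σ : X →ₗ[A] Q)
    (hσ : ∀ x, μ (σ x) = x) (hπ : ∀ x, ∃ p, π p = σ x) : Module.FinitePresentation A X := by
  refine Module.finitePresentation_of_surjective (μ ∘ₗ π) (fun x => ?_)
    (Submodule.fg_of_fg_map_of_fg_inf_ker π ?_ ?_)
  · obtain ⟨p, hp⟩ := hπ x
    exact ⟨p, by rw [LinearMap.comp_apply, hp, hσ]⟩
  · have e : (LinearMap.ker (μ ∘ₗ π)).map π = LinearMap.range (π - σ ∘ₗ μ ∘ₗ π) := by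
      ext z
      constructor
      · rintro ⟨p, hp, rfl⟩
        refine ⟨p, ?_⟩
        rw [LinearMap.sub_apply, LinearMap.comp_apply, LinearMap.mem_ker.1 hp, map_zero, sub_zero]
      · rintro ⟨p, rfl⟩
        obtain ⟨q, hq⟩ := hπ (μ (π p))
        refine ⟨p - q, ?_, ?_⟩
        · rw [SetLike.mem_coe, LinearMap.mem_ker, LinearMap.comp_apply, map_sub, hq, map_sub, hσ,
            sub_self]
        · rw [map_sub, hq]
          rfl
    rw [e]
    exact Submodule.FG.of_finite
  · rwa [inf_eq_right.2]
    exact LinearMap.ker_le_ker_comp π μ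

/-- If a retract of the quotient of a free module by a finitely generated submodule has the
property that every linear map to the free module has values in a finitely generated free
submodule, then it is finitely presented. -/
theorem finitePresentation_of_retract {X : Type*} [AddCommGroup X] [Module A X]
    {P : Submodule A (ι →₀ A)} (hP : P.FG) (μ : ((ι →₀ A) ⧸ P) →ₗ[A] X)
    (σ : X →ₗ[A] (ι →₀ A) ⧸ P) (hσ : ∀ x, μ (σ x) = x)
    (h : ∀ θ : X →ₗ[A] ι →₀ A, ∃ s : Finset ι, ∀ x, forget s (θ x) = 0) :
    Module.FinitePresentation A X := by
  classical
  obtain ⟨B, hB⟩ := exists_le_supported_of_fg hP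
  -- P lives in the coordinates of B, so forgetting B is defined on the quotient. The hypothesis on
  -- maps to the free module then bounds the remaining coordinates of σ.
  obtain ⟨s, hs⟩ := h (P.liftQ (forget B)
    (fun p hp => LinearMap.mem_ker.2 (forget_eq_zero_iff.2 (hB hp))) ∘ₗ σ)
  have hBC : (B : Set ι) ⊆ (B ∪ s : Finset ι) := Finset.coe_subset.2 Finset.subset_union_left
  let F := Finsupp.supported A A ((B ∪ s : Finset ι) : Set ι)
  let π : F →ₗ[A] (ι →₀ A) ⧸ P := P.mkQ ∘ₗ F.subtype
  have hπ (x : X) : ∃ p, π p = σ x := by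
    obtain ⟨p, hp⟩ := Submodule.mkQ_surjective P (σ x)
    refine ⟨⟨p, ?_⟩, hp⟩
    have h1 := hs x
    rw [LinearMap.comp_apply, ← hp, Submodule.mkQ_apply, Submodule.liftQ_apply] at h1
    refine (Finsupp.mem_supported' A p).2 fun i hi => ?_
    have h2 := DFunLike.congr_fun h1 i
    simp only [Finset.coe_union, Set.mem_union, Finset.mem_coe, not_or] at hi
    simpa [forget_apply, hi.1, hi.2] using h2
  have hker : (LinearMap.ker π).FG := by
    rw [LinearMap.ker_comp, Submodule.ker_mkQ]
    refine Submodule.fg_of_fg_map_injective F.subtype Subtype.val_injective ?_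
    rwa [Submodule.map_comap_subtype, inf_eq_right.2]
    exact hB.trans (Finsupp.supported_mono hBC)
  have : Module.FinitePresentation A F := Module.finitePresentation_of_projective A F
  exact finitePresentation_of_le_range (F := F) π hker μ σ hσ hπ

end RadSqZero

end Presentation

/-! ### From compactness to finite presentation -/

namespace RadSqZero

variable {k V : Type u} [Field k] [Quiver.{u} V] [Fintype V] [∀ i j : V, Fintype (i ⟶ j)]
variable {X : Type u} [AddCommGroup X] [Module k X] [Module (PathAlgebra k Vᵒᵖ) X]
  [IsScalarTower k (PathAlgebra k Vᵒᵖ) X]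

/-- A module over the path algebra for which linear maps to free modules and cocycles with values
in free modules are finite is finitely presented. -/
theorem finitePresentation_of_forget
    (h0 : ∀ (L : Type u) (θ : X →ₗ[PathAlgebra k Vᵒᵖ] L →₀ PathAlgebra k Vᵒᵖ),
      ∃ s : Finset L, ∀ x, forget s (θ x) = 0)
    (h1 : ∀ (L : Type u) (F : QuiverArrow V → X →ₗ[k] L →₀ PathAlgebra k Vᵒᵖ)
      (_ : ∀ α x, dualVertex (k := k) α.1 • F α x = F α x)
      (_ : ∀ α x, F α (dualVertex (k := k) α.2.1 • x) = F α x),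
      ∃ (s : Finset L) (η : X →ₗ[k] L →₀ PathAlgebra k Vᵒᵖ),
        (∀ (i : V) x, η (dualVertex (k := k) i • x) = dualVertex (k := k) i • η x) ∧
        ∀ α x, forget s (F α x) = η (dual (k := k) α • x) - dual (k := k) α • η x) :
    Module.FinitePresentation (PathAlgebra k Vᵒᵖ) X := by
  classical
  -- The free cover μ has one generator for each element of a k-basis of X; n is its obvious
  -- k-linear section, and s₀ below the vertex-compatible part of n.
  let b := Module.Basis.ofVectorSpace k X
  let ι := Module.Basis.ofVectorSpaceIndex k X
  let n : X →ₗ[k] ι →₀ PathAlgebra k Vᵒᵖ := b.constr k fun i => Finsupp.single i 1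
  have hn (i : ι) : n (b i) = Finsupp.single i 1 := b.constr_basis k _ i
  let μ : (ι →₀ PathAlgebra k Vᵒᵖ) →ₗ[PathAlgebra k Vᵒᵖ] X :=
    Finsupp.linearCombination (PathAlgebra k Vᵒᵖ) b
  have hμn (x) : μ (n x) = x := by
    have : μ.restrictScalars k ∘ₗ n = LinearMap.id := b.ext fun i => by simp [hn, μ]
    exact LinearMap.congr_fun this x
  let s₀ : X →ₗ[k] ι →₀ PathAlgebra k Vᵒᵖ := ∑ i : V,
    Algebra.lsmul k k _ (dualVertex (k := k) i) ∘ₗ n ∘ₗ Algebra.lsmul k k _ (dualVertex (k := k) i)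
  have hs₀ (x) : s₀ x = ∑ i : V, dualVertex (k := k) i • n (dualVertex (k := k) i • x) := by
    simp [s₀, LinearMap.sum_apply]
  have hne {i j : V} (h : i ≠ j) : Opposite.op i ≠ Opposite.op j :=
    fun e => h (Opposite.op_injective e)
  have hs₀' (i : V) (x) : s₀ (dualVertex (k := k) i • x) =
      dualVertex (k := k) i • n (dualVertex (k := k) i • x) := by
    rw [hs₀, Finset.sum_eq_single i, PathAlgebra.vertex_smul_vertex_smul]
    · intro j _ hj
      rw [PathAlgebra.vertex_smul_vertex_smul_of_ne (hne hj), map_zero, smul_zero]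
    · simp
  have hs₀'' (i : V) (x) : dualVertex (k := k) i • s₀ x =
      dualVertex (k := k) i • n (dualVertex (k := k) i • x) := by
    rw [hs₀, Finset.smul_sum, Finset.sum_eq_single i, PathAlgebra.vertex_smul_vertex_smul]
    · intro j _ hj
      exact PathAlgebra.vertex_smul_vertex_smul_of_ne (hne hj.symm) _
    · simp
  have hμs₀ (x) : μ (s₀ x) = x := by
    simp only [hs₀, map_sum, map_smul, hμn, PathAlgebra.vertex_smul_vertex_smul]
    rw [← PathAlgebra.sum_vertex_smul (k := k) (W := Vᵒᵖ) x]
    exact (Fintype.sum_equiv Opposite.equivToOpposite _ _ fun i => by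
      rw [PathAlgebra.sum_vertex_smul]; rfl)
  -- A cocycle into a free module with basis the pairs (α, i). Composed with ζ, it measures how far
  -- n is from commuting with the arrows; ζ has values in the kernel of μ.
  let F₀ (α : QuiverArrow V) : X →ₗ[k] QuiverArrow V × ι →₀ PathAlgebra k Vᵒᵖ :=
    b.constr k fun i => Finsupp.single (α, i) (dualVertex (k := k) α.1)
  have hF₀ (α : QuiverArrow V) (i : ι) : F₀ α (b i) =
    Finsupp.single (α, i) (dualVertex (k := k) α.1) := b.constr_basis k _ i
  let ζ : (QuiverArrow V × ι →₀ PathAlgebra k Vᵒᵖ) →ₗ[PathAlgebra k Vᵒᵖ]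
      ι →₀ PathAlgebra k Vᵒᵖ := Finsupp.linearCombination (PathAlgebra k Vᵒᵖ) fun p =>
    dualVertex (k := k) p.1.1 • n (dual (k := k) p.1 • b p.2) - dual (k := k) p.1 • n (b p.2)
  have hζ (α : QuiverArrow V) (x) : ζ (F₀ α x) =
      dualVertex (k := k) α.1 • n (dual (k := k) α • x) - dual (k := k) α • n x := by
    have : ζ.restrictScalars k ∘ₗ F₀ α = Algebra.lsmul k k _ (dualVertex (k := k) α.1) ∘ₗ n ∘ₗ
        Algebra.lsmul k k _ (dual (k := k) α) - Algebra.lsmul k k _ (dual (k := k) α) ∘ₗ n :=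
      b.ext fun i => by
        simp only [LinearMap.comp_apply, LinearMap.restrictScalars_apply, hF₀, ζ,
          Finsupp.linearCombination_single, LinearMap.sub_apply, Algebra.lsmul_coe, smul_sub,
          PathAlgebra.vertex_smul_vertex_smul, PathAlgebra.vertex_smul_arrow_smul]
    exact LinearMap.congr_fun this x
  have hμζ (z) : μ (ζ z) = 0 := by
    have : μ ∘ₗ ζ = 0 := Finsupp.lhom_ext' fun p => LinearMap.ext_ring (by
      simp only [LinearMap.comp_apply, Finsupp.lsingle_apply, ζ, Finsupp.linearCombination_single,
        one_smul, map_sub, map_smul, hμn, PathAlgebra.vertex_smul_arrow_smul, sub_self,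
        LinearMap.zero_apply])
    exact LinearMap.congr_fun this z
  obtain ⟨S, η, hη, hη'⟩ := h1 (QuiverArrow V × ι)
    (fun α => F₀ α ∘ₗ Algebra.lsmul k k _ (dualVertex (k := k) α.2.1))
    (fun α x => by
      have : Algebra.lsmul k k _ (dualVertex (k := k) α.1) ∘ₗ F₀ α = F₀ α := b.ext fun i => by
        rw [LinearMap.comp_apply, hF₀]
        refine (Finsupp.smul_single _ _ _).trans (congrArg _ ?_)
        exact PathAlgebra.vertex_mul_ofPath _
      exact LinearMap.congr_fun this _)
    (fun α x => by
      simp only [LinearMap.comp_apply, Algebra.lsmul_coe, PathAlgebra.vertex_smul_vertex_smul])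
  let P := (Finsupp.supported (PathAlgebra k Vᵒᵖ) (PathAlgebra k Vᵒᵖ)
    (S : Set (QuiverArrow V × ι))).map ζ
  have hP : P.FG := Submodule.FG.map ζ (Module.Finite.iff_fg.1 inferInstance)
  -- Correcting s₀ by ζη cancels the part of the obstruction outside the finite set S. What is left
  -- lies in ζ of the coordinates in S, that is in P, so s is A-linear modulo P.
  let s : X →ₗ[k] ι →₀ PathAlgebra k Vᵒᵖ := s₀ - ζ.restrictScalars k ∘ₗ η
  have hs (x) : s x = s₀ x - ζ (η x) := rfl
  let σ : X →ₗ[PathAlgebra k Vᵒᵖ] (ι →₀ PathAlgebra k Vᵒᵖ) ⧸ P := PathAlgebra.linearMapOfVertexArrow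
    (P.mkQ.restrictScalars k ∘ₗ s)
    (fun i x => by
      rw [LinearMap.comp_apply, LinearMap.comp_apply, LinearMap.restrictScalars_apply,
        LinearMap.restrictScalars_apply, ← map_smul, hs, hs, smul_sub, ← map_smul ζ, ← hη i.unop,
        hs₀' i.unop, hs₀'' i.unop])
    (fun {i j} a x => by
      let α : QuiverArrow V := ⟨j.unop, i.unop, a.unop⟩
      change P.mkQ (s (dual (k := k) α • x)) = dual (k := k) α • P.mkQ (s x)
      rw [← map_smul, ← sub_eq_zero, ← map_sub, Submodule.mkQ_apply, Submodule.Quotient.mk_eq_zero]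
      -- The defect s(α* x) - α* s(x) equals ζ of F₀ α (e_{t(α)} x) minus its forgotten version,
      -- which is supported in S.
      refine ⟨_, sub_forget_mem_supported S (F₀ α (dualVertex (k := k) α.2.1 • x)), ?_⟩
      have h2 := hη' α x
      rw [LinearMap.comp_apply, Algebra.lsmul_coe] at h2
      rw [h2, map_sub ζ, map_sub ζ, map_smul ζ, hζ, hs, hs, smul_sub,
        PathAlgebra.arrow_smul_vertex_smul,
        ← PathAlgebra.arrow_smul_vertex_smul α.2.2.op (s₀ x), hs₀'' α.2.1,
        PathAlgebra.arrow_smul_vertex_smul,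
        ← PathAlgebra.vertex_smul_arrow_smul (k := k) α.2.2.op x, hs₀' α.1,
        PathAlgebra.vertex_smul_arrow_smul]
      abel)
  refine finitePresentation_of_retract hP (P.liftQ μ ?_) σ (fun x => ?_) (h0 ι)
  · rintro _ ⟨z, -, rfl⟩
    exact hμζ z
  · change μ (s x) = x
    rw [hs, map_sub, hμs₀, hμζ, sub_zero]

/-- The module `F(M)` of a compact object is finitely presented. -/
theorem KoszulDual.finitePresentation_of_isCompactObj {M : DiffProj (RadSqZero k V)}
    {hM : M.IsReduced} (h : IsCompactObj M.toHomotopyCat) :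
    Module.FinitePresentation (PathAlgebra k Vᵒᵖ) (KoszulDual M hM) :=
  finitePresentation_of_forget (fun _ => exists_forget_linearMap_eq_zero h)
    (fun _ => exists_forget_cocycle_eq h)

end RadSqZero

theorem proposition1p2 {k : Type u} [Field k] {V : Type u} [Quiver.{u} V] [Fintype V]
    [∀ i j : V, Fintype (i ⟶ j)] (M : DiffProj (RadSqZero k V)) (hM : M.IsReduced) :
    (FiniteDimensional k M ↔ FiniteDimensional k (RadSqZero.KoszulDual M hM)) ∧
    (IsCompactObj M.toHomotopyCat ↔
      Module.FinitePresentation (PathAlgebra k Vᵒᵖ) (RadSqZero.KoszulDual M hM)) ∧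
    (M.IsExact ↔
      ∀ n : ℕ, n = 0 ∨ n = 1 →
        Subsingleton (Abelian.Ext
          (ModuleCat.of (PathAlgebra k Vᵒᵖ) (PathAlgebra.vertexModule k Vᵒᵖ))
          (ModuleCat.of (PathAlgebra k Vᵒᵖ) (RadSqZero.KoszulDual M hM)) n)) :=
  ⟨RadSqZero.KoszulDual.finiteDimensional_iff,
    ⟨fun h => RadSqZero.KoszulDual.finitePresentation_of_isCompactObj h, fun _ =>
      (DiffProj.isCompactObj_iff M).2 fun _ T f =>
        RadSqZero.exists_isNullHomotopic_truncation hM T f⟩,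
    RadSqZero.KoszulDual.isExact_iff_ext⟩
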